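/- **Setting.** Space-time is $\mathbb{R}^2_{\rm c}=([-\infty,\infty]\times\mathbb{R})\cup\{(\ast,-\infty),(\ast,\infty)\}$, with the compact metrisable topology that is the product topology on $[-\infty,\infty]\times\mathbb{R}$ and for which $(x_n,t_n)\to(\ast,\pm\infty)$ if and only if $t_n\to\pm\infty$. The set $\Pi$ consists of the càdlàg paths $f$ on closed intervals $[\sigma_f,\tau_f]\subseteq[-\infty,\infty]$ with values in $[-\infty,\infty]$: at each finite time $t$ of its domain, $f$ has values $f(t-)$ and $f(t+)$ such that $t\mapsto f(t+)$ is right continuous with left limits, and $f(t-)$ is the left limit at $t$ if $t>\sigma_f$, while $f(\sigma_f-)$ is arbitrary. No values are attached to the times $\pm\infty$. The interpolated graph $H(f)\subseteq\mathbb{R}^2_{\rm c}$ consists of the points $(x,t)$ with $t\in[\sigma_f,\tau_f]$ and, if $t$ is finite, $x$ between $f(t-)$ and $f(t+)$ (inclusive); if $t=\pm\infty$, the point is $(\ast,\pm\infty)$. It is totally ordered by time and, at each finite time $t$, from $f(t-)$ to $f(t+)$; $H^{(2)}(f)$ is the set of pairs $(z_1,z_2)\in H(f)^2$ such that $z_1$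 is equal to or precedes $z_2$. The set $\Pi$ has the M1 topology, in which $f_n\to f$ if and only if $H^{(2)}(f_n)\to H^{(2)}(f)$ in the Hausdorff metric, and the set $\mathcal{K}(\Pi)$ of nonempty compact subsets of $\Pi$ has the topology of the Hausdorff metric. Let $\Pi^\uparrow=\{f:\tau_f=\infty\}$ and $\Pi^\updownarrow=\{f:\sigma_f=-\infty,\ \tau_f=\infty\}$, and let $\mathcal{K}(\Pi^\uparrow)\subseteq\mathcal{K}(\Pi)$ be the set of nonempty compact subsets of $\Pi^\uparrow$. A path $g$ *extends* $f$, written $f\subseteq g$, if $H^{(2)}(f)\subseteq H^{(2)}(g)$. Paths $f,g$ are *non-crossing* if there are $f',g'\in\Pi^\updownarrow$ with $f\subseteq f'$, $g\subseteq g'$ such that either $f'(t\pm)\le g'(t\pm)$ for all $t\in\mathbb{R}$, or $g'(t\pm)\le f'(t\pm)$ for all $t\in\mathbb{R}$. A set of paths is non-crossing if all pairs of its elements are. For $A\subseteq\Pi^\uparrow$, let $A(z)=\{f\in A: z\in H(f)\}$. The set $A$ is *pervasive* if $A(z)\neq\emptyset$ for all $z\in\mathbb{R}^2_{\rm c}$.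 A point $z$ is *non-ramified* in $A$ if any two elements of $A(z)$ are comparable under $\subseteq$; a set $D\subseteq\mathbb{R}^2_{\rm c}$ is non-ramified in $A$ if all its points are. For $f\in\Pi^\uparrow$ and $z\in H(f)$, let $f|_z\in\Pi^\uparrow$ be the path $g\subseteq f$ with initial point $(g(\sigma_g-),\sigma_g)=z$; let $A|_D=\{f|_z: z\in D,\ f\in A(z)\}$, and let $A_\uparrow=\{g\in\Pi^\uparrow: g\subseteq f\text{ for some }f\in A\}$. For a compact, pervasive and non-crossing $A\subseteq\Pi^\uparrow$, let $\operatorname{web}(A)=\overline{(A|_D)_\uparrow}$, where $D\subseteq\mathbb{R}^2$ is dense and non-ramified in $A$; this does not depend on the choice of $D$, and $D$ may be taken to be the set of all points of $\mathbb{R}^2$ that are non-ramified in $A$. A *weave* is (the law of) a $\mathcal{K}(\Pi^\uparrow)$-valued random variable that is almost surely pervasive and non-crossing. For weaves $\mathcal{A},\mathcal{B}$, write $\mathcal{A}\sim\mathcal{B}$ if $\operatorname{web}(\mathcal{A})$ and $\operatorname{web}(\mathcal{B})$ are equal in law. If $\vec z=(z_1,\dots,z_m)$ is a finite sequence of points of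 $\mathbb{R}^2_{\rm c}$ such that almost surely each $z_i$ is non-ramified in $\mathcal{A}$, then the *$m$-particle motion* $\mathcal{A}|_{\vec z}$ is the random element $(f_1,\dots,f_m)$ of $\Pi^m$ for which almost surely $\mathcal{A}|_{\{z_i\}}=\{f_i\}$ for all $i$. **Theorem 2.6.** Let $\mathcal{A},\mathcal{B}$ be weaves. 1. Suppose that $\mathcal{A}\sim\mathcal{B}$. If $\vec z$ is a finite sequence of (deterministic) points of $\mathbb{R}^2_{\rm c}$ that are almost surely non-ramified in $\mathcal{A}$ and almost surely non-ramified in $\mathcal{B}$, then $\mathcal{A}|_{\vec z}$ and $\mathcal{B}|_{\vec z}$ are equal in law. 2. The following are equivalent: - (a) $\mathcal{A}\sim\mathcal{B}$; - (b) there is a coupling of $\mathcal{A}$ and $\mathcal{B}$ under which $\mathcal{A}\cup\mathcal{B}$ is almost surely non-crossing; - (c) there is a deterministic countable dense set $D\subseteq\mathbb{R}^2$ that is almost surely non-ramified in $\mathcal{A}$ and almost surely non-ramified in $\mathcal{B}$, such that $\mathcal{A}|_{\vec z}$ and $\mathcal{B}|_{\vec z}$ are equal in law for every finite sequence $\vec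 z$ of points of $D$. -/

import Mathlib

open Set Filter Topology MeasureTheory ProbabilityTheory TopologicalSpace

namespace Weaves

/-! ### Compactified space-time -/

/-- Space-time `([-∞, ∞] × ℝ) ∪ {(∗, -∞), (∗, ∞)}`; the first coordinate of `pt` is space, the
second is time. -/
inductive SpaceTime : Type
  | pt (x : EReal) (t : ℝ)
  | bot
  | top

/-- The point `(x, t)` of space-time, where all points with `t = -∞` (resp. `t = ∞`) are
identified with `(∗, -∞)` (resp. `(∗, ∞)`). -/
noncomputable def SpaceTime.mk (x t : EReal) : SpaceTime :=
  if t = ⊥ then .bot else if t = ⊤ then .top else .pt x t.toReal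

/-- Space-time is the quotient of `[-∞, ∞]²` in which the lines `t = -∞` and `t = ∞` are collapsed
to one point each. This is the metrisable topology that is the product topology on
`[-∞, ∞] × ℝ` and for which `(xₙ, tₙ) → (∗, ±∞)` if and only if `tₙ → ±∞`. -/
noncomputable instance : TopologicalSpace SpaceTime :=
  TopologicalSpace.coinduced (fun p : EReal × EReal => SpaceTime.mk p.1 p.2) inferInstance

/-- The inclusion of `ℝ²` in space-time. -/
def ofPlane (p : ℝ × ℝ) : SpaceTime := .pt (p.1 : EReal) p.2

/-! ### Càdlàg paths -/

/-- A càdlàg path on a closed interval `[σ, τ] ⊆ [-∞, ∞]`, with values in `[-∞, ∞]`: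
`left t` is `f(t-)` and `right t` is `f(t+)`, for each finite time `t`.

The function `t ↦ f(t+)` is right continuous with left limits, and `f(t-)` is its left limit at `t`,
except that the value `f(σ-)` at the left end of the initial time is arbitrary.
No value is attached to the times `±∞`, and the fields `left` and `right` are set to `0` outside
`[σ, τ]`, so that two paths are equal as terms of this type if and only if they have the same
domain and the same values at all finite times of the domain. -/
@[ext]
structure CadlagPath : Type where
  σ : EReal
  τ : EReal
  σ_le_τ : σ ≤ τ
  left : ℝ → EReal
  right : ℝ → EReal
  right_cont : ∀ t : ℝ, σ ≤ t → (t : EReal) < τ → Tendsto right (𝓝[>] t) (𝓝 (right t))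
  left_lim : ∀ t : ℝ, σ < t → (t : EReal) ≤ τ → Tendsto right (𝓝[<] t) (𝓝 (left t))
  off_domain : ∀ t : ℝ, ¬ (σ ≤ t ∧ (t : EReal) ≤ τ) → left t = 0 ∧ right t = 0

namespace CadlagPath

/-- The interpolated graph `H(f)`. -/
def graph (f : CadlagPath) : Set SpaceTime :=
  {z | match z with
    | .pt x t => f.σ ≤ t ∧ (t : EReal) ≤ f.τ ∧ x ∈ uIcc (f.left t) (f.right t)
    | .bot => f.σ = ⊥
    | .top => f.τ = ⊤}

/-- The total order on the interpolated graph `H(f)`: a point precedes another one if it has a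
smaller time, or the same time `t` and a position that is non-strictly closer to `f(t-)`. -/
def precedes (f : CadlagPath) : SpaceTime → SpaceTime → Prop
  | .pt x s, .pt y t => s < t ∨ (s = t ∧ x ∈ uIcc (f.left s) y)
  | .bot, _ => True
  | _, .top => True
  | _, _ => False

/-- The second order interpolated graph `H⁽²⁾(f)`. -/
def graph₂ (f : CadlagPath) : Set (SpaceTime × SpaceTime) :=
  {p | p.1 ∈ f.graph ∧ p.2 ∈ f.graph ∧ f.precedes p.1 p.2}

/-- The M1 topology: `fₙ → f` if and only if the (compact) second order interpolated graphs converge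
in the Hausdorff metric. On compact subsets of a metrisable space the topology of
the Hausdorff metric is the Vietoris topology. -/
noncomputable instance : TopologicalSpace CadlagPath :=
  TopologicalSpace.induced graph₂ (TopologicalSpace.vietoris (SpaceTime × SpaceTime))

noncomputable instance : MeasurableSpace CadlagPath := borel CadlagPath

instance : BorelSpace CadlagPath := ⟨rfl⟩

/-- `Extends g f`: the path `g` extends the path `f`. -/
def Extends (g f : CadlagPath) : Prop := f.graph₂ ⊆ g.graph₂

/-- The initial point `(f(σ-), σ)`. -/
noncomputable def initialPoint (f : CadlagPath) : SpaceTime :=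
  SpaceTime.mk (f.left f.σ.toReal) f.σ

/-- The set of forwards half-infinite paths. -/
def halfInfinite : Set CadlagPath := {f | f.τ = ⊤}

/-- The set of bi-infinite paths. -/
def biInfinite : Set CadlagPath := {f | f.σ = ⊥ ∧ f.τ = ⊤}

/-- Pointwise order of bi-infinite paths, at all `t-` and `t+` with `t` finite. -/
def StaysLeft (f g : CadlagPath) : Prop :=
  ∀ t : ℝ, f.left t ≤ g.left t ∧ f.right t ≤ g.right t

/-- Two paths are non-crossing if they have bi-infinite extensions one of which stays to the left
of the other. -/
def NonCrossing (f g : CadlagPath) : Prop :=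
  ∃ f' ∈ biInfinite, ∃ g' ∈ biInfinite,
    f'.Extends f ∧ g'.Extends g ∧ (f'.StaysLeft g' ∨ g'.StaysLeft f')

end CadlagPath

open CadlagPath

/-! ### Sets of paths -/

/-- A set of paths is non-crossing if all pairs of its elements are. -/
def SetNonCrossing (A : Set CadlagPath) : Prop := ∀ f ∈ A, ∀ g ∈ A, f.NonCrossing g

/-- The set `A(z)` of the paths in `A` that pass through `z`. -/
def through (A : Set CadlagPath) (z : SpaceTime) : Set CadlagPath := {f ∈ A | z ∈ f.graph}

/-- A set of paths is pervasive if it has a path through each point of space-time. -/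
def Pervasive (A : Set CadlagPath) : Prop := ∀ z, (through A z).Nonempty

/-- The point `z` is non-ramified in `A`: any two paths of `A` through `z` are comparable for
extension. -/
def NonRamified (A : Set CadlagPath) (z : SpaceTime) : Prop :=
  ∀ f ∈ through A z, ∀ g ∈ through A z, g.Extends f ∨ f.Extends g

/-- `A|_D`: the restrictions of the paths in `A` that pass through a point of `D` to their part
from that point on. The restriction of `f` from `z ∈ H(f)` is the half-infinite path with
initial point `z` that `f` extends. -/
def restrict (A : Set CadlagPath) (D : Set SpaceTime) : Set CadlagPath :=
  {g ∈ halfInfinite | ∃ z ∈ D, ∃ f ∈ through A z, f.Extends g ∧ g.initialPoint = z}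

/-- `A_↑`: the half-infinite paths that can be extended to an element of `A`. -/
def up (A : Set CadlagPath) : Set CadlagPath := {g ∈ halfInfinite | ∃ f ∈ A, f.Extends g}

/-- `web_D(A)`. -/
def webOn (D : Set SpaceTime) (A : Set CadlagPath) : Set CadlagPath := closure (up (restrict A D))

/-- `web(A)` is `web_D(A)` for a dense set `D ⊆ ℝ²` of non-ramified points of `A`. For a
compact, pervasive, non-crossing `A` its value does not depend on the choice of `D`;
we take for `D` the set of all non-ramified points of `A` in `ℝ²`. -/
def web (A : Set CadlagPath) : Set CadlagPath :=
  webOn {z ∈ range ofPlane | NonRamified A z} A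

/-! ### Random sets of paths -/

/-- The space of nonempty compact sets of paths; its Mathlib topology is that of the Hausdorff
metric. -/
abbrev PathSets : Type := NonemptyCompacts CadlagPath

noncomputable instance : MeasurableSpace PathSets := borel PathSets

instance : BorelSpace PathSets := ⟨rfl⟩

/-- A weave: the law of a random nonempty compact set of half-infinite paths that is almost surely
pervasive and non-crossing. -/
structure IsWeave (μ : Measure PathSets) : Prop where
  prob : IsProbabilityMeasure μ
  half_infinite : ∀ᵐ A : PathSets ∂μ, (A : Set CadlagPath) ⊆ halfInfinite
  pervasive : ∀ᵐ A : PathSets ∂μ, Pervasive (A : Set CadlagPath)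
  non_crossing : ∀ᵐ A : PathSets ∂μ, SetNonCrossing (A : Set CadlagPath)

/-- `F` is a version of the random variable `web(A)`, where `A` has law `μ`. -/
def IsWebVersion (μ : Measure PathSets) (F : PathSets → PathSets) : Prop :=
  ∀ᵐ A : PathSets ∂μ, (F A : Set CadlagPath) = web (A : Set CadlagPath)

/-- The equivalence of weaves: `web(A)` and `web(B)` are random variables with the same law, where
`A` has law `μ` and `B` has law `ν`. (Versions are almost surely unique.) -/
def WeaveEquiv (μ ν : Measure PathSets) : Prop :=
  ∃ F G : PathSets → PathSets, IsWebVersion μ F ∧ IsWebVersion ν G ∧ IdentDistrib F G μ ν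

/-- `F` is a version of the `m`-particle motion of `A` from `z`, where `A` has law `μ`: almost
surely, the `i`-th coordinate of `F A` is the only element of `A|_{z i}`. -/
def IsMotionVersion (μ : Measure PathSets) {m : ℕ} (z : Fin m → SpaceTime)
    (F : PathSets → Fin m → CadlagPath) : Prop :=
  ∀ᵐ A : PathSets ∂μ, ∀ i, restrict (A : Set CadlagPath) {z i} = {F A i}

/-- The `m`-particle motions from `z` of `A` and `B` are random variables with the same law, where
`A` has law `μ` and `B` has law `ν`. (Versions are almost surely unique.) -/
def SameMotion (μ ν : Measure PathSets) {m : ℕ} (z : Fin m → SpaceTime) : Prop :=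
  ∃ F G : PathSets → Fin m → CadlagPath,
    IsMotionVersion μ z F ∧ IsMotionVersion ν z G ∧ IdentDistrib F G μ ν

/-- The set `D` is almost surely non-ramified. -/
def AENonRamified (μ : Measure PathSets) (D : Set SpaceTime) : Prop :=
  ∀ᵐ A : PathSets ∂μ, ∀ z ∈ D, NonRamified (A : Set CadlagPath) z

/-- There is a coupling of `A` (with law `μ`) and `B` (with law `ν`) such that `A ∪ B` is almost
surely non-crossing. -/
def NonCrossingCoupling (μ ν : Measure PathSets) : Prop :=
  ∃ ρ : Measure (PathSets × PathSets), ρ.map Prod.fst = μ ∧ ρ.map Prod.snd = ν ∧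
    ∀ᵐ p : PathSets × PathSets ∂ρ, SetNonCrossing ((p.1 : Set CadlagPath) ∪ (p.2 : Set CadlagPath))

end Weaves

/-! The heart of the matter is deterministic: two compact, pervasive, non-crossing sets `A`, `B` of
half-infinite paths have the same web if and only if `A ∪ B` is non-crossing.

If `A ∪ B` is non-crossing, its ramified points are rare: all but countably many of their time
slices are countable (`hasCountableSlices_ramified`). Hence its non-ramified points are dense. From
such a point `A` and `B` start one and the same path, and the webs are generated by these paths
(`web_eq_of_nonCrossing`). Conversely, the common web has a path from each point, and no path of `A`
or `B` crosses it, because its elements are parts of paths of `A` and of `B`. If `f ∈ A` and `g ∈ B`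
crossed, a web path started in the gap between them before the crossing would be caught between the
two and keep them apart (`leftOf_or_leftOf_of_web`). Non-crossing is handled throughout by the
explicit inequalities `LeftOf`.

For random weaves, equality in law of the webs is turned into almost sure equality by a coupling
(`IdentDistrib.exists_coupling`); this gives (a) ⇒ (b), and the deterministic statement read under a
coupling gives (b) ⇒ (a) and the equality of motions. For (c) ⇒ (b), finite-dimensional laws
determine the law of the motion from all of `D`; coupling these motions to be equal makes the webs
equal. The set `D` of (c) exists by Fubini, since countable slices are Lebesgue null.

Compactness carries the topology. Along an ultrafilter, second order graphs converge, and the limit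
has every property of a second order graph except possibly antisymmetry (`isPathOrder_of_tendsto`,
`exists_graph₂_eq`). Antisymmetry is inherited as soon as the limit lies in the graph of a path
(`exists_tendsto_of_extends`). It is also a `Gδ` condition, so the space of paths is Polish. -/

namespace Weaves

/-! ### Topology of space-time -/

namespace SpaceTime

/-- The time coordinate of a point of space-time. -/
noncomputable def time : SpaceTime → EReal
  | pt _ t => t
  | bot => ⊥
  | top => ⊤

/-- The space coordinate of a point of space-time, with value `0` at the two infinite points. -/
noncomputable def space : SpaceTime → EReal
  | pt x _ => x
  | bot => 0
  | top => 0

@[simp] lemma time_pt (x : EReal) (t : ℝ) : (pt x t).time = t := rfl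
@[simp] lemma time_bot : bot.time = ⊥ := rfl
@[simp] lemma time_top : top.time = ⊤ := rfl
@[simp] lemma space_pt (x : EReal) (t : ℝ) : (pt x t).space = x := rfl

@[simp] lemma mk_coe (x : EReal) (t : ℝ) : mk x t = pt x t := by simp [mk]
@[simp] lemma mk_bot (x : EReal) : mk x ⊥ = bot := by simp [mk]
@[simp] lemma mk_top (x : EReal) : mk x ⊤ = top := by simp [mk]

lemma time_eq_bot_iff {z : SpaceTime} : z.time = ⊥ ↔ z = bot := by cases z <;> simp
lemma time_eq_top_iff {z : SpaceTime} : z.time = ⊤ ↔ z = top := by cases z <;> simp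
lemma time_eq_coe_iff {z : SpaceTime} {t : ℝ} : z.time = t ↔ z = pt z.space t := by
  cases z <;> simp [space]

@[simp] lemma time_mk (x t : EReal) : (mk x t).time = t := by
  induction t <;> simp

lemma surjective_mk : Function.Surjective (fun p : EReal × EReal => mk p.1 p.2) := by
  rintro (⟨x, t⟩ | _ | _)
  exacts [⟨(x, t), by simp⟩, ⟨(0, ⊥), by simp⟩, ⟨(0, ⊤), by simp⟩]

lemma isQuotientMap_mk : IsQuotientMap (fun p : EReal × EReal => mk p.1 p.2) :=
  ⟨⟨rfl⟩, surjective_mk⟩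

lemma continuous_mk : Continuous (fun p : EReal × EReal => mk p.1 p.2) :=
  isQuotientMap_mk.continuous

instance : CompactSpace SpaceTime := by
  have h := isCompact_range continuous_mk
  rw [surjective_mk.range_eq] at h
  exact ⟨h⟩

lemma continuous_time : Continuous time := by
  rw [isQuotientMap_mk.continuous_iff]
  exact continuous_snd.congr fun p => (time_mk _ _).symm

/-- An order isomorphism of the extended reals with the unit interval. -/
noncomputable def toUnitInterval : EReal ≃o Icc (0 : ℝ) 1 :=
  ENNReal.logOrderIso.symm.trans ENNReal.orderIsoUnitIntervalBirational

lemma continuous_toUnitInterval : Continuous fun x => (toUnitInterval x : ℝ) :=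
  continuous_subtype_val.comp toUnitInterval.continuous

lemma toUnitInterval_bot : (toUnitInterval ⊥ : ℝ) = 0 := by
  rw [toUnitInterval.map_bot]; rfl

lemma toUnitInterval_top : (toUnitInterval ⊤ : ℝ) = 1 := by
  rw [toUnitInterval.map_top]; rfl

/-- A continuous injection of space-time in a Hausdorff space. -/
noncomputable def embed (z : SpaceTime) : EReal × ℝ :=
  -- With time rescaled to the unit interval, the second factor vanishes exactly at times `±∞`.
  -- There it hides the default value of `space`, which would break continuity; at finite times it
  -- can be cancelled.
  (z.time, (toUnitInterval z.space : ℝ) *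
    ((toUnitInterval z.time : ℝ) * (1 - (toUnitInterval z.time : ℝ))))

lemma continuous_embed : Continuous embed := by
  rw [isQuotientMap_mk.continuous_iff]
  have h : Continuous fun p : EReal × EReal => (p.2, (toUnitInterval p.1 : ℝ) *
      ((toUnitInterval p.2 : ℝ) * (1 - (toUnitInterval p.2 : ℝ)))) := by
    have h1 := continuous_toUnitInterval.comp (continuous_fst (X := EReal) (Y := EReal))
    have h2 := continuous_toUnitInterval.comp (continuous_snd (X := EReal) (Y := EReal))
    exact continuous_snd.prodMk (h1.mul (h2.mul (continuous_const.sub h2)))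
  refine h.congr fun ⟨x, t⟩ => ?_
  induction t <;> simp [embed]

lemma injective_embed : Function.Injective embed := by
  intro z w h
  obtain ⟨h1, h2⟩ := Prod.mk.inj h
  rcases z with ⟨x, t⟩ | _ | _
  · obtain ⟨y, rfl⟩ : ∃ y, w = pt y t := ⟨_, time_eq_coe_iff.1 h1.symm⟩
    have h0 : (0 : ℝ) < toUnitInterval (t : EReal) := by
      exact toUnitInterval_bot.symm.trans_lt (toUnitInterval.strictMono (EReal.bot_lt_coe t))
    have h3 : (toUnitInterval (t : EReal) : ℝ) < 1 := by
      exact lt_of_lt_of_eq (toUnitInterval.strictMono (EReal.coe_lt_top t)) toUnitInterval_top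
    have h4 : (toUnitInterval (t : EReal) : ℝ) * (1 - (toUnitInterval (t : EReal) : ℝ)) ≠ 0 :=
      (mul_pos h0 (sub_pos.2 h3)).ne'
    have h5 := mul_right_cancel₀ h4 h2
    simpa using toUnitInterval.injective (Subtype.ext h5)
  · exact (time_eq_bot_iff.1 h1.symm).symm
  · exact (time_eq_top_iff.1 h1.symm).symm

instance : T2Space SpaceTime := T2Space.of_injective_continuous injective_embed continuous_embed

lemma isClosedEmbedding_embed : IsClosedEmbedding embed :=
  continuous_embed.isClosedEmbedding injective_embed

instance : SecondCountableTopology SpaceTime :=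
  isClosedEmbedding_embed.isEmbedding.secondCountableTopology

instance : MetrizableSpace SpaceTime :=
  isClosedEmbedding_embed.isEmbedding.metrizableSpace

lemma isOpenEmbedding_pt : IsOpenEmbedding fun p : EReal × ℝ => pt p.1 p.2 := by
  have h : Continuous fun p : EReal × ℝ => pt p.1 p.2 := by
    refine (continuous_mk.comp (continuous_fst.prodMk
      (continuous_coe_real_ereal.comp continuous_snd))).congr fun p => ?_
    simp
  refine .of_continuous_injective_isOpenMap h (fun p q hpq => ?_) fun W hW => ?_
  · cases p; cases q; simpa using hpq
  · rw [← isQuotientMap_mk.isOpen_preimage]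
    have : (fun p : EReal × EReal => mk p.1 p.2) ⁻¹' ((fun p : EReal × ℝ => pt p.1 p.2) '' W) =
        Prod.map id Real.toEReal '' W := by
      ext ⟨x, t⟩
      induction t <;> simp
    rw [this]
    exact (IsOpenEmbedding.id.prodMap EReal.isOpenEmbedding_coe).isOpenMap _ hW

lemma continuous_pt : Continuous fun p : EReal × ℝ => pt p.1 p.2 := isOpenEmbedding_pt.continuous

lemma continuousAt_space (x : EReal) (t : ℝ) : ContinuousAt space (pt x t) := by
  rw [← isOpenEmbedding_pt.continuousAt_iff (x := (x, t))]
  exact continuous_fst.continuousAt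

variable {ι : Type*} {l : Filter ι} {z : ι → SpaceTime}

lemma tendsto_pt_iff {x : EReal} {t : ℝ} : Tendsto z l (𝓝 (pt x t)) ↔
    Tendsto (fun i => (z i).time) l (𝓝 t) ∧ Tendsto (fun i => (z i).space) l (𝓝 x) := by
  refine ⟨fun h => ⟨(continuous_time.tendsto _).comp h, (continuousAt_space x t).tendsto.comp h⟩,
    fun ⟨h1, h2⟩ => ?_⟩
  have h3 : Tendsto (fun i => ((z i).space, (z i).time)) l (𝓝 (x, (t : EReal))) :=
    h2.prodMk_nhds h1
  have h4 := (continuous_mk.tendsto _).comp h3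
  simp only [mk_coe] at h4
  refine h4.congr' ?_
  filter_upwards [h1.eventually_ne (EReal.coe_ne_bot t), h1.eventually_ne (EReal.coe_ne_top t)]
    with i hi hi'
  cases hz : z i <;> simp_all

/-- A net of points that converges to a point with a finite time consists eventually of points with
a finite time. -/
lemma eventually_eq_pt {x : EReal} {t : ℝ} (h : Tendsto z l (𝓝 (pt x t))) :
    ∀ᶠ i in l, z i = pt (z i).space (z i).time.toReal := by
  have h1 := (tendsto_pt_iff.1 h).1
  filter_upwards [h1.eventually_ne (EReal.coe_ne_bot t), h1.eventually_ne (EReal.coe_ne_top t)]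
    with i hi hi'
  cases hz : z i <;> simp_all

lemma exists_tendsto (U : Ultrafilter ι) (z : ι → SpaceTime) : ∃ w, Tendsto z U (𝓝 w) := by
  obtain ⟨w, -, hw⟩ := isCompact_univ.ultrafilter_le_nhds (U.map z) (by simp)
  exact ⟨w, hw⟩

end SpaceTime

lemma continuous_ofPlane : Continuous ofPlane :=
  SpaceTime.continuous_pt.comp
    ((continuous_coe_real_ereal.comp continuous_fst).prodMk continuous_snd)

lemma denseRange_ofPlane : DenseRange ofPlane := by
  have h0 : DenseRange Real.toEReal := dense_of_exists_between fun _ _ h => by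
    obtain ⟨c, hc⟩ := EReal.lt_iff_exists_real_btwn.1 h
    exact ⟨c, mem_range_self c, hc⟩
  have h1 : DenseRange fun p : ℝ × ℝ => ((p.1 : EReal), (p.2 : EReal)) := h0.prodMap h0
  refine (SpaceTime.surjective_mk.denseRange.comp h1 SpaceTime.continuous_mk).mono ?_
  rintro _ ⟨p, rfl⟩
  exact ⟨p, by simp [ofPlane]⟩

/-! ### Limits in the Vietoris topology -/

section Vietoris

variable {X ι : Type*} [TopologicalSpace X] {l : Filter ι} {R : ι → Set X} {R₀ : Set X}

attribute [local instance] TopologicalSpace.vietoris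

/-- With the next lemma this describes Vietoris limits by convergence of points. It is used mostly
along ultrafilters, where points of the compact space-time always have limits. -/
lemma mem_of_tendsto_vietoris [RegularSpace X] [l.NeBot] (h : Tendsto R l (𝓝 R₀))
    (hR₀ : IsClosed R₀) {z : ι → X} {w : X} (hz : Tendsto z l (𝓝 w)) (hm : ∀ᶠ i in l, z i ∈ R i) :
    w ∈ R₀ := by
  by_contra hw
  have h1 : Disjoint (𝓝ˢ R₀) (𝓝 w) := disjoint_nhdsSet_nhds.2 (by rwa [hR₀.closure_eq])
  obtain ⟨U, hU, V, hV, hUV⟩ := Filter.disjoint_iff.1 h1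
  obtain ⟨U', hU', hRU, hUU⟩ := mem_nhdsSet_iff_exists.1 hU
  have h2 := h.eventually (hU'.powerset_vietoris.mem_nhds hRU)
  obtain ⟨i, hi1, hi2, hi3⟩ := (h2.and (hm.and (hz.eventually hV))).exists
  exact hUV.le_bot ⟨hUU (hi1 hi2), hi3⟩

lemma exists_tendsto_of_mem_vietoris [PseudoMetrizableSpace X] (h : Tendsto R l (𝓝 R₀))
    (hR : ∀ i, IsCompact (R i)) (hne : ∀ i, (R i).Nonempty) {w : X} (hw : w ∈ R₀) :
    ∃ z : ι → X, (∀ i, z i ∈ R i) ∧ Tendsto z l (𝓝 w) := by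
  let _ := pseudoMetrizableSpacePseudoMetric X
  -- Points of `R i` nearest to `w`: they are within `ε` of `w` as soon as `R i` meets the `ε`-ball.
  choose z hz hzd using fun i => (hR i).exists_infDist_eq_dist (hne i) w
  refine ⟨z, hz, Metric.tendsto_nhds.2 fun ε hε => ?_⟩
  have h1 := h.eventually ((vietoris.isOpen_inter_nonempty_of_isOpen
    (Metric.isOpen_ball (x := w) (ε := ε))).mem_nhds ⟨w, hw, Metric.mem_ball_self hε⟩)
  filter_upwards [h1] with i ⟨y, hy, hyw⟩
  rw [dist_comm, ← hzd i]
  exact (Metric.infDist_le_dist_of_mem hy).trans_lt (by rwa [dist_comm])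

lemma mem_of_tendsto_compacts [T3Space X] [l.NeBot] {K : ι → NonemptyCompacts X}
    {K₀ : NonemptyCompacts X} (h : Tendsto K l (𝓝 K₀)) {z : ι → X} {w : X}
    (hz : Tendsto z l (𝓝 w)) (hm : ∀ᶠ i in l, z i ∈ K i) : w ∈ K₀ :=
  mem_of_tendsto_vietoris ((NonemptyCompacts.continuous_coe.tendsto K₀).comp h)
    K₀.isCompact.isClosed hz hm

lemma exists_tendsto_of_mem_compacts [PseudoMetrizableSpace X] {K : ι → NonemptyCompacts X}
    {K₀ : NonemptyCompacts X} (h : Tendsto K l (𝓝 K₀)) {w : X} (hw : w ∈ K₀) :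
    ∃ z : ι → X, (∀ i, z i ∈ K i) ∧ Tendsto z l (𝓝 w) :=
  exists_tendsto_of_mem_vietoris ((NonemptyCompacts.continuous_coe.tendsto K₀).comp h)
    (fun i => (K i).isCompact) (fun i => (K i).nonempty) hw

/-- Along an ultrafilter, points of a convergent net of compact sets converge to a point of the
limit. -/
lemma exists_tendsto_mem_compacts {U : Ultrafilter ι} {K : ι → NonemptyCompacts X}
    {K₀ : NonemptyCompacts X} (h : Tendsto K U (𝓝 K₀)) {z : ι → X} (hz : ∀ᶠ i in U, z i ∈ K i) :
    ∃ w ∈ K₀, Tendsto z U (𝓝 w) := by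
  by_contra! hw
  have h1 : ∀ w ∈ (K₀ : Set X), ∃ V : Set X, IsOpen V ∧ w ∈ V ∧ ∀ᶠ i in U, z i ∉ V := by
    intro w hwK
    obtain ⟨V, hV, hVU⟩ := Filter.not_tendsto_iff_exists_frequently_notMem.1 (hw w hwK)
    obtain ⟨V', hV', hVo, hwV⟩ := mem_nhds_iff.1 hV
    exact ⟨V', hVo, hwV, Ultrafilter.frequently_iff_eventually.1
      (hVU.mono fun i hi hi' => hi (hV' hi'))⟩
  choose! V hVo hwV hVU using h1
  obtain ⟨t, ht, hcov⟩ := K₀.isCompact.elim_nhds_subcover V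
    fun w hw => (hVo w hw).mem_nhds (hwV w hw)
  have h2 : ∀ᶠ i in U, (K i : Set X) ⊆ ⋃ x ∈ t, V x :=
    h.eventually ((NonemptyCompacts.isOpen_subsets_of_isOpen
      (isOpen_biUnion fun w hw => hVo w (ht w hw))).mem_nhds hcov)
  have h3 : ∀ᶠ i in U, ∀ w ∈ t, z i ∉ V w :=
    (Filter.eventually_all_finset t).2 fun w hw => hVU w (ht w hw)
  obtain ⟨i, hi1, hi2, hi3⟩ := (hz.and (h2.and h3)).exists
  obtain ⟨w, hw, hw'⟩ := mem_iUnion₂.1 (hi2 hi1)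
  exact hi3 w hw hw'

end Vietoris

end Weaves

namespace Weaves

open SpaceTime

/-! ### Interpolated graphs: total order, one-sided limits and closedness -/

lemma isClosed_setOf_mem_uIcc : IsClosed {p : EReal × EReal × EReal | p.1 ∈ uIcc p.2.1 p.2.2} := by
  simp only [uIcc, mem_Icc, ofPred_and]
  exact (isClosed_le (f := fun p : EReal × EReal × EReal => p.2.1 ⊓ p.2.2) (by fun_prop)
    (by fun_prop)).inter (isClosed_le (g := fun p : EReal × EReal × EReal => p.2.1 ⊔ p.2.2)
      (by fun_prop) (by fun_prop))

lemma mem_uIcc_of_tendsto {ι : Type*} {l : Filter ι} [l.NeBot] {x a b : ι → EReal}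
    {x₀ a₀ b₀ : EReal} (hx : Tendsto x l (𝓝 x₀)) (ha : Tendsto a l (𝓝 a₀))
    (hb : Tendsto b l (𝓝 b₀)) (h : ∀ᶠ i in l, x i ∈ uIcc (a i) (b i)) : x₀ ∈ uIcc a₀ b₀ :=
  isClosed_setOf_mem_uIcc.mem_of_tendsto (hx.prodMk_nhds (ha.prodMk_nhds hb)) h

lemma tendsto_of_mem_uIcc {ι : Type*} {l : Filter ι} {x a b : ι → EReal} {y : EReal}
    (ha : Tendsto a l (𝓝 y)) (hb : Tendsto b l (𝓝 y)) (h : ∀ᶠ i in l, x i ∈ uIcc (a i) (b i)) :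
    Tendsto x l (𝓝 y) := by
  have h1 : Tendsto (fun i => a i ⊓ b i) l (𝓝 y) := by simpa using ha.inf_nhds hb
  have h2 : Tendsto (fun i => a i ⊔ b i) l (𝓝 y) := by simpa using ha.sup_nhds hb
  exact tendsto_of_tendsto_of_tendsto_of_le_of_le' h1 h2 (h.mono fun i hi => hi.1)
    (h.mono fun i hi => hi.2)

namespace CadlagPath

variable {f g : CadlagPath}

@[simp] lemma pt_mem_graph {x : EReal} {t : ℝ} :
    pt x t ∈ f.graph ↔ f.σ ≤ t ∧ (t : EReal) ≤ f.τ ∧ x ∈ uIcc (f.left t) (f.right t) := Iff.rfl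

@[simp] lemma bot_mem_graph : bot ∈ f.graph ↔ f.σ = ⊥ := Iff.rfl

@[simp] lemma top_mem_graph : top ∈ f.graph ↔ f.τ = ⊤ := Iff.rfl

@[simp] lemma precedes_pt {x y : EReal} {s t : ℝ} :
    f.precedes (pt x s) (pt y t) ↔ s < t ∨ (s = t ∧ x ∈ uIcc (f.left s) y) := Iff.rfl

@[simp] lemma bot_precedes {z : SpaceTime} : f.precedes bot z := by
  cases z <;> trivial

@[simp] lemma precedes_top {z : SpaceTime} : f.precedes z top := by
  cases z <;> trivial

@[simp] lemma pt_precedes_bot {x : EReal} {s : ℝ} : ¬ f.precedes (pt x s) bot := id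

@[simp] lemma top_precedes_pt {x : EReal} {s : ℝ} : ¬ f.precedes top (pt x s) := id

@[simp] lemma top_precedes_bot : ¬ f.precedes top bot := id

lemma mem_graph₂ {z w : SpaceTime} :
    (z, w) ∈ f.graph₂ ↔ z ∈ f.graph ∧ w ∈ f.graph ∧ f.precedes z w := Iff.rfl

lemma time_le_of_precedes {z w : SpaceTime} (h : f.precedes z w) : z.time ≤ w.time := by
  rcases z with ⟨x, s⟩ | _ | _ <;> rcases w with ⟨y, t⟩ | _ | _ <;> simp_all
  rcases h with h | h
  exacts [h.le, h.1.le]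

lemma precedes_of_time_lt {z w : SpaceTime} (h : z.time < w.time) : f.precedes z w := by
  rcases z with ⟨x, s⟩ | _ | _ <;> rcases w with ⟨y, t⟩ | _ | _ <;> simp_all

lemma precedes_refl (z : SpaceTime) : f.precedes z z := by
  rcases z with ⟨x, s⟩ | _ | _ <;> simp

lemma σ_le_time {z : SpaceTime} (h : z ∈ f.graph) : f.σ ≤ z.time := by
  rcases z with ⟨x, s⟩ | _ | _ <;> simp_all

lemma time_le_τ {z : SpaceTime} (h : z ∈ f.graph) : z.time ≤ f.τ := by
  rcases z with ⟨x, s⟩ | _ | _ <;> simp_all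

lemma mem_uIcc_or {a b x y : EReal} (hx : x ∈ uIcc a b) (hy : y ∈ uIcc a b) :
    x ∈ uIcc a y ∨ y ∈ uIcc a x := by
  simp only [mem_uIcc] at *
  grind

lemma eq_of_mem_uIcc {a x y : EReal} (hx : x ∈ uIcc a y) (hy : y ∈ uIcc a x) : x = y := by
  simp only [mem_uIcc] at *
  grind

lemma precedes_total {z w : SpaceTime} (hz : z ∈ f.graph) (hw : w ∈ f.graph) :
    f.precedes z w ∨ f.precedes w z := by
  rcases lt_trichotomy z.time w.time with h | h | h
  · exact .inl (precedes_of_time_lt h)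
  · rcases z with ⟨x, s⟩ | _ | _ <;> rcases w with ⟨y, t⟩ | _ | _ <;> try simp at h ⊢
    subst h
    simpa using mem_uIcc_or hz.2.2 hw.2.2
  · exact .inr (precedes_of_time_lt h)

lemma precedes_antisymm {z w : SpaceTime} (h1 : f.precedes z w) (h2 : f.precedes w z) : z = w := by
  have h := (time_le_of_precedes h1).antisymm (time_le_of_precedes h2)
  rcases z with ⟨x, s⟩ | _ | _ <;> rcases w with ⟨y, t⟩ | _ | _ <;> simp_all
  exact eq_of_mem_uIcc h1 h2

/-- At each time of the domain that is not the final time, the values at `t-` converge to the value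
at `t+` from the right. -/
lemma tendsto_left_nhdsGT {t : ℝ} (h1 : f.σ ≤ t) (h2 : (t : EReal) < f.τ) :
    Tendsto f.left (𝓝[>] t) (𝓝 (f.right t)) := by
  have h := f.right_cont t h1 h2
  -- Closed neighbourhoods suffice: `f(u-)` is a limit of values `f(v+)` with `t < v < u`, so it
  -- stays in any closed set that contains these.
  rw [(closed_nhds_basis (f.right t)).tendsto_right_iff]
  intro s ⟨hs, hsc⟩
  obtain ⟨b, hb, hbs⟩ := (mem_nhdsGT_iff_exists_Ioo_subset).1 (h hs)
  obtain ⟨c, hc, hcτ⟩ := EReal.lt_iff_exists_real_btwn.1 h2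
  have hb' : t < min b c := lt_min hb (EReal.coe_lt_coe_iff.1 hc)
  filter_upwards [Ioo_mem_nhdsGT hb'] with u hu
  have h3 := f.left_lim u (h1.trans_lt (EReal.coe_lt_coe_iff.2 hu.1))
    ((EReal.coe_lt_coe_iff.2 (hu.2.trans_le (min_le_right _ _))).trans hcτ).le
  refine hsc.mem_of_tendsto h3 ?_
  filter_upwards [Ioo_mem_nhdsLT hu.1] with v hv
  exact hbs ⟨hv.1, hv.2.trans (hu.2.trans_le (min_le_left _ _))⟩

lemma tendsto_left_nhdsLT {t : ℝ} (h1 : f.σ < t) (h2 : (t : EReal) ≤ f.τ) :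
    Tendsto f.left (𝓝[<] t) (𝓝 (f.left t)) := by
  have h := f.left_lim t h1 h2
  rw [(closed_nhds_basis (f.left t)).tendsto_right_iff]
  intro s ⟨hs, hsc⟩
  obtain ⟨b, hb, hbs⟩ := (mem_nhdsLT_iff_exists_Ioo_subset).1 (h hs)
  obtain ⟨c, hcσ, hc⟩ := EReal.lt_iff_exists_real_btwn.1 h1
  have hb' : max b c < t := max_lt hb (EReal.coe_lt_coe_iff.1 hc)
  filter_upwards [Ioo_mem_nhdsLT hb'] with u hu
  have h3 := f.left_lim u (hcσ.trans (EReal.coe_lt_coe_iff.2 ((le_max_right _ _).trans_lt hu.1)))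
    ((EReal.coe_lt_coe_iff.2 hu.2).le.trans h2)
  refine hsc.mem_of_tendsto h3 ?_
  filter_upwards [Ioo_mem_nhdsLT ((le_max_left _ _).trans_lt hu.1)] with v hv
  exact hbs ⟨hv.1, hv.2.trans hu.2⟩

variable {ι : Type*} {l : Filter ι}

lemma tendsto_space_of_nhdsGT {x : ι → EReal} {s : ι → ℝ} {t : ℝ} (h1 : f.σ ≤ t)
    (h2 : (t : EReal) < f.τ) (hs : Tendsto s l (𝓝[>] t))
    (hx : ∀ᶠ i in l, x i ∈ uIcc (f.left (s i)) (f.right (s i))) :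
    Tendsto x l (𝓝 (f.right t)) :=
  tendsto_of_mem_uIcc ((tendsto_left_nhdsGT h1 h2).comp hs) ((f.right_cont t h1 h2).comp hs) hx

lemma tendsto_space_of_nhdsLT {x : ι → EReal} {s : ι → ℝ} {t : ℝ} (h1 : f.σ < t)
    (h2 : (t : EReal) ≤ f.τ) (hs : Tendsto s l (𝓝[<] t))
    (hx : ∀ᶠ i in l, x i ∈ uIcc (f.left (s i)) (f.right (s i))) :
    Tendsto x l (𝓝 (f.left t)) :=
  tendsto_of_mem_uIcc ((tendsto_left_nhdsLT h1 h2).comp hs) ((f.left_lim t h1 h2).comp hs) hx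

/-- Along an ultrafilter, a convergent net of reals is eventually constant or converges from one
side. -/
lemma tendsto_trichotomy (U : Ultrafilter ι) {s : ι → ℝ} {t : ℝ} (hs : Tendsto s U (𝓝 t)) :
    Tendsto s U (𝓝[<] t) ∨ (∀ᶠ i in U, s i = t) ∨ Tendsto s U (𝓝[>] t) := by
  have h : ∀ᶠ i in U, s i < t ∨ s i = t ∨ t < s i := .of_forall fun i => lt_trichotomy _ _
  rw [Ultrafilter.eventually_or, Ultrafilter.eventually_or] at h
  exact h.imp (fun h => tendsto_nhdsWithin_iff.2 ⟨hs, h⟩)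
    (Or.imp_right fun h => tendsto_nhdsWithin_iff.2 ⟨hs, h⟩)

/-- The position at a limit time, for a net of points of the graph that converges from the left
(in the first case), has constant times (in the second case) or converges from the right. -/
lemma limit_cases (U : Ultrafilter ι) {x : ι → EReal} {s : ι → ℝ} {x₀ : EReal} {t : ℝ}
    (h : ∀ᶠ i in U, pt (x i) (s i) ∈ f.graph) (hx : Tendsto x U (𝓝 x₀)) (hs : Tendsto s U (𝓝 t)) :
    f.σ ≤ t ∧ (t : EReal) ≤ f.τ ∧
      (((∀ᶠ i in U, s i < t) ∧ x₀ = f.left t) ∨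
        ((∀ᶠ i in U, s i = t) ∧ x₀ ∈ uIcc (f.left t) (f.right t)) ∨
        ((∀ᶠ i in U, t < s i) ∧ x₀ = f.right t)) := by
  have hs' : Tendsto (fun i => (s i : EReal)) U (𝓝 t) :=
    (continuous_coe_real_ereal.tendsto t).comp hs
  have h1 : f.σ ≤ t := ge_of_tendsto hs' (h.mono fun i hi => hi.1)
  have h2 : (t : EReal) ≤ f.τ := le_of_tendsto hs' (h.mono fun i hi => hi.2.1)
  refine ⟨h1, h2, ?_⟩
  rcases tendsto_trichotomy U hs with h3 | h3 | h3
  · have h4 : ∀ᶠ i in U, s i < t := (tendsto_nhdsWithin_iff.1 h3).2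
    obtain ⟨i, hi, hi'⟩ := (h.and h4).exists
    exact .inl ⟨h4, tendsto_nhds_unique hx (tendsto_space_of_nhdsLT
      (hi.1.trans_lt (EReal.coe_lt_coe_iff.2 hi')) h2 h3 (h.mono fun i hi => hi.2.2))⟩
  · refine .inr (.inl ⟨h3, mem_uIcc_of_tendsto hx tendsto_const_nhds tendsto_const_nhds ?_⟩)
    filter_upwards [h, h3] with i hi hi'
    simpa [hi'] using hi.2.2
  · have h4 : ∀ᶠ i in U, t < s i := (tendsto_nhdsWithin_iff.1 h3).2
    obtain ⟨i, hi, hi'⟩ := (h.and h4).exists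
    exact .inr (.inr ⟨h4, tendsto_nhds_unique hx (tendsto_space_of_nhdsGT h1
      ((EReal.coe_lt_coe_iff.2 hi').trans_le hi.2.1) h3 (h.mono fun i hi => hi.2.2))⟩)

lemma mem_graph_of_tendsto (U : Ultrafilter ι) {z : ι → SpaceTime} {w : SpaceTime}
    (h : ∀ᶠ i in U, z i ∈ f.graph) (hz : Tendsto z U (𝓝 w)) : w ∈ f.graph := by
  have ht := (continuous_time.tendsto w).comp hz
  rcases w with ⟨x, t⟩ | _ | _
  · obtain ⟨h1, h2⟩ := tendsto_pt_iff.1 hz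
    have h3 := eventually_eq_pt hz
    have h4 : ∀ᶠ i in U, pt (z i).space (z i).time.toReal ∈ f.graph := by
      filter_upwards [h, h3] with i hi hi'
      rwa [← hi']
    have h5 : Tendsto (fun i => (z i).time.toReal) U (𝓝 t) :=
      (EReal.tendsto_toReal (EReal.coe_ne_top t) (EReal.coe_ne_bot t)).comp h1
    obtain ⟨h6, h7, h8⟩ := limit_cases U h4 h2 h5
    refine ⟨h6, h7, ?_⟩
    rcases h8 with h8 | h8 | h8
    · rw [h8.2]; exact left_mem_uIcc
    · exact h8.2
    · rw [h8.2]; exact right_mem_uIcc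
  · exact le_bot_iff.1 (ge_of_tendsto ht (h.mono fun i hi => σ_le_time hi))
  · exact top_le_iff.1 (le_of_tendsto ht (h.mono fun i hi => time_le_τ hi))

/-- Only limit pairs with a common finite time are at issue. By `limit_cases` each component arrives
from the left, at the time itself, or from the right, and the order of times excludes that the
second one arrives from an earlier side than the first. A limit from the left is `f(t-)` and one
from the right is `f(t+)`, the two ends of the segment, so the limits are in order. -/
lemma isClosed_graph₂ (f : CadlagPath) : IsClosed f.graph₂ := by
  rw [isClosed_iff_ultrafilter]
  rintro ⟨z, w⟩ U hU hmem
  have hz : Tendsto Prod.fst (U : Filter (SpaceTime × SpaceTime)) (𝓝 z) :=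
    (continuous_fst.tendsto (z, w)).mono_left hU
  have hw : Tendsto Prod.snd (U : Filter (SpaceTime × SpaceTime)) (𝓝 w) :=
    (continuous_snd.tendsto (z, w)).mono_left hU
  have hm : ∀ᶠ p in (U : Filter (SpaceTime × SpaceTime)), p ∈ f.graph₂ := hmem
  have hzm := mem_graph_of_tendsto U (hm.mono fun p hp => hp.1) hz
  have hwm := mem_graph_of_tendsto U (hm.mono fun p hp => hp.2.1) hw
  refine ⟨hzm, hwm, ?_⟩
  have hle : z.time ≤ w.time := le_of_tendsto_of_tendsto ((continuous_time.tendsto z).comp hz)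
    ((continuous_time.tendsto w).comp hw) (hm.mono fun p hp => time_le_of_precedes hp.2.2)
  rcases hle.lt_or_eq with h | h
  · exact precedes_of_time_lt h
  rcases z with ⟨x, s⟩ | _ | _ <;> rcases w with ⟨y, t⟩ | _ | _ <;> try simp at h ⊢
  subst h
  refine .inr ⟨rfl, ?_⟩
  have hz1 := eventually_eq_pt hz
  have hw1 := eventually_eq_pt hw
  obtain ⟨hz2, hz3⟩ := tendsto_pt_iff.1 hz
  obtain ⟨hw2, hw3⟩ := tendsto_pt_iff.1 hw
  have hz4 := (EReal.tendsto_toReal (EReal.coe_ne_top s) (EReal.coe_ne_bot s)).comp hz2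
  have hw4 := (EReal.tendsto_toReal (EReal.coe_ne_top s) (EReal.coe_ne_bot s)).comp hw2
  have hz5 : ∀ᶠ p in (U : Filter (SpaceTime × SpaceTime)),
      pt p.1.space p.1.time.toReal ∈ f.graph := by
    filter_upwards [hm, hz1] with p hp hp'
    rw [← hp']; exact hp.1
  have hw5 : ∀ᶠ p in (U : Filter (SpaceTime × SpaceTime)),
      pt p.2.space p.2.time.toReal ∈ f.graph := by
    filter_upwards [hm, hw1] with p hp hp'
    rw [← hp']; exact hp.2.1
  have hle' : ∀ᶠ p in (U : Filter (SpaceTime × SpaceTime)),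
      p.1.time.toReal < p.2.time.toReal ∨
        (p.1.time.toReal = p.2.time.toReal ∧ p.1.space ∈ uIcc (f.left p.1.time.toReal) p.2.space) := by
    filter_upwards [hm, hz1, hw1] with p hp hp1 hp2
    have := hp.2.2
    rw [hp1, hp2] at this
    simpa using this
  obtain ⟨-, -, h6⟩ := limit_cases U hz5 hz3 hz4
  obtain ⟨-, -, h7⟩ := limit_cases U hw5 hw3 hw4
  rw [EReal.toReal_coe] at h6 h7
  rcases h6 with h6 | h6 | h6
  · rw [h6.2]; exact left_mem_uIcc
  · rcases h7 with h7 | h7 | h7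
    · obtain ⟨p, hp1, hp2, hp3⟩ := (h6.1.and (h7.1.and hle')).exists
      grind
    · refine mem_uIcc_of_tendsto hz3 tendsto_const_nhds hw3 ?_
      filter_upwards [h6.1, h7.1, hle'] with p hp1 hp2 hp3
      rcases hp3 with hp3 | hp3
      · exact absurd hp3 (by simp [hp1, hp2])
      · simpa [hp1] using hp3.2
    · rw [h7.2]; exact h6.2
  · rcases h7 with h7 | h7 | h7
    · obtain ⟨p, hp1, hp2, hp3⟩ := (h6.1.and (h7.1.and hle')).exists
      grind
    · obtain ⟨p, hp1, hp2, hp3⟩ := (h6.1.and (h7.1.and hle')).exists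
      grind
    · rw [h6.2, h7.2]; exact right_mem_uIcc

lemma isCompact_graph₂ (f : CadlagPath) : IsCompact f.graph₂ := f.isClosed_graph₂.isCompact

lemma initialPoint_mem_graph (f : CadlagPath) : f.initialPoint ∈ f.graph := by
  have h := f.σ_le_τ
  unfold initialPoint
  cases hσ : f.σ with
  | bot => simp [hσ]
  | top => simpa [hσ] using h
  | coe t => simp_all

@[simp] lemma time_initialPoint (f : CadlagPath) : f.initialPoint.time = f.σ := by
  simp [initialPoint]

lemma initialPoint_precedes {z : SpaceTime} (hz : z ∈ f.graph) :
    f.precedes f.initialPoint z := by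
  have h := σ_le_time hz
  unfold initialPoint
  cases hσ : f.σ with
  | bot => simp
  | top =>
    rw [hσ, top_le_iff, time_eq_top_iff] at h
    simp [h]
  | coe t =>
    rcases z with ⟨x, s⟩ | _ | _
    · obtain ⟨h1, h2, h3⟩ := hz
      rw [hσ, EReal.coe_le_coe_iff] at h1
      rcases h1.lt_or_eq with h1 | rfl <;> simp [*]
    · simp [hσ] at hz
    · simp

lemma mem_graph₂_self {z : SpaceTime} : (z, z) ∈ f.graph₂ ↔ z ∈ f.graph :=
  ⟨fun h => h.1, fun h => ⟨h, h, precedes_refl z⟩⟩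

lemma nonempty_graph₂ (f : CadlagPath) : f.graph₂.Nonempty :=
  ⟨_, mem_graph₂_self.2 f.initialPoint_mem_graph⟩

lemma graph_subset_of_graph₂_subset (h : f.graph₂ ⊆ g.graph₂) : f.graph ⊆ g.graph :=
  fun _ hz => (h (mem_graph₂_self.2 hz)).1

end CadlagPath

end Weaves

namespace Weaves

open SpaceTime

namespace CadlagPath

variable {f g : CadlagPath}

/-! ### A path is determined by its second order graph -/

lemma exists_mem_graph_time_eq {t : EReal} (h1 : f.σ ≤ t) (h2 : t ≤ f.τ) :
    ∃ z ∈ f.graph, z.time = t := by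
  induction t with
  | bot => exact ⟨bot, by simpa using h1, rfl⟩
  | top => exact ⟨top, by simpa using h2, rfl⟩
  | coe t => exact ⟨pt (f.left t) t, by simp [h1, h2], rfl⟩

lemma σ_le_of_graph_subset (h : f.graph ⊆ g.graph) : g.σ ≤ f.σ := by
  obtain ⟨z, hz, hzt⟩ := exists_mem_graph_time_eq (f := f) le_rfl f.σ_le_τ
  exact hzt ▸ σ_le_time (h hz)

lemma τ_le_of_graph_subset (h : f.graph ⊆ g.graph) : f.τ ≤ g.τ := by
  obtain ⟨z, hz, hzt⟩ := exists_mem_graph_time_eq (f := f) f.σ_le_τ le_rfl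
  exact hzt ▸ time_le_τ (h hz)

/-- In the slice at time `t`, `f(t-)` is the first point and `f(t+)` the last one, so antisymmetry
recovers both from the order. -/
lemma injective_graph₂ : Function.Injective graph₂ := by
  intro f g h
  have hs1 := graph_subset_of_graph₂_subset h.subset
  have hs2 := graph_subset_of_graph₂_subset h.symm.subset
  have hσ := (σ_le_of_graph_subset hs2).antisymm (σ_le_of_graph_subset hs1)
  have hτ := (τ_le_of_graph_subset hs1).antisymm (τ_le_of_graph_subset hs2)
  have hL : ∀ t : ℝ, f.σ ≤ t → (t : EReal) ≤ f.τ → f.left t = g.left t := by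
    intro t h1 h2
    have hf : pt (f.left t) t ∈ f.graph := by simp [h1, h2]
    have hg : pt (g.left t) t ∈ g.graph := by simp [← hσ, ← hτ, h1, h2]
    have h3 : (pt (f.left t) t, pt (g.left t) t) ∈ f.graph₂ := ⟨hf, hs2 hg, by simp⟩
    have h4 : (pt (g.left t) t, pt (f.left t) t) ∈ g.graph₂ := ⟨hg, hs1 hf, by simp⟩
    simpa using precedes_antisymm h3.2.2 (h.symm.subset h4).2.2
  have hR : ∀ t : ℝ, f.σ ≤ t → (t : EReal) ≤ f.τ → f.right t = g.right t := by
    intro t h1 h2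
    have hf : pt (f.right t) t ∈ f.graph := by simp [h1, h2]
    have hg : pt (g.right t) t ∈ g.graph := by simp [← hσ, ← hτ, h1, h2]
    have h3 : (pt (g.right t) t, pt (f.right t) t) ∈ f.graph₂ :=
      ⟨hs2 hg, hf, .inr ⟨rfl, (hs2 hg).2.2⟩⟩
    have h4 : (pt (f.right t) t, pt (g.right t) t) ∈ g.graph₂ :=
      ⟨hs1 hf, hg, .inr ⟨rfl, (hs1 hf).2.2⟩⟩
    simpa using precedes_antisymm (h.symm.subset h4).2.2 h3.2.2
  ext : 1
  · exact hσ
  · exact hτ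
  · funext t
    by_cases h : f.σ ≤ t ∧ (t : EReal) ≤ f.τ
    · exact hL t h.1 h.2
    · rw [(f.off_domain t h).1, (g.off_domain t (hσ ▸ hτ ▸ h)).1]
  · funext t
    by_cases h : f.σ ≤ t ∧ (t : EReal) ≤ f.τ
    · exact hR t h.1 h.2
    · rw [(f.off_domain t h).2, (g.off_domain t (hσ ▸ hτ ▸ h)).2]

/-! ### Reflection -/

lemma tendsto_neg_ereal {ι : Type*} {l : Filter ι} {x : ι → EReal} {y : EReal}
    (h : Tendsto x l (𝓝 y)) : Tendsto (fun i => - x i) l (𝓝 (-y)) :=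
  (continuous_neg.tendsto y).comp h

/-- The reflection of a path in the time axis. -/
@[simps]
noncomputable def neg (f : CadlagPath) : CadlagPath where
  σ := f.σ
  τ := f.τ
  σ_le_τ := f.σ_le_τ
  left t := - f.left t
  right t := - f.right t
  right_cont t h1 h2 := tendsto_neg_ereal (f.right_cont t h1 h2)
  left_lim t h1 h2 := tendsto_neg_ereal (f.left_lim t h1 h2)
  off_domain t h := by simp [f.off_domain t h]

lemma neg_neg_path (f : CadlagPath) : f.neg.neg = f := by
  ext <;> simp

lemma neg_mem_uIcc_neg {x a b : EReal} : -x ∈ uIcc (-a) (-b) ↔ x ∈ uIcc a b := by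
  simp only [mem_uIcc, EReal.neg_le_neg_iff]
  tauto

lemma pt_neg_mem_graph_neg {x : EReal} {t : ℝ} : pt (-x) t ∈ f.neg.graph ↔ pt x t ∈ f.graph := by
  simp [neg_mem_uIcc_neg]

lemma neg_precedes_neg {x y : EReal} {s t : ℝ} :
    f.neg.precedes (pt (-x) s) (pt (-y) t) ↔ f.precedes (pt x s) (pt y t) := by
  simp [neg_mem_uIcc_neg]

/-! ### Intermediate values -/

lemma mem_graph₂_of_mem_uIcc {x y x' : EReal} {s : ℝ} (h : (pt x s, pt x' s) ∈ f.graph₂)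
    (hy : y ∈ uIcc x x') : (pt x s, pt y s) ∈ f.graph₂ ∧ (pt y s, pt x' s) ∈ f.graph₂ := by
  obtain ⟨⟨h1, h2, h3⟩, ⟨-, -, h4⟩, h5⟩ := h
  simp only [precedes_pt, lt_self_iff_false, true_and, false_or] at h5
  simp only [mem_graph₂, pt_mem_graph, h1, h2, precedes_pt, lt_self_iff_false, true_and, false_or]
  simp only [mem_uIcc] at *
  refine ⟨⟨by grind, by grind, by grind⟩, by grind, by grind, by grind⟩

/-- An intermediate value theorem: since the graph contains the jumps as segments, it cannot skip a
level. It serves to find intermediate points of limits of graphs, where approximating points need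
not share a time. -/
lemma exists_space_eq_of_lt {x y x' : EReal} {s t : ℝ} (h : (pt x s, pt x' t) ∈ f.graph₂)
    (h1 : x < y) (h2 : y < x') :
    ∃ u : ℝ, (pt x s, pt y u) ∈ f.graph₂ ∧ (pt y u, pt x' t) ∈ f.graph₂ := by
  have hx := h.1
  have hx' := h.2.1
  rcases h.2.2 with hst | ⟨rfl, -⟩
  swap
  · exact ⟨s, mem_graph₂_of_mem_uIcc h (mem_uIcc.2 (.inl ⟨h1.le, h2.le⟩))⟩
  have hdom : ∀ u, s ≤ u → u ≤ t → f.σ ≤ u ∧ (u : EReal) ≤ f.τ := fun u hu hu' =>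
    ⟨hx.1.trans (EReal.coe_le_coe_iff.2 hu), (EReal.coe_le_coe_iff.2 hu').trans hx'.2.1⟩
  have hsr : pt (f.right s) s ∈ f.graph := by simp [hx.1, hx.2.1]
  have htl : pt (f.left t) t ∈ f.graph := by simp [hx'.1, hx'.2.1]
  rcases le_or_gt y (f.right s) with h3 | h3
  · have h4 : (pt x s, pt (f.right s) s) ∈ f.graph₂ := ⟨hx, hsr, .inr ⟨rfl, hx.2.2⟩⟩
    have h5 := mem_graph₂_of_mem_uIcc h4 (mem_uIcc.2 (.inl ⟨h1.le, h3⟩))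
    exact ⟨s, h5.1, h5.1.2.1, hx', .inl hst⟩
  rcases le_or_gt (f.left t) y with h4 | h4
  · have h5 : (pt (f.left t) t, pt x' t) ∈ f.graph₂ := ⟨htl, hx', by simp⟩
    have h6 := mem_graph₂_of_mem_uIcc h5 (mem_uIcc.2 (.inl ⟨h4, h2.le⟩))
    exact ⟨t, ⟨hx, h6.2.1, .inl hst⟩, h6.2⟩
  let S : Set ℝ := {v | v ∈ Ico s t ∧ f.right v < y}
  have hsS : s ∈ S := ⟨⟨le_rfl, hst⟩, h3⟩
  have hbdd : BddAbove S := ⟨t, fun v hv => hv.1.2.le⟩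
  have hsu : s ≤ sSup S := le_csSup hbdd hsS
  have hut : sSup S ≤ t := csSup_le ⟨s, hsS⟩ fun v hv => hv.1.2.le
  set u := sSup S with hu
  obtain ⟨hu1, hu2⟩ := hdom u hsu hut
  have hut' : u < t := by
    have h5 := (f.left_lim t (hx.1.trans_lt (EReal.coe_lt_coe_iff.2 hst)) hx'.2.1).eventually
      (lt_mem_nhds h4)
    obtain ⟨b, hb, hbs⟩ := (mem_nhdsLT_iff_exists_Ioo_subset).1 h5
    refine (csSup_le ⟨s, hsS⟩ fun v hv => ?_).trans_lt hb
    by_contra! hv'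
    exact absurd (hbs ⟨hv', hv.1.2⟩) (not_lt.2 hv.2.le)
  have hru : y ≤ f.right u := by
    refine ge_of_tendsto (f.right_cont u hu1
      ((EReal.coe_lt_coe_iff.2 hut').trans_le hx'.2.1)) ?_
    filter_upwards [Ioo_mem_nhdsGT hut'] with v hv
    by_contra! h5
    exact absurd (le_csSup hbdd (show v ∈ S from ⟨⟨hsu.trans hv.1.le, hv.2⟩, h5⟩)) (not_le.2 hv.1)
  have hsu' : s < u := hsu.lt_of_ne fun h => absurd (h ▸ hru) (not_le.2 h3)
  have hlu : f.left u ≤ y := by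
    refine le_of_tendsto_of_frequently (f.left_lim u
      (hx.1.trans_lt (EReal.coe_lt_coe_iff.2 hsu')) hu2) ?_
    refine Filter.frequently_iff.2 fun {W} hW => ?_
    obtain ⟨b, hb, hbs⟩ := (mem_nhdsLT_iff_exists_Ioo_subset).1 hW
    obtain ⟨v, hv, hbv⟩ := exists_lt_of_lt_csSup ⟨s, hsS⟩ (show b < sSup S from hb)
    refine ⟨v, hbs ⟨hbv, (le_csSup hbdd hv).lt_of_ne fun h => ?_⟩, hv.2.le⟩
    exact absurd (h ▸ hv.2 : f.right (sSup S) < y) (not_lt.2 hru)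
  have hyu : pt y u ∈ f.graph := ⟨hu1, hu2, mem_uIcc.2 (.inl ⟨hlu, hru⟩)⟩
  exact ⟨u, ⟨hx, hyu, .inl hsu'⟩, hyu, hx', .inl hut'⟩

lemma exists_space_eq {x y x' : EReal} {s t : ℝ} (h : (pt x s, pt x' t) ∈ f.graph₂)
    (hy : y ∈ uIcc x x') :
    ∃ u : ℝ, (pt x s, pt y u) ∈ f.graph₂ ∧ (pt y u, pt x' t) ∈ f.graph₂ := by
  have hx : (pt x s, pt x s) ∈ f.graph₂ := mem_graph₂_self.2 h.1
  have hx' : (pt x' t, pt x' t) ∈ f.graph₂ := mem_graph₂_self.2 h.2.1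
  rcases eq_or_ne x y with rfl | hxy
  · exact ⟨s, hx, h⟩
  rcases eq_or_ne y x' with rfl | hyx
  · exact ⟨t, h, hx'⟩
  rcases mem_uIcc.1 hy with ⟨h1, h2⟩ | ⟨h1, h2⟩
  · exact exists_space_eq_of_lt h (h1.lt_of_ne hxy) (h2.lt_of_ne hyx)
  · have key : ∀ {x y : EReal} {s t : ℝ},
        (pt (-x) s, pt (-y) t) ∈ f.neg.graph₂ ↔ (pt x s, pt y t) ∈ f.graph₂ := by
      intros
      rw [mem_graph₂, mem_graph₂, pt_neg_mem_graph_neg, pt_neg_mem_graph_neg, neg_precedes_neg]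
    obtain ⟨u, hu⟩ := exists_space_eq_of_lt (key.2 h)
      (EReal.neg_lt_neg_iff.2 (h2.lt_of_ne hxy.symm)) (EReal.neg_lt_neg_iff.2 (h1.lt_of_ne hyx.symm))
    exact ⟨u, by rwa [key, key] at hu⟩

end CadlagPath

/-! ### A characterisation of second order graphs -/

/-- The closed conditions that, together with antisymmetry, characterise the second order graphs
of càdlàg paths. -/
structure IsPathOrder (R : Set (SpaceTime × SpaceTime)) : Prop where
  refl : ∀ z w, (z, w) ∈ R → (z, z) ∈ R ∧ (w, w) ∈ R
  total : ∀ z w, (z, z) ∈ R → (w, w) ∈ R → (z, w) ∈ R ∨ (w, z) ∈ R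
  time_le : ∀ z w, (z, w) ∈ R → z.time ≤ w.time
  exists_time_eq : ∀ z w, (z, w) ∈ R → ∀ s : ℝ, z.time < s → s < w.time →
    ∃ x, (pt x s, pt x s) ∈ R
  mem_of_mem_uIcc : ∀ x x' y s, (pt x s, pt x' s) ∈ R → y ∈ uIcc x x' →
    (pt x s, pt y s) ∈ R ∧ (pt y s, pt x' s) ∈ R

lemma CadlagPath.isPathOrder_graph₂ (f : CadlagPath) : IsPathOrder f.graph₂ where
  refl _ _ h := ⟨mem_graph₂_self.2 h.1, mem_graph₂_self.2 h.2.1⟩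
  total _ _ hz hw := (precedes_total hz.1 hw.1).imp (fun h => ⟨hz.1, hw.1, h⟩)
    fun h => ⟨hw.1, hz.1, h⟩
  time_le _ _ h := time_le_of_precedes h.2.2
  exists_time_eq _ _ h s h1 h2 := ⟨f.left s, mem_graph₂_self.2
    ⟨(σ_le_time h.1).trans h1.le, h2.le.trans (time_le_τ h.2.1), left_mem_uIcc⟩⟩
  mem_of_mem_uIcc _ _ _ _ h hy := mem_graph₂_of_mem_uIcc h hy

namespace IsPathOrder

variable {R : Set (SpaceTime × SpaceTime)}

lemma mem_of_time_lt (h : IsPathOrder R) {z w : SpaceTime} (hz : (z, z) ∈ R) (hw : (w, w) ∈ R)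
    (hlt : z.time < w.time) : (z, w) ∈ R :=
  (h.total z w hz hw).resolve_right fun h' => absurd (h.time_le _ _ h') (not_le.2 hlt)

/-- A slice is compact, so it has a least and a greatest position; these are comparable in `R`, and
everything between them is then in the slice and in order. The direction of the comparison tells
which end is the value at `t-`. -/
lemma exists_slice (h : IsPathOrder R) (hR : IsClosed R) {t : ℝ} (hne : ∃ x, (pt x t, pt x t) ∈ R) :
    ∃ p : EReal × EReal, (∀ y, (pt y t, pt y t) ∈ R ↔ y ∈ uIcc p.1 p.2) ∧
      ∀ y ∈ uIcc p.1 p.2, (pt p.1 t, pt y t) ∈ R ∧ (pt y t, pt p.2 t) ∈ R := by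
  let S : Set EReal := {x | (pt x t, pt x t) ∈ R}
  have hc : Continuous fun x : EReal => (pt x t, pt x t) := by
    have : Continuous fun x : EReal => pt x t :=
      continuous_pt.comp (continuous_id.prodMk continuous_const)
    exact this.prodMk this
  have hS : IsCompact S := (hR.preimage hc).isCompact
  obtain ⟨a, ha, ha'⟩ := hS.exists_isLeast hne
  obtain ⟨b, hb, hb'⟩ := hS.exists_isGreatest hne
  have key : ∀ p q : EReal, (pt p t, pt q t) ∈ R → (∀ y ∈ S, y ∈ uIcc p q) →
      ∃ p : EReal × EReal, (∀ y, (pt y t, pt y t) ∈ R ↔ y ∈ uIcc p.1 p.2) ∧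
      ∀ y ∈ uIcc p.1 p.2, (pt p.1 t, pt y t) ∈ R ∧ (pt y t, pt p.2 t) ∈ R := by
    intro p q hpq hSpq
    refine ⟨(p, q), fun y => ⟨hSpq y, fun hy => ?_⟩, fun y hy => h.mem_of_mem_uIcc _ _ _ _ hpq hy⟩
    exact (h.refl _ _ (h.mem_of_mem_uIcc _ _ _ _ hpq hy).1).2
  rcases h.total _ _ ha hb with h1 | h1
  · exact key a b h1 fun y hy => mem_uIcc.2 (.inl ⟨ha' hy, hb' hy⟩)
  · exact key b a h1 fun y hy => mem_uIcc.2 (.inr ⟨ha' hy, hb' hy⟩)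

/-- The values at `t±` are the ends of the slice at `t`. The one-sided limits come from closedness
and antisymmetry: a limit point `x` of points at later times satisfies `(f(t+), x) ∈ R`, whereas
`f(t+)` is last in its slice, so `x = f(t+)`; similarly on the left with `f(t-)`. -/
theorem exists_graph₂_eq (h : IsPathOrder R) (hR : IsClosed R) (hne : R.Nonempty)
    (hanti : ∀ z w, (z, w) ∈ R → (w, z) ∈ R → z = w) : ∃ f : CadlagPath, f.graph₂ = R := by
  have hH : IsCompact {z | (z, z) ∈ R} := (hR.preimage (by fun_prop)).isCompact
  have hHne : {z | (z, z) ∈ R}.Nonempty := by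
    obtain ⟨⟨z, w⟩, hz⟩ := hne
    exact ⟨z, (h.refl _ _ hz).1⟩
  obtain ⟨z₀, hz₀, hmin⟩ := hH.exists_isMinOn hHne continuous_time.continuousOn
  obtain ⟨z₁, hz₁, hmax⟩ := hH.exists_isMaxOn hHne continuous_time.continuousOn
  have hmin' : ∀ z, (z, z) ∈ R → z₀.time ≤ z.time := fun z hz => hmin hz
  have hmax' : ∀ z, (z, z) ∈ R → z.time ≤ z₁.time := fun z hz => hmax hz
  have hz₀' : (z₀, z₀) ∈ R := hz₀
  have hz₁' : (z₁, z₁) ∈ R := hz₁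
  have hslice : ∀ t : ℝ, ∃ p : EReal × EReal, z₀.time ≤ t → t ≤ z₁.time →
      (∀ y, (pt y t, pt y t) ∈ R ↔ y ∈ uIcc p.1 p.2) ∧
      ∀ y ∈ uIcc p.1 p.2, (pt p.1 t, pt y t) ∈ R ∧ (pt y t, pt p.2 t) ∈ R := by
    intro t
    by_cases ht : z₀.time ≤ t ∧ t ≤ z₁.time
    · have h1 : ∃ x, (pt x t, pt x t) ∈ R := by
        rcases ht.1.lt_or_eq with h1 | h1
        · rcases ht.2.lt_or_eq with h2 | h2
          · exact h.exists_time_eq z₀ z₁ (h.mem_of_time_lt hz₀' hz₁' (h1.trans h2)) t h1 h2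
          · rw [time_eq_coe_iff.1 h2.symm] at hz₁'
            exact ⟨_, hz₁'⟩
        · rw [time_eq_coe_iff.1 h1] at hz₀'
          exact ⟨_, hz₀'⟩
      obtain ⟨p, hp⟩ := h.exists_slice hR h1
      exact ⟨p, fun _ _ => hp⟩
    · exact ⟨0, fun h1 h2 => absurd ⟨h1, h2⟩ ht⟩
  choose p hp using hslice
  have hleft : ∀ t : ℝ, z₀.time ≤ t → t ≤ z₁.time → (pt (p t).1 t, pt (p t).1 t) ∈ R :=
    fun t h1 h2 => ((hp t h1 h2).1 _).2 left_mem_uIcc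
  have hright : ∀ t : ℝ, z₀.time ≤ t → t ≤ z₁.time → (pt (p t).2 t, pt (p t).2 t) ∈ R :=
    fun t h1 h2 => ((hp t h1 h2).1 _).2 right_mem_uIcc
  have hlim : ∀ (t : ℝ) (U : Ultrafilter ℝ), (U : Filter ℝ) ≤ 𝓝 t →
      (∀ᶠ u : ℝ in U, z₀.time ≤ u ∧ u ≤ z₁.time) →
      ∃ x, Tendsto (fun u => (p u).2) U (𝓝 x) ∧ (pt x t, pt x t) ∈ R ∧
        Tendsto (fun u => pt (p u).2 u) U (𝓝 (pt x t)) := by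
    intro t U hU hdom
    obtain ⟨w, hw⟩ := exists_tendsto U fun u => pt (p u).2 u
    have h1 := tendsto_nhds_unique ((continuous_time.tendsto w).comp hw)
      ((continuous_coe_real_ereal.tendsto t).mono_left hU)
    obtain ⟨x, rfl⟩ : ∃ x, w = pt x t := ⟨_, time_eq_coe_iff.1 h1⟩
    exact ⟨x, (tendsto_pt_iff.1 hw).2, hR.mem_of_tendsto (hw.prodMk_nhds hw)
      (hdom.mono fun u hu => hright u hu.1 hu.2), hw⟩
  classical
  let f : CadlagPath :=
    { σ := z₀.time
      τ := z₁.time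
      σ_le_τ := hmin' _ hz₁'
      left := fun t => if z₀.time ≤ t ∧ t ≤ z₁.time then (p t).1 else 0
      right := fun t => if z₀.time ≤ t ∧ t ≤ z₁.time then (p t).2 else 0
      right_cont := by
        intro t h1 h2
        have hdom : ∀ᶠ u : ℝ in 𝓝[>] t, z₀.time ≤ u ∧ u ≤ z₁.time := by
          obtain ⟨c, hc, hcτ⟩ := EReal.lt_iff_exists_real_btwn.1 h2
          filter_upwards [Ioo_mem_nhdsGT (EReal.coe_lt_coe_iff.1 hc)] with u hu
          exact ⟨h1.trans (EReal.coe_le_coe_iff.2 hu.1.le),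
            (EReal.coe_le_coe_iff.2 hu.2.le).trans hcτ.le⟩
        rw [if_pos ⟨h1, h2.le⟩]
        refine Tendsto.congr' (f₁ := fun u => (p u).2)
          (hdom.mono fun u hu => (if_pos hu).symm) ?_
        rw [tendsto_iff_ultrafilter]
        intro U hU
        obtain ⟨x, hx, hxR, hxp⟩ := hlim t U (hU.trans nhdsWithin_le_nhds) (hU hdom)
        suffices h3 : (pt (p t).2 t, pt x t) ∈ R by
          have h4 := ((hp t h1 h2.le).2 x (((hp t h1 h2.le).1 x).1 hxR)).2
          have h5 := hanti _ _ h3 h4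
          simp only [pt.injEq, and_true] at h5
          rwa [h5]
        refine hR.mem_of_tendsto (tendsto_const_nhds.prodMk_nhds hxp) ?_
        filter_upwards [hU hdom, hU self_mem_nhdsWithin] with u hu hu'
        exact h.mem_of_time_lt (hright t h1 h2.le) (hright u hu.1 hu.2)
          (EReal.coe_lt_coe_iff.2 hu')
      left_lim := by
        intro t h1 h2
        have hdom : ∀ᶠ u : ℝ in 𝓝[<] t, z₀.time ≤ u ∧ u ≤ z₁.time := by
          obtain ⟨c, hcσ, hc⟩ := EReal.lt_iff_exists_real_btwn.1 h1
          filter_upwards [Ioo_mem_nhdsLT (EReal.coe_lt_coe_iff.1 hc)] with u hu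
          exact ⟨hcσ.le.trans (EReal.coe_le_coe_iff.2 hu.1.le),
            (EReal.coe_le_coe_iff.2 hu.2.le).trans h2⟩
        rw [if_pos ⟨h1.le, h2⟩]
        refine Tendsto.congr' (f₁ := fun u => (p u).2)
          (hdom.mono fun u hu => (if_pos hu).symm) ?_
        rw [tendsto_iff_ultrafilter]
        intro U hU
        obtain ⟨x, hx, hxR, hxp⟩ := hlim t U (hU.trans nhdsWithin_le_nhds) (hU hdom)
        suffices h3 : (pt x t, pt (p t).1 t) ∈ R by
          have h4 := ((hp t h1.le h2).2 x (((hp t h1.le h2).1 x).1 hxR)).1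
          have h5 := hanti _ _ h3 h4
          simp only [pt.injEq, and_true] at h5
          rwa [← h5]
        refine hR.mem_of_tendsto (hxp.prodMk_nhds tendsto_const_nhds) ?_
        filter_upwards [hU hdom, hU self_mem_nhdsWithin] with u hu hu'
        exact h.mem_of_time_lt (hright u hu.1 hu.2) (hleft t h1.le h2)
          (EReal.coe_lt_coe_iff.2 hu')
      off_domain := fun t ht => ⟨if_neg ht, if_neg ht⟩ }
  have hgraph : ∀ z, z ∈ f.graph ↔ (z, z) ∈ R := by
    rintro (⟨x, t⟩ | _ | _)
    · change z₀.time ≤ t ∧ t ≤ z₁.time ∧ x ∈ uIcc (if z₀.time ≤ t ∧ t ≤ z₁.time then (p t).1 else 0)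
        (if z₀.time ≤ t ∧ t ≤ z₁.time then (p t).2 else 0) ↔ _
      refine ⟨fun ⟨h1, h2, h3⟩ => ?_, fun h1 => ?_⟩
      · rw [if_pos ⟨h1, h2⟩, if_pos ⟨h1, h2⟩] at h3
        exact ((hp t h1 h2).1 x).2 h3
      · have h2 := hmin' _ h1
        have h3 := hmax' _ h1
        refine ⟨h2, h3, ?_⟩
        rw [if_pos ⟨h2, h3⟩, if_pos ⟨h2, h3⟩]
        exact ((hp t h2 h3).1 x).1 h1
    · change z₀.time = ⊥ ↔ _
      refine ⟨fun h1 => ?_, fun h1 => le_bot_iff.1 (hmin' _ h1)⟩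
      rw [time_eq_bot_iff] at h1
      exact h1 ▸ hz₀'
    · change z₁.time = ⊤ ↔ _
      refine ⟨fun h1 => ?_, fun h1 => top_le_iff.1 (hmax' _ h1)⟩
      rw [time_eq_top_iff] at h1
      exact h1 ▸ hz₁'
  refine ⟨f, ?_⟩
  ext ⟨z, w⟩
  rw [CadlagPath.mem_graph₂, hgraph, hgraph]
  suffices key : (z, z) ∈ R → (w, w) ∈ R → (f.precedes z w ↔ (z, w) ∈ R) from
    ⟨fun ⟨h1, h2, h3⟩ => (key h1 h2).1 h3, fun h1 =>
      ⟨(h.refl _ _ h1).1, (h.refl _ _ h1).2, (key (h.refl _ _ h1).1 (h.refl _ _ h1).2).2 h1⟩⟩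
  intro hz hw
  rcases lt_trichotomy z.time w.time with h1 | h1 | h1
  · exact iff_of_true (CadlagPath.precedes_of_time_lt h1) (h.mem_of_time_lt hz hw h1)
  · rcases z with ⟨x, s⟩ | _ | _ <;> rcases w with ⟨y, t⟩ | _ | _ <;> try simp at h1
    · subst h1
      have h2 := hmin' _ hz
      have h3 := hmax' _ hz
      rw [CadlagPath.precedes_pt]
      change s < s ∨ s = s ∧ x ∈ uIcc (if z₀.time ≤ s ∧ s ≤ z₁.time then (p s).1 else 0) y ↔ _
      rw [if_pos ⟨h2, h3⟩]
      simp only [lt_self_iff_false, true_and, false_or]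
      obtain ⟨h4, h5⟩ := hp s h2 h3
      rw [h4] at hz hw
      refine ⟨fun h6 => (h.mem_of_mem_uIcc _ _ _ _ (h5 y hw).1 h6).2, fun h6 => ?_⟩
      rcases CadlagPath.mem_uIcc_or hz hw with h7 | h7
      · exact h7
      · have h8 := hanti _ _ h6 (h.mem_of_mem_uIcc _ _ _ _ (h5 x hz).1 h7).2
        simp only [pt.injEq, and_true] at h8
        rw [h8]; exact right_mem_uIcc
    · exact iff_of_true (by simp) hz
    · exact iff_of_true (by simp) hz
  · exact iff_of_false (fun h2 => absurd (CadlagPath.time_le_of_precedes h2) (not_le.2 h1))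
      fun h2 => absurd (h.time_le _ _ h2) (not_le.2 h1)

end IsPathOrder

end Weaves

namespace Weaves

open SpaceTime

/-! ### Polish spaces -/

/-- A `Gδ` subset of a Polish space is Polish. -/
lemma _root_.IsGδ.polishSpace_subtype {X : Type*} [TopologicalSpace X] [PolishSpace X] {s : Set X}
    (hs : IsGδ s) : PolishSpace s := by
  obtain ⟨U, hU, rfl⟩ := isGδ_iff_eq_iInter_nat.1 hs
  have : ∀ n, PolishSpace (U n) := fun n => (hU n).polishSpace
  let φ : (⋂ n, U n : Set X) → ∀ n, U n := fun x n => ⟨x, mem_iInter.1 x.2 n⟩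
  have hφ : Continuous φ := continuous_pi fun n => continuous_subtype_val.subtype_mk _
  have hemb : IsEmbedding φ := by
    refine .of_comp hφ (g := fun y => (y 0 : X)) (by fun_prop) ?_
    exact IsEmbedding.subtypeVal
  have hr : range φ = {y | ∀ n, (y n : X) = y 0} := by
    ext y
    refine ⟨fun ⟨x, hx⟩ n => hx ▸ rfl, fun hy => ?_⟩
    exact ⟨⟨y 0, mem_iInter.2 fun n => hy n ▸ (y n).2⟩, funext fun n => Subtype.ext (hy n).symm⟩
  have hc : IsClosedEmbedding φ := ⟨hemb, by
    rw [hr, ofPred_forall]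
    exact isClosed_iInter fun n => isClosed_eq (by fun_prop) (by fun_prop)⟩
  exact hc.polishSpace

lemma _root_.Topology.IsEmbedding.polishSpace_of_isGδ {X Y : Type*} [TopologicalSpace X]
    [TopologicalSpace Y] [PolishSpace Y] {φ : X → Y} (hφ : IsEmbedding φ) (h : IsGδ (range φ)) :
    PolishSpace X :=
  have := h.polishSpace_subtype
  hφ.toHomeomorph.isClosedEmbedding.polishSpace

namespace CadlagPath

variable {ι : Type*} {l : Filter ι} {f g : CadlagPath}

/-- The second order graph as a nonempty compact set. -/
def toCompacts (f : CadlagPath) : NonemptyCompacts (SpaceTime × SpaceTime) :=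
  ⟨⟨f.graph₂, f.isCompact_graph₂⟩, f.nonempty_graph₂⟩

lemma isEmbedding_toCompacts : IsEmbedding toCompacts := by
  refine ⟨⟨?_⟩, fun f g h => injective_graph₂
    (congrArg (SetLike.coe : NonemptyCompacts (SpaceTime × SpaceTime) → _) h)⟩
  let _ : TopologicalSpace (Set (SpaceTime × SpaceTime)) := TopologicalSpace.vietoris _
  rw [NonemptyCompacts.isEmbedding_coe.eq_induced, induced_compose]
  rfl

instance : T2Space CadlagPath := isEmbedding_toCompacts.t2Space

instance : SecondCountableTopology CadlagPath := isEmbedding_toCompacts.secondCountableTopology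

/-- Each condition is inherited through approximating points. Antisymmetry is absent because it can
be lost: pairs in opposite orders may have the same limits. -/
lemma isPathOrder_of_tendsto {U : Ultrafilter ι} {f : ι → CadlagPath}
    {R : NonemptyCompacts (SpaceTime × SpaceTime)}
    (h : Tendsto (fun i => (f i).toCompacts) U (𝓝 R)) :
    IsPathOrder (R : Set (SpaceTime × SpaceTime)) where
  refl z w hzw := by
    obtain ⟨p, hp, hlim⟩ := exists_tendsto_of_mem_compacts h hzw
    have hz := (continuous_fst.tendsto _).comp hlim
    have hw := (continuous_snd.tendsto _).comp hlim
    exact ⟨mem_of_tendsto_compacts h (hz.prodMk_nhds hz)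
        (.of_forall fun i => mem_graph₂_self.2 (hp i).1),
      mem_of_tendsto_compacts h (hw.prodMk_nhds hw)
        (.of_forall fun i => mem_graph₂_self.2 (hp i).2.1)⟩
  total z w hz hw := by
    obtain ⟨p, hp, hp'⟩ := exists_tendsto_of_mem_compacts h hz
    obtain ⟨q, hq, hq'⟩ := exists_tendsto_of_mem_compacts h hw
    have hpz := (continuous_fst.tendsto _).comp hp'
    have hqw := (continuous_fst.tendsto _).comp hq'
    have h1 : ∀ᶠ i in U, ((p i).1, (q i).1) ∈ (f i).graph₂ ∨ ((q i).1, (p i).1) ∈ (f i).graph₂ :=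
      .of_forall fun i => (f i).isPathOrder_graph₂.total _ _
        (mem_graph₂_self.2 (hp i).1) (mem_graph₂_self.2 (hq i).1)
    rw [Ultrafilter.eventually_or] at h1
    exact h1.imp (mem_of_tendsto_compacts h (hpz.prodMk_nhds hqw))
      (mem_of_tendsto_compacts h (hqw.prodMk_nhds hpz))
  time_le z w hzw := by
    obtain ⟨p, hp, hlim⟩ := exists_tendsto_of_mem_compacts h hzw
    have hz := (continuous_fst.tendsto _).comp hlim
    have hw := (continuous_snd.tendsto _).comp hlim
    exact le_of_tendsto_of_tendsto' ((continuous_time.tendsto _).comp hz)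
      ((continuous_time.tendsto _).comp hw) fun i => time_le_of_precedes (hp i).2.2
  exists_time_eq z w hzw s hzs hsw := by
    obtain ⟨p, hp, hlim⟩ := exists_tendsto_of_mem_compacts h hzw
    have hz := (continuous_time.tendsto _).comp ((continuous_fst.tendsto _).comp hlim)
    have hw := (continuous_time.tendsto _).comp ((continuous_snd.tendsto _).comp hlim)
    have h1 : ∀ᶠ i in U, ∃ x, pt x s ∈ (f i).graph := by
      filter_upwards [hz.eventually (gt_mem_nhds hzs), hw.eventually (lt_mem_nhds hsw)]
        with i hi1 hi2
      obtain ⟨x, hx⟩ := (f i).isPathOrder_graph₂.exists_time_eq _ _ (hp i) s hi1 hi2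
      exact ⟨x, hx.1⟩
    obtain ⟨x, hx⟩ := h1.choice
    obtain ⟨w, hw⟩ := exists_tendsto U fun i => pt (x i) s
    have h2 := tendsto_nhds_unique ((continuous_time.tendsto w).comp hw) tendsto_const_nhds
    obtain ⟨y, rfl⟩ : ∃ y, w = pt y s := ⟨_, time_eq_coe_iff.1 h2⟩
    exact ⟨y, mem_of_tendsto_compacts h (hw.prodMk_nhds hw)
      (hx.mono fun i hi => mem_graph₂_self.2 hi)⟩
  mem_of_mem_uIcc x x' y s hxx hy := by
    obtain ⟨p, hp, hlim⟩ := exists_tendsto_of_mem_compacts h hxx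
    have hz := (continuous_fst.tendsto _).comp hlim
    have hw := (continuous_snd.tendsto _).comp hlim
    obtain ⟨hz1, hz2⟩ := tendsto_pt_iff.1 hz
    obtain ⟨hw1, hw2⟩ := tendsto_pt_iff.1 hw
    have hzz := mem_of_tendsto_compacts h (hz.prodMk_nhds hz)
        (.of_forall fun i => mem_graph₂_self.2 (hp i).1)
    have hww := mem_of_tendsto_compacts h (hw.prodMk_nhds hw)
        (.of_forall fun i => mem_graph₂_self.2 (hp i).2.1)
    rcases eq_or_ne x y with rfl | hxy
    · exact ⟨hzz, hxx⟩
    rcases eq_or_ne y x' with rfl | hyx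
    · exact ⟨hxx, hww⟩
    -- With the end points excluded, `y` is strictly between the limits, hence also between the
    -- approximating positions.
    have hev : ∀ᶠ i in U, y ∈ uIcc (p i).1.space (p i).2.space := by
      rcases mem_uIcc.1 hy with ⟨h1, h2⟩ | ⟨h1, h2⟩
      · filter_upwards [hz2.eventually (gt_mem_nhds (h1.lt_of_ne hxy)),
          hw2.eventually (lt_mem_nhds (h2.lt_of_ne hyx))] with i hi1 hi2
        exact mem_uIcc.2 (.inl ⟨hi1.le, hi2.le⟩)
      · filter_upwards [hw2.eventually (gt_mem_nhds (h1.lt_of_ne hyx.symm)),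
          hz2.eventually (lt_mem_nhds (h2.lt_of_ne hxy.symm))] with i hi1 hi2
        exact mem_uIcc.2 (.inr ⟨hi1.le, hi2.le⟩)
    -- The times of `p i` may differ, so the point at level `y` is supplied by `exists_space_eq`;
    -- its time `u i` is squeezed to `s` in the limit.
    have h1 : ∀ᶠ i in U, ∃ u : ℝ, ((p i).1, pt y u) ∈ (f i).graph₂ ∧
        (pt y u, (p i).2) ∈ (f i).graph₂ := by
      filter_upwards [hev, eventually_eq_pt hz, eventually_eq_pt hw] with i hi hi1 hi2
      have h3 : ((p i).1, (p i).2) ∈ (f i).graph₂ := hp i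
      simp only [Function.comp_apply] at hi1 hi2
      rw [hi1, hi2] at h3 ⊢
      exact exists_space_eq h3 hi
    obtain ⟨u, hu⟩ := h1.choice
    obtain ⟨v, hv⟩ := exists_tendsto U fun i => pt y (u i)
    have h2 := mem_of_tendsto_compacts h (hz.prodMk_nhds hv) (hu.mono fun i hi => hi.1)
    have h3 := mem_of_tendsto_compacts h (hv.prodMk_nhds hw) (hu.mono fun i hi => hi.2)
    have hvt := (continuous_time.tendsto v).comp hv
    have h4 : v.time = s := le_antisymm
      (le_of_tendsto_of_tendsto hvt hw1 (hu.mono fun i hi => time_le_of_precedes hi.2.2.2))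
      (le_of_tendsto_of_tendsto hz1 hvt (hu.mono fun i hi => time_le_of_precedes hi.1.2.2))
    obtain ⟨y', rfl⟩ : ∃ y, v = pt y s := ⟨_, time_eq_coe_iff.1 h4⟩
    obtain rfl : y = y' := tendsto_nhds_unique tendsto_const_nhds (tendsto_pt_iff.1 hv).2
    exact ⟨h2, h3⟩

/-- A limit of second order graphs that is antisymmetric is a second order graph. -/
lemma exists_tendsto_of_antisymm {U : Ultrafilter ι} {f : ι → CadlagPath}
    {R : NonemptyCompacts (SpaceTime × SpaceTime)}
    (h : Tendsto (fun i => (f i).toCompacts) U (𝓝 R))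
    (hanti : ∀ z w, (z, w) ∈ R → (w, z) ∈ R → z = w) :
    ∃ g : CadlagPath, g.toCompacts = R ∧ Tendsto f U (𝓝 g) := by
  obtain ⟨g, hg⟩ := (isPathOrder_of_tendsto h).exists_graph₂_eq R.isCompact.isClosed R.nonempty hanti
  have hg' : g.toCompacts = R := NonemptyCompacts.ext hg
  refine ⟨g, hg', ?_⟩
  rw [isEmbedding_toCompacts.tendsto_nhds_iff, hg']
  exact h

/-- Antisymmetry fails exactly if, for some `n`, there is a pair at distance at least `1 / (n + 1)`
with both orders in `R`. For fixed `n` this is a closed condition, by compactness of space-time. -/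
lemma isGδ_antisymm : IsGδ {R : NonemptyCompacts (SpaceTime × SpaceTime) |
    ∀ z w, (z, w) ∈ R → (w, z) ∈ R → z = w} := by
  let _ := metrizableSpaceMetric SpaceTime
  have h1 : {R : NonemptyCompacts (SpaceTime × SpaceTime) |
      ∀ z w, (z, w) ∈ R → (w, z) ∈ R → z = w} =
      ⋂ n : ℕ, {R | ∃ z w, (z, w) ∈ R ∧ (w, z) ∈ R ∧ 1 / ((n : ℝ) + 1) ≤ dist z w}ᶜ := by
    ext R
    simp only [mem_ofPred_eq, mem_iInter, mem_compl_iff, not_exists, not_and, not_le]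
    refine ⟨fun h n z w h1 h2 => ?_, fun h z w h1 h2 => ?_⟩
    · rw [h z w h1 h2, dist_self]; positivity
    · by_contra hne
      obtain ⟨n, hn⟩ := exists_nat_one_div_lt (dist_pos.2 hne)
      exact absurd (h n z w h1 h2) (not_lt.2 hn.le)
  rw [h1]
  refine .iInter_of_isOpen fun n => isOpen_compl_iff.2 ?_
  rw [isClosed_iff_ultrafilter]
  intro R U hU hmem
  have h2 : ∀ᶠ R in (U : Filter (NonemptyCompacts (SpaceTime × SpaceTime))),
      ∃ z w, (z, w) ∈ R ∧ (w, z) ∈ R ∧ 1 / ((n : ℝ) + 1) ≤ dist z w := hmem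
  obtain ⟨z, hz⟩ := h2.choice
  obtain ⟨w, hw⟩ := hz.choice
  obtain ⟨z₀, hz₀⟩ := exists_tendsto U z
  obtain ⟨w₀, hw₀⟩ := exists_tendsto U w
  exact ⟨z₀, w₀, mem_of_tendsto_compacts (K := fun R => R) hU (hz₀.prodMk_nhds hw₀)
      (hw.mono fun _ h => h.1),
    mem_of_tendsto_compacts (K := fun R => R) hU (hw₀.prodMk_nhds hz₀) (hw.mono fun _ h => h.2.1),
    ge_of_tendsto (hz₀.dist hw₀) (hw.mono fun _ h => h.2.2)⟩

/-- A limit of graphs satisfies all closed conditions of `IsPathOrder`, so antisymmetry is all that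
separates the closure from the range. -/
lemma range_toCompacts : range toCompacts = closure (range toCompacts) ∩
    {R | ∀ z w, (z, w) ∈ R → (w, z) ∈ R → z = w} := by
  refine Subset.antisymm ?_ fun R ⟨h1, h2⟩ => ?_
  · rintro _ ⟨f, rfl⟩
    exact ⟨subset_closure ⟨f, rfl⟩, fun z w h1 h2 => precedes_antisymm h1.2.2 h2.2.2⟩
  · obtain ⟨U, hU, hR⟩ := mem_closure_iff_ultrafilter.1 h1
    have h3 : ∀ᶠ R in (U : Filter (NonemptyCompacts (SpaceTime × SpaceTime))),
      ∃ f : CadlagPath, f.toCompacts = R := hU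
    obtain ⟨f, hf⟩ := h3.choice
    have h4 : Tendsto (fun R => (f R).toCompacts) U (𝓝 R) :=
      Tendsto.congr' (hf.mono fun _ h => h.symm) hR
    obtain ⟨g, hg, -⟩ := exists_tendsto_of_antisymm h4 h2
    exact ⟨g, hg⟩

instance : PolishSpace CadlagPath := by
  let _ := metrizableSpaceMetric SpaceTime
  refine isEmbedding_toCompacts.polishSpace_of_isGδ ?_
  rw [range_toCompacts]
  exact isClosed_closure.isGδ.inter isGδ_antisymm

instance : PolishSpace PathSets := by
  let _ := upgradeIsCompletelyMetrizable CadlagPath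
  exact inferInstanceAs (PolishSpace (NonemptyCompacts CadlagPath))

/-! ### Convergent nets of paths: points, extensions, initial points -/

lemma mem_graph₂_of_tendsto [l.NeBot] {f : ι → CadlagPath} {z w : ι → SpaceTime}
    {z₀ w₀ : SpaceTime} (hf : Tendsto f l (𝓝 g)) (hz : Tendsto z l (𝓝 z₀))
    (hw : Tendsto w l (𝓝 w₀)) (h : ∀ᶠ i in l, (z i, w i) ∈ (f i).graph₂) : (z₀, w₀) ∈ g.graph₂ :=
  mem_of_tendsto_compacts ((isEmbedding_toCompacts.continuous.tendsto g).comp hf)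
    (hz.prodMk_nhds hw) h

lemma mem_graph_of_tendsto_path [l.NeBot] {f : ι → CadlagPath} {z : ι → SpaceTime} {z₀ : SpaceTime}
    (hf : Tendsto f l (𝓝 g)) (hz : Tendsto z l (𝓝 z₀)) (h : ∀ᶠ i in l, z i ∈ (f i).graph) :
    z₀ ∈ g.graph :=
  (mem_graph₂_of_tendsto hf hz hz (h.mono fun _ hi => mem_graph₂_self.2 hi)).1

lemma exists_tendsto_graph₂ {f : ι → CadlagPath} (hf : Tendsto f l (𝓝 g))
    {p : SpaceTime × SpaceTime} (hp : p ∈ g.graph₂) :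
    ∃ q : ι → SpaceTime × SpaceTime, (∀ i, q i ∈ (f i).graph₂) ∧ Tendsto q l (𝓝 p) :=
  exists_tendsto_of_mem_compacts ((isEmbedding_toCompacts.continuous.tendsto g).comp hf) hp

lemma exists_tendsto_graph {f : ι → CadlagPath} (hf : Tendsto f l (𝓝 g)) {w : SpaceTime}
    (hw : w ∈ g.graph) :
    ∃ z : ι → SpaceTime, (∀ i, z i ∈ (f i).graph) ∧ Tendsto z l (𝓝 w) := by
  obtain ⟨q, hq, hlim⟩ := exists_tendsto_graph₂ hf (mem_graph₂_self.2 hw)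
  exact ⟨fun i => (q i).1, fun i => (hq i).1, (continuous_fst.tendsto _).comp hlim⟩

lemma extends_of_tendsto [l.NeBot] {f h : ι → CadlagPath} {k : CadlagPath}
    (hf : Tendsto f l (𝓝 g)) (hh : Tendsto h l (𝓝 k)) (hfh : ∀ᶠ i in l, (f i).Extends (h i)) :
    g.Extends k := by
  intro p hp
  obtain ⟨q, hq, hlim⟩ := exists_tendsto_graph₂ hh hp
  exact mem_graph₂_of_tendsto hf ((continuous_fst.tendsto _).comp hlim)
    ((continuous_snd.tendsto _).comp hlim) (hfh.mono fun i hi => hi (hq i))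

/-- Any net of paths that are extended by the elements of a convergent net of paths converges along
each ultrafilter. -/
lemma exists_tendsto_of_extends {U : Ultrafilter ι} {f h : ι → CadlagPath}
    (hf : Tendsto f U (𝓝 g)) (hfh : ∀ᶠ i in U, (f i).Extends (h i)) :
    ∃ k : CadlagPath, Tendsto h U (𝓝 k) ∧ g.Extends k := by
  obtain ⟨R, -, hR⟩ := isCompact_univ.ultrafilter_le_nhds (U.map fun i => (h i).toCompacts)
    (by simp)
  have hR' : Tendsto (fun i => (h i).toCompacts) U (𝓝 R) := hR
  -- The limit of the smaller graphs lies in the graph of `g`, from which it takes its antisymmetry.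
  have hsub : ∀ p ∈ R, p ∈ g.graph₂ := by
    intro p hp
    obtain ⟨q, hq, hlim⟩ := exists_tendsto_of_mem_compacts hR' hp
    exact mem_graph₂_of_tendsto hf ((continuous_fst.tendsto _).comp hlim)
      ((continuous_snd.tendsto _).comp hlim) (hfh.mono fun i hi => hi (hq i))
  obtain ⟨k, -, hk⟩ := exists_tendsto_of_antisymm hR' fun z w h1 h2 =>
    precedes_antisymm (hsub _ h1).2.2 (hsub _ h2).2.2
  exact ⟨k, hk, extends_of_tendsto hf hk hfh⟩

lemma isClosed_halfInfinite : IsClosed halfInfinite := by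
  rw [isClosed_iff_ultrafilter]
  intro f U hU hmem
  exact mem_graph_of_tendsto_path (f := fun f => f) (z := fun _ => top) hU tendsto_const_nhds hmem

lemma eq_initialPoint {z : SpaceTime} (hz : z ∈ f.graph)
    (h : f.precedes z f.initialPoint) : z = f.initialPoint :=
  precedes_antisymm h (initialPoint_precedes hz)

/-- The initial point is first in the order. A limit `z` of initial points therefore precedes the
limit of any other points of the graphs; taking points that tend to `f.initialPoint` forces `z` to
be equal to it. -/
lemma continuous_initialPoint : Continuous initialPoint := by
  rw [continuous_iff_ultrafilter]
  intro f U hU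
  obtain ⟨z, hz⟩ := exists_tendsto U initialPoint
  have h1 : z ∈ f.graph := mem_graph_of_tendsto_path (f := fun f => f) hU hz
    (.of_forall fun f => f.initialPoint_mem_graph)
  obtain ⟨w, hw, hlim⟩ := exists_tendsto_graph (f := fun f => f) hU f.initialPoint_mem_graph
  have h2 := mem_graph₂_of_tendsto (f := fun f => f) hU hz hlim
    (.of_forall fun f => ⟨f.initialPoint_mem_graph, hw f, initialPoint_precedes (hw f)⟩)
  rw [← eq_initialPoint h1 h2.2.2]
  exact hz

end CadlagPath

end Weaves

namespace Weaves

open SpaceTime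

namespace CadlagPath

variable {f g h : CadlagPath}

/-! ### Extension of half-infinite paths -/

lemma Extends.trans (h1 : f.Extends g) (h2 : g.Extends h) : f.Extends h :=
  Subset.trans (α := SpaceTime × SpaceTime) h2 h1

lemma Extends.refl (f : CadlagPath) : f.Extends f := Subset.refl _

lemma Extends.graph_subset (h : g.Extends f) : f.graph ⊆ g.graph := graph_subset_of_graph₂_subset h

/-- The only freedom in passing to a shorter path is its value at the left end of the initial time,
which may lie anywhere on the segment of `g`. The other values are one-sided limits along the graph
of `g`. -/
lemma extends_iff (hf : f ∈ halfInfinite) (hg : g ∈ halfInfinite) :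
    g.Extends f ↔ g.σ ≤ f.σ ∧ (∀ t : ℝ, f.σ ≤ t → f.right t = g.right t) ∧
      (∀ t : ℝ, f.σ < t → f.left t = g.left t) ∧
      ∀ t : ℝ, f.σ = t → f.left t ∈ uIcc (g.left t) (g.right t) := by
  have hf' : f.τ = ⊤ := hf
  have hg' : g.τ = ⊤ := hg
  constructor
  · intro h
    have hs := h.graph_subset
    have hσ := σ_le_of_graph_subset hs
    refine ⟨hσ, fun t ht => ?_, fun t ht => ?_, fun t ht => ?_⟩
    · refine tendsto_nhds_unique (f.right_cont t ht (by simp [hf'])) ?_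
      refine tendsto_space_of_nhdsGT (s := id) (hσ.trans ht) (by simp [hg']) tendsto_id ?_
      filter_upwards [self_mem_nhdsWithin] with u hu
      exact (hs (show pt (f.right u) u ∈ f.graph by
        simp [hf', ht.trans (EReal.coe_le_coe_iff.2 (le_of_lt hu))])).2.2
    · refine tendsto_nhds_unique (f.left_lim t ht (by simp [hf'])) ?_
      refine tendsto_space_of_nhdsLT (s := id) (hσ.trans_lt ht) (by simp [hg']) tendsto_id ?_
      obtain ⟨c, hc, hct⟩ := EReal.lt_iff_exists_real_btwn.1 ht
      filter_upwards [Ioo_mem_nhdsLT (EReal.coe_lt_coe_iff.1 hct)] with u hu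
      exact (hs (show pt (f.right u) u ∈ f.graph by
        simp [hf', hc.le.trans (EReal.coe_le_coe_iff.2 hu.1.le)])).2.2
    · exact (hs (show pt (f.left t) t ∈ f.graph by simp [hf', ht])).2.2
  · rintro ⟨hσ, hR, hL, hI⟩
    have hs : ∀ z ∈ f.graph, z ∈ g.graph := by
      rintro (⟨x, t⟩ | _ | _) hz
      · obtain ⟨h1, h2, h3⟩ := hz
        refine ⟨hσ.trans h1, by simp [hg'], ?_⟩
        rcases h1.lt_or_eq with h4 | h4
        · rwa [← hR t h1, ← hL t h4]
        · have h5 := hI t h4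
          rw [hR t h1] at h3
          simp only [mem_uIcc] at *
          grind
      · exact le_bot_iff.1 (hσ.trans (le_of_eq hz))
      · exact hg'
    rintro ⟨z, w⟩ ⟨hz, hw, hzw⟩
    refine ⟨hs z hz, hs w hw, ?_⟩
    rcases z with ⟨x, s⟩ | _ | _ <;> rcases w with ⟨y, t⟩ | _ | _ <;> try simp at hzw ⊢
    refine hzw.imp_right ?_
    rintro ⟨rfl, hxy⟩
    refine ⟨rfl, ?_⟩
    rcases hz.1.lt_or_eq with h4 | h4
    · rwa [← hL s h4]
    · have h5 := hI s h4
      have h6 := hw.2.2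
      rw [hR s hz.1] at h6
      simp only [mem_uIcc] at *
      grind

lemma biInfinite_subset : biInfinite ⊆ halfInfinite := fun _ h => h.2

lemma initialPoint_eq_pt {t : ℝ} (h : f.σ = t) : f.initialPoint = pt (f.left t) t := by
  simp [initialPoint, h]

/-- A half-infinite path is determined by an extension and its initial point. -/
lemma eq_of_extends_of_initialPoint_eq (hf : f ∈ halfInfinite) (hg : g ∈ halfInfinite)
    (hh : h ∈ halfInfinite) (h1 : h.Extends f) (h2 : h.Extends g)
    (h3 : f.initialPoint = g.initialPoint) : f = g := by
  have hσ : f.σ = g.σ := by rw [← time_initialPoint, h3, time_initialPoint]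
  obtain ⟨-, hR1, hL1, -⟩ := (extends_iff hf hh).1 h1
  obtain ⟨-, hR2, hL2, -⟩ := (extends_iff hg hh).1 h2
  have hτ : f.τ = g.τ := hf.trans hg.symm
  ext t
  · exact hσ
  · exact hτ
  · rcases lt_trichotomy f.σ t with h4 | h4 | h4
    · rw [hL1 t h4, hL2 t (hσ ▸ h4)]
    · rw [initialPoint_eq_pt h4, initialPoint_eq_pt (hσ ▸ h4)] at h3
      simpa using h3
    · rw [(f.off_domain t fun h => absurd h.1 (not_le.2 h4)).1,
        (g.off_domain t fun h => absurd h.1 (not_le.2 (hσ ▸ h4))).1]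
  · rcases le_or_gt f.σ t with h4 | h4
    · rw [hR1 t h4, hR2 t (hσ ▸ h4)]
    · rw [(f.off_domain t fun h => absurd h.1 (not_le.2 h4)).2,
        (g.off_domain t fun h => absurd h.1 (not_le.2 (hσ ▸ h4))).2]

/-- The restriction of a half-infinite path to its part from a point on. -/
lemma exists_restriction (hf : f ∈ halfInfinite) {z : SpaceTime} (hz : z ∈ f.graph) :
    ∃ g ∈ halfInfinite, f.Extends g ∧ g.initialPoint = z := by
  have hf' : f.τ = ⊤ := hf
  classical
  let g : CadlagPath :=
    { σ := z.time
      τ := ⊤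
      σ_le_τ := le_top
      left := fun u => if z.time < u then f.left u else if z.time = u then z.space else 0
      right := fun u => if z.time ≤ u then f.right u else 0
      right_cont := by
        intro t h1 h2
        rw [if_pos h1]
        refine (f.right_cont t ((σ_le_time hz).trans h1) (hf'.symm ▸ h2)).congr' ?_
        filter_upwards [self_mem_nhdsWithin] with u hu
        rw [if_pos (h1.trans (EReal.coe_le_coe_iff.2 (le_of_lt hu)))]
      left_lim := by
        intro t h1 h2
        rw [if_pos h1]
        refine (f.left_lim t ((σ_le_time hz).trans_lt h1) (hf'.symm ▸ h2)).congr' ?_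
        obtain ⟨c, hc, hct⟩ := EReal.lt_iff_exists_real_btwn.1 h1
        filter_upwards [Ioo_mem_nhdsLT (EReal.coe_lt_coe_iff.1 hct)] with u hu
        rw [if_pos (hc.le.trans (EReal.coe_le_coe_iff.2 hu.1.le))]
      off_domain := by
        intro t ht
        have h1 : ¬ z.time ≤ t := fun h => ht ⟨h, le_top⟩
        exact ⟨by rw [if_neg fun h => h1 h.le, if_neg fun h => h1 h.le], if_neg h1⟩ }
  have hg : g ∈ halfInfinite := rfl
  refine ⟨g, hg, (extends_iff hg hf).2 ⟨σ_le_time hz, fun t ht => if_pos ht, fun t ht => if_pos ht,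
    fun t ht => ?_⟩, ?_⟩
  · change z.time = t at ht
    change (if z.time < t then f.left t else if z.time = t then z.space else 0) ∈ _
    rw [if_neg ht.not_lt, if_pos ht]
    rw [time_eq_coe_iff.1 ht] at hz
    exact hz.2.2
  · rcases z with ⟨x, t⟩ | _ | _
    · rw [initialPoint_eq_pt (show g.σ = t from rfl)]
      simp [g]
    · simp [initialPoint, g]
    · simp [initialPoint, g]

/-! ### The order of non-crossing paths -/

/-- The path `f` lies to the left of `g` at all times at which both are defined, also after an
extension to earlier times. The values of `f` and `g` at the left end `t-` of the initial time
matter only if each extension has to pass them. -/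
def LeftOf (f g : CadlagPath) : Prop := ∀ t : ℝ,
  (f.σ ≤ t → g.σ ≤ t → f.right t ≤ g.right t) ∧
  ((f.σ < t ∨ (f.σ ≤ t ∧ f.right t < f.left t)) →
    (g.σ < t ∨ (g.σ ≤ t ∧ g.left t < g.right t)) → f.left t ≤ g.left t)

lemma LeftOf.right_le (h : f.LeftOf g) {t : ℝ} (hf : f.σ ≤ t) (hg : g.σ ≤ t) :
    f.right t ≤ g.right t := (h t).1 hf hg

lemma LeftOf.left_le (h : f.LeftOf g) {t : ℝ} (hf : f.σ < t) (hg : g.σ < t) :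
    f.left t ≤ g.left t := (h t).2 (.inl hf) (.inl hg)

/-- Suppose that `f` jumps down at its initial time `s`. An extension `f'` passes `f(s-)` on its way
from `f'(s-)` to `f(s+) < f(s-)`, so `f(s-) ≤ f'(s-)`. Likewise `g'(s-) ≤ g(s-)` if `g` jumps up.
These are the cases for which `LeftOf` compares initial values. -/
lemma leftOf_of_staysLeft {f' g' : CadlagPath} (hf : f ∈ halfInfinite) (hg : g ∈ halfInfinite)
    (hf' : f' ∈ biInfinite) (hg' : g' ∈ biInfinite) (h1 : f'.Extends f) (h2 : g'.Extends g)
    (h3 : f'.StaysLeft g') : f.LeftOf g := by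
  obtain ⟨-, hR1, hL1, hI1⟩ := (extends_iff hf (biInfinite_subset hf')).1 h1
  obtain ⟨-, hR2, hL2, hI2⟩ := (extends_iff hg (biInfinite_subset hg')).1 h2
  refine fun t => ⟨fun h4 h5 => hR1 t h4 ▸ hR2 t h5 ▸ (h3 t).2, fun h4 h5 => ?_⟩
  have h6 : f.left t ≤ f'.left t := by
    rcases h4 with h4 | ⟨h4, h7⟩
    · exact (hL1 t h4).le
    · rcases h4.lt_or_eq with h4 | h4
      · exact (hL1 t h4).le
      · have h8 := hI1 t h4
        rw [hR1 t h4.le] at h7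
        rw [mem_uIcc] at h8
        grind
  have h7 : g'.left t ≤ g.left t := by
    rcases h5 with h5 | ⟨h5, h7⟩
    · exact (hL2 t h5).ge
    · rcases h5.lt_or_eq with h5 | h5
      · exact (hL2 t h5).ge
      · have h8 := hI2 t h5
        rw [hR2 t h5.le] at h7
        rw [mem_uIcc] at h8
        grind
  exact h6.trans ((h3 t).1.trans h7)

/-- The bi-infinite path with a constant value. -/
@[simps]
noncomputable def const (c : EReal) : CadlagPath where
  σ := ⊥
  τ := ⊤
  σ_le_τ := bot_le
  left _ := c
  right _ := c
  right_cont _ _ _ := tendsto_const_nhds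
  left_lim _ _ _ := tendsto_const_nhds
  off_domain t h := by simp at h

/-- The maximum of a bi-infinite path and a constant. -/
@[simps]
noncomputable def supConst (p : CadlagPath) (hp : p ∈ biInfinite) (c : EReal) : CadlagPath where
  σ := ⊥
  τ := ⊤
  σ_le_τ := bot_le
  left t := p.left t ⊔ c
  right t := p.right t ⊔ c
  right_cont t _ _ := (p.right_cont t (by simp [hp.1]) (by simp [hp.2])).sup_nhds tendsto_const_nhds
  left_lim t _ _ := (p.left_lim t (by simp [hp.1]) (by simp [hp.2])).sup_nhds tendsto_const_nhds
  off_domain t h := by simp at h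

open Classical in
/-- The concatenation of a bi-infinite path, up to the initial time of a half-infinite path, and
the latter path. -/
@[simps]
noncomputable def withPast (f p : CadlagPath) (hf : f ∈ halfInfinite) (hp : p ∈ biInfinite) :
    CadlagPath where
  σ := ⊥
  τ := ⊤
  σ_le_τ := bot_le
  left t := if t ≤ f.σ then p.left t else f.left t
  right t := if t < f.σ then p.right t else f.right t
  right_cont t _ _ := by
    split_ifs with h
    · refine (p.right_cont t (by simp [hp.1]) (by simp [hp.2])).congr' ?_
      obtain ⟨c, hc, hct⟩ := EReal.lt_iff_exists_real_btwn.1 h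
      filter_upwards [Ioo_mem_nhdsGT (EReal.coe_lt_coe_iff.1 hc)] with u hu
      rw [if_pos ((EReal.coe_lt_coe_iff.2 hu.2).trans hct)]
    · refine (f.right_cont t (not_lt.1 h) (hf.symm ▸ EReal.coe_lt_top t)).congr' ?_
      filter_upwards [self_mem_nhdsWithin] with u hu
      rw [if_neg (not_lt.2 ((not_lt.1 h).trans (EReal.coe_le_coe_iff.2 (le_of_lt hu))))]
  left_lim t _ _ := by
    split_ifs with h
    · refine (p.left_lim t (by simp [hp.1]) (by simp [hp.2])).congr' ?_
      filter_upwards [self_mem_nhdsWithin] with u hu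
      rw [if_pos ((EReal.coe_lt_coe_iff.2 hu).trans_le h)]
    · refine (f.left_lim t (not_le.1 h) (hf.symm ▸ le_top)).congr' ?_
      obtain ⟨c, hc, hct⟩ := EReal.lt_iff_exists_real_btwn.1 (not_le.1 h)
      filter_upwards [Ioo_mem_nhdsLT (EReal.coe_lt_coe_iff.1 hct)] with u hu
      rw [if_neg (not_lt.2 (hc.le.trans (EReal.coe_le_coe_iff.2 hu.1.le)))]
  off_domain t h := by simp at h

lemma withPast_mem_biInfinite {p : CadlagPath} (hf : f ∈ halfInfinite) (hp : p ∈ biInfinite) :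
    f.withPast p hf hp ∈ biInfinite := ⟨rfl, rfl⟩

lemma withPast_extends {p : CadlagPath} (hf : f ∈ halfInfinite) (hp : p ∈ biInfinite)
    (h : ∀ t : ℝ, f.σ = t → f.left t ∈ uIcc (p.left t) (f.right t)) :
    (f.withPast p hf hp).Extends f := by
  refine (extends_iff hf (biInfinite_subset (withPast_mem_biInfinite hf hp))).2
    ⟨bot_le, fun t ht => ?_, fun t ht => ?_, fun t ht => ?_⟩
  · simp [ht.not_gt]
  · simp [ht.not_ge]
  · simpa [ht] using h t ht

/-- The earlier path `f` is continued to the past as far left as possible, by a constant `c`; then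
`g` is continued as far right as needed, by the maximum of `f'` and a constant `d`, which is
automatically to the right of `f'`. -/
lemma exists_staysLeft_of_le (hf : f ∈ halfInfinite) (hg : g ∈ halfInfinite) (h : f.LeftOf g)
    (hσ : f.σ ≤ g.σ) : ∃ f' ∈ biInfinite, ∃ g' ∈ biInfinite,
      f'.Extends f ∧ g'.Extends g ∧ f'.StaysLeft g' := by
  classical
  -- If `f` jumps down initially, its past must end at or above `f(σ-)`, and `c = f(σ-)` is the
  -- least choice; otherwise `⊥` is allowed. The choice of `d` is the mirror image. At an infinite
  -- initial time no value is to be matched, and the default value of `toReal` does no harm.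
  let c : EReal := if f.right f.σ.toReal < f.left f.σ.toReal then f.left f.σ.toReal else ⊥
  let d : EReal := if g.left g.σ.toReal < g.right g.σ.toReal then g.left g.σ.toReal else ⊤
  have hc : const c ∈ biInfinite := ⟨rfl, rfl⟩
  let f' := f.withPast (const c) hf hc
  have hf' : f' ∈ biInfinite := withPast_mem_biInfinite hf hc
  have hq : f'.supConst hf' d ∈ biInfinite := ⟨rfl, rfl⟩
  let g' := g.withPast (f'.supConst hf' d) hg hq
  have hf'L : ∀ t : ℝ, f'.left t = if t ≤ f.σ then c else f.left t := fun t => rfl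
  refine ⟨f', hf', g', withPast_mem_biInfinite hg hq, ?_, ?_, fun t => ⟨?_, ?_⟩⟩
  · refine withPast_extends hf hc fun t ht => ?_
    simp only [const_left, c, ht, EReal.toReal_coe]
    split_ifs with h1
    · exact left_mem_uIcc
    · exact mem_uIcc.2 (.inl ⟨bot_le, not_lt.1 h1⟩)
  · refine withPast_extends hg hq fun t ht => ?_
    simp only [supConst_left, d, ht, EReal.toReal_coe]
    split_ifs with h1
    · suffices h2 : f'.left t ≤ g.left t by
        rw [sup_eq_right.2 h2]; exact left_mem_uIcc
      rw [hf'L]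
      split_ifs with h2
      · have h3 : f.σ = t := (ht ▸ hσ).antisymm h2
        simp only [c, h3, EReal.toReal_coe]
        split_ifs with h4
        · exact (h t).2 (.inr ⟨h3.le, h4⟩) (.inr ⟨ht.le, h1⟩)
        · exact bot_le
      · exact (h t).2 (.inl (not_le.1 h2)) (.inr ⟨ht.le, h1⟩)
    · rw [sup_top_eq]
      exact mem_uIcc.2 (.inr ⟨not_lt.1 h1, le_top⟩)
  · change f'.left t ≤ if t ≤ g.σ then f'.left t ⊔ d else g.left t
    split_ifs with h1
    · exact le_sup_left
    · have h2 := hσ.trans_lt (not_le.1 h1)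
      rw [hf'L, if_neg (not_le.2 h2)]
      exact h.left_le h2 (not_le.1 h1)
  · change (if t < f.σ then c else f.right t) ≤
      if t < g.σ then (if t < f.σ then c else f.right t) ⊔ d else g.right t
    split_ifs with h1 h2 h2
    · exact le_sup_left
    · exact absurd (h1.trans_le hσ) h2
    · exact le_sup_left
    · exact h.right_le (not_lt.1 h1) (not_lt.1 h2)

lemma neg_mem_halfInfinite : f.neg ∈ halfInfinite ↔ f ∈ halfInfinite := Iff.rfl

lemma Extends.neg (h : g.Extends f) (hf : f ∈ halfInfinite) (hg : g ∈ halfInfinite) :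
    g.neg.Extends f.neg := by
  obtain ⟨h1, h2, h3, h4⟩ := (extends_iff hf hg).1 h
  exact (extends_iff (f := f.neg) (g := g.neg) hf hg).2 ⟨h1, fun t ht => congrArg Neg.neg (h2 t ht),
    fun t ht => congrArg Neg.neg (h3 t ht), fun t ht => neg_mem_uIcc_neg.2 (h4 t ht)⟩

lemma LeftOf.neg (h : f.LeftOf g) : g.neg.LeftOf f.neg := fun t =>
  ⟨fun h1 h2 => EReal.neg_le_neg_iff.2 ((h t).1 h2 h1), fun h1 h2 => EReal.neg_le_neg_iff.2
    ((h t).2 (h2.imp_right fun h => ⟨h.1, EReal.neg_lt_neg_iff.1 h.2⟩)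
      (h1.imp_right fun h => ⟨h.1, EReal.neg_lt_neg_iff.1 h.2⟩))⟩

lemma leftOf_neg_iff : g.neg.LeftOf f.neg ↔ f.LeftOf g :=
  ⟨fun h => by simpa [neg_neg_path] using h.neg, fun h => h.neg⟩

lemma exists_staysLeft (hf : f ∈ halfInfinite) (hg : g ∈ halfInfinite) (h : f.LeftOf g) :
    ∃ f' ∈ biInfinite, ∃ g' ∈ biInfinite, f'.Extends f ∧ g'.Extends g ∧ f'.StaysLeft g' := by
  rcases le_total f.σ g.σ with hσ | hσ
  · exact exists_staysLeft_of_le hf hg h hσ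
  · obtain ⟨g', hg', f', hf', h1, h2, h3⟩ :=
      exists_staysLeft_of_le (f := g.neg) (g := f.neg) hg hf h.neg hσ
    refine ⟨f'.neg, hf', g'.neg, hg', ?_, ?_, fun t =>
      ⟨EReal.neg_le_neg_iff.2 (h3 t).1, EReal.neg_le_neg_iff.2 (h3 t).2⟩⟩
    · simpa [neg_neg_path] using h2.neg hf (biInfinite_subset hf')
    · simpa [neg_neg_path] using h1.neg hg (biInfinite_subset hg')

lemma nonCrossing_iff (hf : f ∈ halfInfinite) (hg : g ∈ halfInfinite) :
    f.NonCrossing g ↔ f.LeftOf g ∨ g.LeftOf f := by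
  constructor
  · rintro ⟨f', hf', g', hg', h1, h2, h3 | h3⟩
    · exact .inl (leftOf_of_staysLeft hf hg hf' hg' h1 h2 h3)
    · exact .inr (leftOf_of_staysLeft hg hf hg' hf' h2 h1 h3)
  · rintro (h | h)
    · obtain ⟨f', hf', g', hg', h1, h2, h3⟩ := exists_staysLeft hf hg h
      exact ⟨f', hf', g', hg', h1, h2, .inl h3⟩
    · obtain ⟨g', hg', f', hf', h1, h2, h3⟩ := exists_staysLeft hg hf h
      exact ⟨f', hf', g', hg', h2, h1, .inr h3⟩

lemma NonCrossing.of_extends (h1 : f.NonCrossing g) (h2 : f.Extends h) : h.NonCrossing g := by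
  obtain ⟨f', hf', g', hg', h3, h4, h5⟩ := h1
  exact ⟨f', hf', g', hg', h3.trans h2, h4, h5⟩

lemma NonCrossing.symm (h : f.NonCrossing g) : g.NonCrossing f := by
  obtain ⟨f', hf', g', hg', h3, h4, h5⟩ := h
  exact ⟨g', hg', f', hf', h4, h3, h5.symm⟩

/-- Non-crossing paths are ordered by their values at a time at which these are different. -/
lemma leftOf_of_right_lt (h : f.LeftOf g ∨ g.LeftOf f) {t : ℝ} (hf : f.σ ≤ t) (hg : g.σ ≤ t)
    (hlt : f.right t < g.right t) : f.LeftOf g :=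
  h.resolve_right fun h => absurd (h.right_le hg hf) (not_le.2 hlt)

/-- A path through a point strictly to the right of a path is not to the left of that path. -/
lemma not_leftOf_of_mem {y : EReal} {t : ℝ} (hg : g.σ < t) (h1 : g.left t < y) (h2 : g.right t < y)
    (hy : pt y t ∈ f.graph) : ¬ f.LeftOf g := by
  intro h
  have h3 := (h t).1 hy.1 hg.le
  have h4 : f.right t < f.left t := by
    have := hy.2.2
    rw [mem_uIcc] at this
    grind
  have h5 := (h t).2 (.inr ⟨hy.1, h4⟩) (.inl hg)
  have := hy.2.2
  rw [mem_uIcc] at this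
  grind

lemma not_leftOf_of_mem' {y : EReal} {t : ℝ} (hg : g.σ < t) (h1 : y < g.left t) (h2 : y < g.right t)
    (hy : pt y t ∈ f.graph) : ¬ g.LeftOf f := fun h =>
  not_leftOf_of_mem (f := f.neg) (g := g.neg) (y := -y) hg (EReal.neg_lt_neg_iff.2 h1)
    (EReal.neg_lt_neg_iff.2 h2) (pt_neg_mem_graph_neg.2 hy) h.neg

end CadlagPath

end Weaves

namespace Weaves

open SpaceTime CadlagPath

/-! ### Ramified points -/

/-- All but countably many time slices of the set are countable. -/
def HasCountableSlices (Z : Set (EReal × ℝ)) : Prop :=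
  ∃ T : Set ℝ, T.Countable ∧ ∀ t ∉ T, {x | (x, t) ∈ Z}.Countable

namespace HasCountableSlices

variable {Z Z' : Set (EReal × ℝ)}

lemma mono (h : HasCountableSlices Z') (hs : Z ⊆ Z') : HasCountableSlices Z := by
  obtain ⟨T, hT, h⟩ := h
  exact ⟨T, hT, fun t ht => (h t ht).mono fun x hx => hs hx⟩

lemma iUnion {ι : Type*} [Countable ι] {Z : ι → Set (EReal × ℝ)}
    (h : ∀ i, HasCountableSlices (Z i)) : HasCountableSlices (⋃ i, Z i) := by
  choose T hT h using h
  refine ⟨⋃ i, T i, countable_iUnion hT, fun t ht => ?_⟩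
  simp only [mem_iUnion, not_exists, ofPred_exists] at ht ⊢
  exact countable_iUnion fun i => h i t (ht i)

lemma union (h : HasCountableSlices Z) (h' : HasCountableSlices Z') :
    HasCountableSlices (Z ∪ Z') := by
  rw [union_eq_iUnion]
  exact iUnion fun b => by cases b <;> assumption

lemma of_countable_not_subsingleton
    (h : {t : ℝ | ¬ {x : EReal | (x, t) ∈ Z}.Subsingleton}.Countable) : HasCountableSlices Z :=
  ⟨_, h, fun _ ht => (not_not.1 ht).countable⟩

lemma of_countable_times {T : Set ℝ} (hT : T.Countable) (h : ∀ p ∈ Z, p.2 ∈ T) :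
    HasCountableSlices Z :=
  ⟨T, hT, fun t ht => by
    rw [show {x | (x, t) ∈ Z} = ∅ from eq_empty_of_forall_notMem fun x hx => ht (h _ hx)]
    exact countable_empty⟩

lemma neg (h : HasCountableSlices Z) : HasCountableSlices {p | (-p.1, p.2) ∈ Z} := by
  obtain ⟨T, hT, h⟩ := h
  exact ⟨T, hT, fun _ ht => (h _ ht).preimage neg_injective⟩

end HasCountableSlices

/-- A set of reals is countable if its elements can be given labels from a countable set in such a
way that different elements do not share a label. -/
lemma countable_of_labels {L : Type*} [Countable L] {B : Set ℝ} (P : L → Set ℝ)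
    (h : ∀ t ∈ B, ∃ a, t ∈ P a) (hs : ∀ a, ∀ t ∈ P a, ∀ t' ∈ P a, ¬ t < t') : B.Countable := by
  refine Countable.mono (fun t ht => mem_iUnion.2 (h t ht)) (countable_iUnion fun a =>
    Set.Subsingleton.countable fun t ht t' ht' => ?_)
  exact le_antisymm (not_lt.1 (hs a t' ht' t ht)) (not_lt.1 (hs a t ht t' ht'))

lemma exists_rat_Ioo_right {P : ℝ → Prop} {t : ℝ} (h : ∀ᶠ v in 𝓝[>] t, P v) :
    ∃ b : ℚ, t < b ∧ ∀ v ∈ Ioo t (b : ℝ), P v := by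
  obtain ⟨b, hb, hbs⟩ := (mem_nhdsGT_iff_exists_Ioo_subset).1 h
  obtain ⟨c, hc, hcb⟩ := exists_rat_btwn (show t < b from hb)
  exact ⟨c, hc, fun v hv => hbs ⟨hv.1, hv.2.trans hcb⟩⟩

lemma exists_rat_Ioo_left {P : ℝ → Prop} {t : ℝ} {σ : EReal} (hσ : σ < t)
    (h : ∀ᶠ v in 𝓝[<] t, P v) :
    ∃ a : ℚ, σ ≤ (a : ℝ) ∧ a < t ∧ ∀ v ∈ Ioo (a : ℝ) t, P v := by
  obtain ⟨b, hb, hbs⟩ := (mem_nhdsLT_iff_exists_Ioo_subset).1 h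
  obtain ⟨c, hσc, hct⟩ := EReal.lt_iff_exists_real_btwn.1 hσ
  obtain ⟨d, hd, hdt⟩ := exists_rat_btwn (max_lt hb (EReal.coe_lt_coe_iff.1 hct))
  exact ⟨d, hσc.le.trans (EReal.coe_le_coe_iff.2 ((le_max_right _ _).trans hd.le)), hdt,
    fun v hv => hbs ⟨(le_max_left _ _).trans_lt (hd.trans hv.1), hv.2⟩⟩

namespace CadlagPath

variable {f g : CadlagPath} {t : ℝ}

lemma tendsto_right_GT (hf : f ∈ halfInfinite) (h : f.σ ≤ t) :
    Tendsto f.right (𝓝[>] t) (𝓝 (f.right t)) :=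
  f.right_cont t h (hf.symm ▸ EReal.coe_lt_top t)

lemma tendsto_left_GT (hf : f ∈ halfInfinite) (h : f.σ ≤ t) :
    Tendsto f.left (𝓝[>] t) (𝓝 (f.right t)) :=
  tendsto_left_nhdsGT h (hf.symm ▸ EReal.coe_lt_top t)

lemma tendsto_right_LT (hf : f ∈ halfInfinite) (h : f.σ < t) :
    Tendsto f.right (𝓝[<] t) (𝓝 (f.left t)) :=
  f.left_lim t h (hf.symm ▸ le_top)

lemma tendsto_left_LT (hf : f ∈ halfInfinite) (h : f.σ < t) :
    Tendsto f.left (𝓝[<] t) (𝓝 (f.left t)) :=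
  tendsto_left_nhdsLT h (hf.symm ▸ le_top)

lemma left_eq_of_right_eq (hf : f ∈ halfInfinite) (hg : g ∈ halfInfinite) {s : EReal}
    (hfs : f.σ ≤ s) (hgs : g.σ ≤ s) (h : ∀ v : ℝ, s ≤ v → f.right v = g.right v) (hst : s < t) :
    f.left t = g.left t := by
  refine tendsto_nhds_unique (tendsto_right_LT hf (hfs.trans_lt hst))
    ((tendsto_right_LT hg (hgs.trans_lt hst)).congr' ?_)
  obtain ⟨c, hc, hct⟩ := EReal.lt_iff_exists_real_btwn.1 hst
  filter_upwards [Ioo_mem_nhdsLT (EReal.coe_lt_coe_iff.1 hct)] with u hu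
  exact (h u (hc.le.trans (EReal.coe_le_coe_iff.2 hu.1.le))).symm

end CadlagPath

section Ramified

variable {C : Set CadlagPath}

/-- Every `f` below `q` at time `u` is left of every `g` above `q`. If such pairs meet at two points
`x < x'` of one slice, some `g` passes `x` and some `f` passes `x'`. This needs a jump at `t`:
either `g` jumps up across a rational level while `f` stays above it for a rational while, or `f`
jumps down across one while `g` stays below it. Two times with the same label would violate the
order of `f` and the `g'` of the later time (or of `f'` and `g`), so such times are countable. -/
lemma hasCountableSlices_of_lt_of_lt (hC : C ⊆ halfInfinite)
    (hord : ∀ f ∈ C, ∀ g ∈ C, f.LeftOf g ∨ g.LeftOf f) (u q : ℝ) :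
    HasCountableSlices {p | ∃ f ∈ C, ∃ g ∈ C, pt p.1 p.2 ∈ f.graph ∧ pt p.1 p.2 ∈ g.graph ∧
      f.σ ≤ u ∧ g.σ ≤ u ∧ f.right u < q ∧ (q : EReal) < g.right u} := by
  have hord' : ∀ f ∈ C, ∀ g ∈ C, f.σ ≤ u → g.σ ≤ u → f.right u < q → (q : EReal) < g.right u →
      f.LeftOf g := fun f hf g hg h1 h2 h3 h4 =>
    leftOf_of_right_lt (hord f hf g hg) h1 h2 (h3.trans h4)
  refine .of_countable_not_subsingleton ?_
  let Pu : ℚ × ℚ → Set ℝ := fun a => {t | t < a.2 ∧ ∃ f ∈ C, ∃ g ∈ C, f.σ ≤ u ∧ g.σ ≤ u ∧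
    f.right u < q ∧ (q : EReal) < g.right u ∧ f.σ ≤ t ∧ g.σ ≤ t ∧ g.left t < (a.1 : ℝ) ∧
    ((a.1 : ℝ) : EReal) < g.right t ∧ ∀ v ∈ Ioo t (a.2 : ℝ), ((a.1 : ℝ) : EReal) < f.left v}
  let Pd : ℚ × ℚ → Set ℝ := fun a => {t | t < a.2 ∧ ∃ f ∈ C, ∃ g ∈ C, f.σ ≤ u ∧ g.σ ≤ u ∧
    f.right u < q ∧ (q : EReal) < g.right u ∧ f.σ ≤ t ∧ g.σ ≤ t ∧ ((a.1 : ℝ) : EReal) < f.left t ∧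
    f.right t < (a.1 : ℝ) ∧ ∀ v ∈ Ioo t (a.2 : ℝ), g.left v < (a.1 : ℝ)}
  refine countable_of_labels (L := (ℚ × ℚ) ⊕ (ℚ × ℚ)) (Sum.elim Pu Pd) ?_ ?_
  · intro t ht
    have h1 : ∃ x x', x < x' ∧ (∃ g ∈ C, g.σ ≤ u ∧ (q : EReal) < g.right u ∧ pt x t ∈ g.graph) ∧
        ∃ f ∈ C, f.σ ≤ u ∧ f.right u < q ∧ pt x' t ∈ f.graph := by
      obtain ⟨x, ⟨f, hf, g, hg, h1, h2, h3, h4, h5, h6⟩, x', ⟨f', hf', g', hg', h1', h2', h3', h4',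
        h5', h6'⟩, hne⟩ := not_subsingleton_iff.1 ht
      rcases lt_or_gt_of_ne hne with h | h
      · exact ⟨x, x', h, ⟨g, hg, h4, h6, h2⟩, f', hf', h3', h5', h1'⟩
      · exact ⟨x', x, h, ⟨g', hg', h4', h6', h2'⟩, f, hf, h3, h5, h1⟩
    obtain ⟨x, x', hxx, ⟨g, hg, hgu, hqg, hgx⟩, f, hf, hfu, hfq, hfx⟩ := h1
    have hfg := hord' f hf g hg hfu hgu hfq hqg
    have hft := hfx.1
    have hgt := hgx.1
    have hfx' := mem_uIcc.1 hfx.2.2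
    have hgx' := mem_uIcc.1 hgx.2.2
    rcases le_or_gt x' (f.right t) with h1 | h1
    · obtain ⟨p, hxp, hpx⟩ := EReal.lt_iff_exists_rat_btwn.1 hxx
      obtain ⟨b, hb, hbv⟩ := exists_rat_Ioo_right
        ((tendsto_left_GT (hC hf) hft).eventually (lt_mem_nhds (hpx.trans_le h1)))
      have h2 := hfg.right_le hft hgt
      exact ⟨.inl (p, b), hb, f, hf, g, hg, hfu, hgu, hfq, hqg, hft, hgt, by grind, by grind, hbv⟩
    · obtain ⟨p, hxp, hpx⟩ := EReal.lt_iff_exists_rat_btwn.1 (max_lt hxx h1)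
      rw [max_lt_iff] at hxp
      have h2 : g.right t < (p : ℝ) := by
        have h3 := (hfg t).2 (.inr ⟨hft, by grind⟩)
        grind
      obtain ⟨b, hb, hbv⟩ := exists_rat_Ioo_right
        ((tendsto_left_GT (hC hg) hgt).eventually (gt_mem_nhds h2))
      exact ⟨.inr (p, b), hb, f, hf, g, hg, hfu, hgu, hfq, hqg, hft, hgt, by grind, hxp.2, hbv⟩
  · rintro (a | a) t ⟨ht, f, hf, g, hg, h1, h2, h3, h4, h5, h6, h7, h8, h9⟩ t'
      ⟨ht', f', hf', g', hg', h1', h2', h3', h4', h5', h6', h7', h8', h9'⟩ hlt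
    · have h10 := (hord' f hf g' hg' h1 h2' h3 h4' t').2
        (.inl (h5.trans_lt (EReal.coe_lt_coe_iff.2 hlt))) (.inr ⟨h6', h7'.trans h8'⟩)
      exact absurd (h10.trans_lt h7') (not_lt.2 (h9 t' ⟨hlt, ht'⟩).le)
    · have h10 := (hord' f' hf' g hg h1' h2 h3' h4 t').2
        (.inr ⟨h5', h8'.trans h7'⟩) (.inl (h6.trans_lt (EReal.coe_lt_coe_iff.2 hlt)))
      exact absurd (h7'.trans_le h10) (not_lt.2 (h9 t' ⟨hlt, ht'⟩).le)

/-- A strict inequality at `u+` persists, by right continuity, at a rational time with a rational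
level in between. -/
lemma hasCountableSlices_right_ne (hC : C ⊆ halfInfinite)
    (hord : ∀ f ∈ C, ∀ g ∈ C, f.LeftOf g ∨ g.LeftOf f) :
    HasCountableSlices {p | ∃ f ∈ C, ∃ g ∈ C, pt p.1 p.2 ∈ f.graph ∧ pt p.1 p.2 ∈ g.graph ∧
      ∃ u : ℝ, f.σ ≤ u ∧ g.σ ≤ u ∧ f.right u ≠ g.right u} := by
  refine (HasCountableSlices.iUnion (ι := ℚ × ℚ) fun a =>
    hasCountableSlices_of_lt_of_lt hC hord a.1 a.2).mono ?_
  rintro ⟨x, t⟩ ⟨f, hf, g, hg, hfx, hgx, u, hfu, hgu, hne⟩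
  wlog hlt : f.right u < g.right u generalizing f g
  · exact this g hg f hf hgx hfx hgu hfu hne.symm (hne.lt_or_gt.resolve_left hlt)
  obtain ⟨q, hq1, hq2⟩ := EReal.lt_iff_exists_rat_btwn.1 hlt
  obtain ⟨b, hb, hbv⟩ := exists_rat_Ioo_right
    (((tendsto_right_GT (hC hf) hfu).eventually (gt_mem_nhds hq1)).and
      ((tendsto_right_GT (hC hg) hgu).eventually (lt_mem_nhds hq2)))
  obtain ⟨v, hv, hvb⟩ := exists_rat_btwn hb
  have hv' := EReal.coe_le_coe_iff.2 hv.le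
  exact mem_iUnion.2 ⟨(v, q), f, hf, g, hg, hfx, hgx, hfu.trans hv', hgu.trans hv',
    hbv v ⟨hv, hvb⟩⟩

/-- Paths that agree at all times at which they are defined. -/
lemma hasCountableSlices_of_agree {G : Set CadlagPath} (hG : G ⊆ halfInfinite)
    (hagree : ∀ g ∈ G, ∀ g' ∈ G, ∀ w : ℝ, g.σ ≤ w → g'.σ ≤ w → g.right w = g'.right w) :
    HasCountableSlices {p | ∃ g ∈ G, (g.σ < p.2 ∧ pt p.1 p.2 ∈ g.graph) ∨
      (g.σ ≤ p.2 ∧ p.1 = g.right p.2)} := by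
  refine .of_countable_not_subsingleton ?_
  -- Together the paths form the graph of one function, and two points of a slice mean that it jumps
  -- there. The label is a rational level inside the jump and a rational time from which on the
  -- function stays, until `t`, on the near side of that level. An earlier time with this label
  -- would have its value on the far side.
  let Pu : ℚ × ℚ → Set ℝ := fun a => {t | a.2 < t ∧ ∃ g ∈ G, g.σ ≤ (a.2 : ℝ) ∧
    ((a.1 : ℝ) : EReal) < g.right t ∧ ∀ v ∈ Ioo (a.2 : ℝ) t, g.right v < (a.1 : ℝ)}
  let Pd : ℚ × ℚ → Set ℝ := fun a => {t | a.2 < t ∧ ∃ g ∈ G, g.σ ≤ (a.2 : ℝ) ∧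
    g.right t < (a.1 : ℝ) ∧ ∀ v ∈ Ioo (a.2 : ℝ) t, ((a.1 : ℝ) : EReal) < g.right v}
  refine countable_of_labels (L := (ℚ × ℚ) ⊕ (ℚ × ℚ)) (Sum.elim Pu Pd) ?_ ?_
  · intro t ht
    have h1 : ∃ g ∈ G, g.σ < t ∧ g.left t ≠ g.right t := by
      by_contra! h
      refine ht fun x hx x' hx' => ?_
      have key : ∀ {x}, (∃ g ∈ G, (g.σ < t ∧ pt x t ∈ g.graph) ∨ (g.σ ≤ t ∧ x = g.right t)) →
          ∃ g ∈ G, g.σ ≤ t ∧ x = g.right t := by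
        rintro x ⟨g, hg, h1 | h1⟩
        · refine ⟨g, hg, h1.1.le, ?_⟩
          simpa [h g hg h1.1] using h1.2.2.2
        · exact ⟨g, hg, h1⟩
      obtain ⟨g, hg, h1, rfl⟩ := key hx
      obtain ⟨g', hg', h1', rfl⟩ := key hx'
      exact hagree g hg g' hg' t h1 h1'
    obtain ⟨g, hg, hσ, hne⟩ := h1
    have hlim := tendsto_right_LT (hG hg) hσ
    rcases hne.lt_or_gt with h | h
    · obtain ⟨m, hm1, hm2⟩ := EReal.lt_iff_exists_rat_btwn.1 h
      obtain ⟨a, ha, hat, hav⟩ := exists_rat_Ioo_left hσ (hlim.eventually (gt_mem_nhds hm1))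
      exact ⟨.inl (m, a), hat, g, hg, ha, hm2, hav⟩
    · obtain ⟨m, hm1, hm2⟩ := EReal.lt_iff_exists_rat_btwn.1 h
      obtain ⟨a, ha, hat, hav⟩ := exists_rat_Ioo_left hσ (hlim.eventually (lt_mem_nhds hm2))
      exact ⟨.inr (m, a), hat, g, hg, ha, hm1, hav⟩
  · rintro (a | a) t ⟨ht, g, hg, h1, h2, h3⟩ t' ⟨ht', g', hg', h1', h2', h3'⟩ hlt
    all_goals
      have h4 := hagree g hg g' hg' t (h1.trans (EReal.coe_le_coe_iff.2 ht.le))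
        (h1'.trans (EReal.coe_le_coe_iff.2 ht.le))
      have h5 := h3' t ⟨ht, hlt⟩
      rw [h4] at h2
      exact absurd h2 (not_lt.2 h5.le)

/-- The pair starts at a common time `s` on both sides of the common value at `s+`. The sets `G a`
fix rational levels in the two initial jumps and a rational duration on which `g` is above the lower
level and `f` below the upper one. If `g` and `g'` in one `G a` were strictly ordered at some time,
`g` would be left of `f'` (up to exchange); but at the later of the two initial times, `f'` jumps up
from below the lower level or `g` jumps down from above the upper one, against this order. So the
paths of `G a` agree and `hasCountableSlices_of_agree` applies. -/
lemma hasCountableSlices_coalescing_initial (hC : C ⊆ halfInfinite)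
    (hord : ∀ f ∈ C, ∀ g ∈ C, f.LeftOf g ∨ g.LeftOf f) :
    HasCountableSlices {p | ∃ f ∈ C, ∃ g ∈ C, pt p.1 p.2 ∈ f.graph ∧ pt p.1 p.2 ∈ g.graph ∧
      ∃ s : ℝ, f.σ = s ∧ g.σ = s ∧ (∀ v : ℝ, s ≤ v → f.right v = g.right v) ∧
        f.left s < f.right s ∧ f.right s < g.left s} := by
  let G : ℚ × ℚ × ℚ → Set CadlagPath := fun a => {g ∈ C | ∃ f ∈ C, ∃ s : ℝ, f.σ = s ∧ g.σ = s ∧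
    (∀ v : ℝ, s ≤ v → f.right v = g.right v) ∧ s < a.2.2 ∧ f.left s < (a.1 : ℝ) ∧
    ((a.1 : ℝ) : EReal) < f.right s ∧ g.right s < (a.2.1 : ℝ) ∧ ((a.2.1 : ℝ) : EReal) < g.left s ∧
    ∀ v ∈ Ioo s (a.2.2 : ℝ), ((a.1 : ℝ) : EReal) < g.left v ∧ f.left v < (a.2.1 : ℝ)}
  have key : ∀ a, ∀ g ∈ G a, ∀ g' ∈ G a, ∀ w : ℝ, g.σ ≤ w → g'.σ ≤ w →
      ¬ g.right w < g'.right w := by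
    rintro ⟨p, q, b⟩ g ⟨hg, f, hf, s, hfs, hgs, hfg, hsb, h1, h2, h3, h4, h5⟩ g' ⟨hg', f', hf', s',
      hfs', hgs', hfg', hsb', h1', h2', h3', h4', h5'⟩ w hw hw' hlt
    dsimp only at *
    rw [hgs] at hw
    rw [hgs'] at hw'
    rw [← hfg' w (EReal.coe_le_coe_iff.1 hw')] at hlt
    have h6 : g.LeftOf f' := leftOf_of_right_lt (hord g hg f' hf') (hgs ▸ hw) (hfs' ▸ hw') hlt
    rcases lt_trichotomy s s' with h | h | h
    · have h7 := (h6 s').2 (.inl (hgs ▸ EReal.coe_lt_coe_iff.2 h)) (.inr ⟨hfs'.le, h1'.trans h2'⟩)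
      exact absurd (h7.trans_lt h1') (not_lt.2 (h5 s' ⟨h, hsb'⟩).1.le)
    · subst h
      have h7 := (h6 s).2 (.inr ⟨hgs.le, h3.trans h4⟩) (.inr ⟨hfs'.le, h1'.trans h2'⟩)
      have h8 := hfg s le_rfl
      exact absurd (h4.trans_le h7) (not_lt.2 (h1'.trans (h2.trans (h8 ▸ h3))).le)
    · have h7 := (h6 s).2 (.inr ⟨hgs.le, h3.trans h4⟩) (.inl (hfs' ▸ EReal.coe_lt_coe_iff.2 h))
      exact absurd (h4.trans_le h7) (not_lt.2 (h5' s ⟨h, hsb⟩).2.le)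
  refine (HasCountableSlices.iUnion fun a => hasCountableSlices_of_agree (G := G a)
    (fun g hg => hC hg.1) fun g hg g' hg' w hw hw' => le_antisymm
      (not_lt.1 (key a g' hg' g hg w hw' hw)) (not_lt.1 (key a g hg g' hg' w hw hw'))).mono ?_
  rintro ⟨x, t⟩ ⟨f, hf, g, hg, hfx, hgx, s, hfs, hgs, hfg, h1, h2⟩
  obtain ⟨p, hp1, hp2⟩ := EReal.lt_iff_exists_rat_btwn.1 h1
  obtain ⟨q, hq1, hq2⟩ := EReal.lt_iff_exists_rat_btwn.1 h2
  have h3 := hfg s le_rfl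
  obtain ⟨b, hb, hbv⟩ := exists_rat_Ioo_right
    (((tendsto_left_GT (hC hg) hgs.le).eventually (lt_mem_nhds (h3 ▸ hp2))).and
      ((tendsto_left_GT (hC hf) hfs.le).eventually (gt_mem_nhds hq1)))
  refine mem_iUnion.2 ⟨(p, q, b), g, ⟨hg, f, hf, s, hfs, hgs, hfg, hb, hp1, hp2, h3 ▸ hq1, hq2, hbv⟩,
    ?_⟩
  rcases hgx.1.lt_or_eq with h4 | h4
  · exact .inl ⟨h4, hgx⟩
  · obtain rfl : s = t := EReal.coe_injective (hgs.symm.trans h4)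
    refine .inr ⟨h4.le, ?_⟩
    have hfx' := mem_uIcc.1 hfx.2.2
    have hgx' := mem_uIcc.1 hgx.2.2
    dsimp only at *
    grind

/-- Here `g` starts at `s` above an older path `f` and drops onto it. The sets `G a` fix a rational
level `q` inside the drop and a rational time interval around `s` on which `f` is below `q`. If
`g(w+) < g'(w+) = f'(w+)`, then `g` would be left of `f'`, although it starts above `q` where `f'`
is below. So each `G a` consists of paths that agree. Common points on the drop itself, at time `s`
and away from `g(s+)`, need a jump down of `f` at `s`; the times `T` of these jumps are countable by
a similar argument with a further level `m` in the jump. -/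
lemma hasCountableSlices_coalescing_above (hC : C ⊆ halfInfinite)
    (hord : ∀ f ∈ C, ∀ g ∈ C, f.LeftOf g ∨ g.LeftOf f) :
    HasCountableSlices {p | ∃ f ∈ C, ∃ g ∈ C, pt p.1 p.2 ∈ f.graph ∧ pt p.1 p.2 ∈ g.graph ∧
      ∃ s : ℝ, f.σ < s ∧ g.σ = s ∧ (∀ v : ℝ, s ≤ v → f.right v = g.right v) ∧
        f.left s < g.left s ∧ f.right s < g.left s} := by
  let G : ℚ × ℚ × ℚ → Set CadlagPath := fun a => {g ∈ C | ∃ f ∈ C, ∃ s : ℝ, f.σ ≤ (a.2.1 : ℝ) ∧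
    g.σ = s ∧ (∀ v : ℝ, s ≤ v → f.right v = g.right v) ∧ a.2.1 < s ∧ s < a.2.2 ∧
    g.right s < (a.1 : ℝ) ∧ ((a.1 : ℝ) : EReal) < g.left s ∧
    ∀ v ∈ Ioo (a.2.1 : ℝ) (a.2.2 : ℝ), f.left v < (a.1 : ℝ)}
  let T : ℚ × ℚ × ℚ × ℚ → Set ℝ := fun a => {s | ∃ f ∈ C, ∃ g ∈ C, f.σ ≤ (a.2.1 : ℝ) ∧
    g.σ = s ∧ (∀ v : ℝ, s ≤ v → f.right v = g.right v) ∧ a.2.1 < s ∧ s < a.2.2.1 ∧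
    g.right s < (a.1 : ℝ) ∧ ((a.1 : ℝ) : EReal) < g.left s ∧
    (∀ v ∈ Ioo (a.2.1 : ℝ) (a.2.2.1 : ℝ), f.left v < (a.1 : ℝ)) ∧ g.right s < (a.2.2.2 : ℝ) ∧
    ∀ v ∈ Ioo (a.2.1 : ℝ) s, ((a.2.2.2 : ℝ) : EReal) < f.right v}
  have hT : (⋃ a, T a).Countable := by
    refine countable_of_labels T (fun t ht => mem_iUnion.1 ht) ?_
    rintro ⟨q, a, b, m⟩ s ⟨f, hf, g, hg, hfa, hgs, hfg, has, hsb, h1, h2, h3, h4, h5⟩ s'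
      ⟨f', hf', g', hg', hfa', hgs', hfg', has', hsb', h1', h2', h3', h4', h5'⟩ hlt
    dsimp only at *
    have h6 := h5' s ⟨has, hlt⟩
    have has'' := EReal.coe_lt_coe_iff.2 has
    have h7 : g.LeftOf f' := leftOf_of_right_lt (hord g hg f' hf') hgs.le
      (hfa'.trans has''.le) (h4.trans h6)
    have h8 := (h7 s).2 (.inr ⟨hgs.le, h1.trans h2⟩) (.inl (hfa'.trans_lt has''))
    exact absurd (h2.trans_le h8) (not_lt.2 (h3' s ⟨has, hsb⟩).le)
  have key : ∀ a, ∀ g ∈ G a, ∀ g' ∈ G a, ∀ w : ℝ, g.σ ≤ w → g'.σ ≤ w →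
      ¬ g.right w < g'.right w := by
    rintro ⟨q, a, b⟩ g ⟨hg, f, hf, s, hfa, hgs, hfg, has, hsb, h1, h2, h3⟩ g' ⟨hg', f', hf', s',
      hfa', hgs', hfg', has', hsb', h1', h2', h3'⟩ w hw hw' hlt
    dsimp only at *
    rw [hgs] at hw
    rw [hgs'] at hw'
    rw [← hfg' w (EReal.coe_le_coe_iff.1 hw')] at hlt
    have has'' := EReal.coe_lt_coe_iff.2 has
    have h7 : g.LeftOf f' := leftOf_of_right_lt (hord g hg f' hf') (hgs ▸ hw)
      (hfa'.trans (has''.le.trans hw)) hlt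
    have h8 := (h7 s).2 (.inr ⟨hgs.le, h1.trans h2⟩) (.inl (hfa'.trans_lt has''))
    exact absurd (h2.trans_le h8) (not_lt.2 (h3' s ⟨has, hsb⟩).le)
  refine ((HasCountableSlices.iUnion fun a => hasCountableSlices_of_agree (G := G a)
    (fun g hg => hC hg.1) fun g hg g' hg' w hw hw' => le_antisymm
      (not_lt.1 (key a g' hg' g hg w hw' hw)) (not_lt.1 (key a g hg g' hg' w hw hw'))).union
    (HasCountableSlices.of_countable_times (Z := {p | p.2 ∈ ⋃ a, T a}) hT fun p hp => hp)).mono ?_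
  rintro ⟨x, t⟩ ⟨f, hf, g, hg, hfx, hgx, s, hfs, hgs, hfg, h1, h2⟩
  obtain ⟨q, hq1, hq2⟩ := EReal.lt_iff_exists_rat_btwn.1 (max_lt h1 h2)
  rw [max_lt_iff] at hq1
  have h3 := hfg s le_rfl
  obtain ⟨b, hb, hbv⟩ := exists_rat_Ioo_right
    ((tendsto_left_GT (hC hf) hfs.le).eventually (gt_mem_nhds hq1.2))
  have hleft := (tendsto_left_LT (hC hf) hfs).eventually (gt_mem_nhds hq1.1)
  have hglue : ∀ a : ℚ, (∀ v ∈ Ioo (a : ℝ) s, f.left v < (q : ℝ)) →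
      ∀ v ∈ Ioo (a : ℝ) (b : ℝ), f.left v < (q : ℝ) := by
    intro a ha v hv
    rcases lt_trichotomy v s with h | rfl | h
    exacts [ha v ⟨hv.1, h⟩, hq1.1, hbv v ⟨h, hv.2⟩]
  obtain ⟨a, ha, has, hav⟩ := exists_rat_Ioo_left hfs hleft
  have hgG : g ∈ G (q, a, b) := ⟨hg, f, hf, s, ha, hgs, hfg, has, hb, h3 ▸ hq1.2, hq2, hglue a hav⟩
  rcases hgx.1.lt_or_eq with h4 | h4
  · exact .inl (mem_iUnion.2 ⟨(q, a, b), g, hgG, .inl ⟨h4, hgx⟩⟩)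
  obtain rfl : s = t := EReal.coe_injective (hgs.symm.trans h4)
  rcases eq_or_ne x (g.right s) with h5 | h5
  · exact .inl (mem_iUnion.2 ⟨(q, a, b), g, hgG, .inr ⟨h4.le, h5⟩⟩)
  right
  have h6 : f.right s < f.left s := by
    have hfx' := mem_uIcc.1 hfx.2.2
    have hgx' := mem_uIcc.1 hgx.2.2
    dsimp only at *
    grind
  obtain ⟨m, hm1, hm2⟩ := EReal.lt_iff_exists_rat_btwn.1 h6
  obtain ⟨a', ha', has', hav'⟩ := exists_rat_Ioo_left hfs
    (hleft.and ((tendsto_right_LT (hC hf) hfs).eventually (lt_mem_nhds hm2)))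
  exact mem_iUnion.2 ⟨(q, a', b, m), f, hf, g, hg, ha', hgs, hfg, has', hb, h3 ▸ hq1.2, hq2,
    hglue a' fun v hv => (hav' v hv).1, h3 ▸ hm1, fun v hv => (hav' v hv).2⟩

lemma hasCountableSlices_coalescing_below (hC : C ⊆ halfInfinite)
    (hord : ∀ f ∈ C, ∀ g ∈ C, f.LeftOf g ∨ g.LeftOf f) :
    HasCountableSlices {p | ∃ f ∈ C, ∃ g ∈ C, pt p.1 p.2 ∈ f.graph ∧ pt p.1 p.2 ∈ g.graph ∧
      ∃ s : ℝ, f.σ < s ∧ g.σ = s ∧ (∀ v : ℝ, s ≤ v → f.right v = g.right v) ∧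
        g.left s < f.left s ∧ g.left s < f.right s} := by
  have hC' : neg '' C ⊆ halfInfinite := by
    rintro _ ⟨f, hf, rfl⟩
    exact neg_mem_halfInfinite.2 (hC hf)
  have hord' : ∀ f ∈ neg '' C, ∀ g ∈ neg '' C, f.LeftOf g ∨ g.LeftOf f := by
    rintro _ ⟨f, hf, rfl⟩ _ ⟨g, hg, rfl⟩
    rw [leftOf_neg_iff, leftOf_neg_iff]
    exact hord g hg f hf
  refine (hasCountableSlices_coalescing_above hC' hord').neg.mono ?_
  rintro ⟨x, t⟩ ⟨f, hf, g, hg, hfx, hgx, s, hfs, hgs, hfg, h1, h2⟩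
  exact ⟨_, ⟨f, hf, rfl⟩, _, ⟨g, hg, rfl⟩, pt_neg_mem_graph_neg.2 hfx, pt_neg_mem_graph_neg.2 hgx,
    s, hfs, hgs, fun v hv => congrArg Neg.neg (hfg v hv), EReal.neg_lt_neg_iff.2 h1,
    EReal.neg_lt_neg_iff.2 h2⟩

/-- All but countably many time slices of the set of ramified points are countable. -/
theorem hasCountableSlices_ramified (hC : C ⊆ halfInfinite) (hNC : SetNonCrossing C) :
    HasCountableSlices {p | ¬ NonRamified C (pt p.1 p.2)} := by
  have hord : ∀ f ∈ C, ∀ g ∈ C, f.LeftOf g ∨ g.LeftOf f := fun f hf g hg =>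
    (nonCrossing_iff (hC hf) (hC hg)).1 (hNC f hf g hg)
  refine ((hasCountableSlices_right_ne hC hord).union
    ((hasCountableSlices_coalescing_initial hC hord).union
      ((hasCountableSlices_coalescing_above hC hord).union
        (hasCountableSlices_coalescing_below hC hord)))).mono ?_
  rintro ⟨x, t⟩ hram
  simp only [mem_ofPred_eq, NonRamified, not_forall, not_or] at hram
  obtain ⟨f, ⟨hf, hfx⟩, g, ⟨hg, hgx⟩, h1, h2⟩ := hram
  wlog hσ : f.σ ≤ g.σ generalizing f g
  · exact this g hg hgx f hf hfx h2 h1 (le_of_not_ge hσ)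
  -- Incomparable paths either differ at some `u+`, or agree after the later start; in the latter
  -- case the obstruction is an initial value off the segment of the other path.
  by_cases hne : ∃ u : ℝ, f.σ ≤ u ∧ g.σ ≤ u ∧ f.right u ≠ g.right u
  · exact .inl ⟨f, hf, g, hg, hfx, hgx, hne⟩
  right
  push Not at hne
  have hR : ∀ v : ℝ, g.σ ≤ v → f.right v = g.right v := fun v hv => hne v (hσ.trans hv) hv
  have hL : ∀ v : ℝ, g.σ < v → f.left v = g.left v := fun v hv =>
    left_eq_of_right_eq (hC hf) (hC hg) hσ le_rfl hR hv
  rw [extends_iff (hC hg) (hC hf)] at h2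
  obtain ⟨s, hgs, h3⟩ : ∃ s : ℝ, g.σ = s ∧ g.left s ∉ uIcc (f.left s) (f.right s) := by
    by_contra! h
    exact h2 ⟨hσ, fun v hv => (hR v hv).symm, fun v hv => (hL v hv).symm, h⟩
  rw [hgs] at hσ
  have hR' : ∀ v : ℝ, s ≤ v → f.right v = g.right v := fun v hv =>
    hR v (hgs ▸ EReal.coe_le_coe_iff.2 hv)
  rcases hσ.lt_or_eq with h4 | h4
  · right
    rw [mem_uIcc] at h3
    by_cases h5 : f.left s < g.left s ∧ f.right s < g.left s
    · exact .inl ⟨f, hf, g, hg, hfx, hgx, s, h4, hgs, hR', h5⟩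
    · exact .inr ⟨f, hf, g, hg, hfx, hgx, s, h4, hgs, hR', by grind, by grind⟩
  · left
    have h5 : f.left s ∉ uIcc (g.left s) (g.right s) := by
      intro h
      refine h1 ((extends_iff (hC hf) (hC hg)).2 ⟨by rw [h4, hgs], fun v hv => ?_, fun v hv => ?_,
        fun v hv => ?_⟩)
      · exact hR v (by rwa [hgs, ← h4])
      · exact hL v (by rwa [hgs, ← h4])
      · obtain rfl : s = v := EReal.coe_injective (h4.symm.trans hv)
        exact h
    have h6 := hR' s le_rfl
    rw [mem_uIcc] at h3 h5
    -- Neither initial value lies between the other one and the common value at `s+`, so they lie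
    -- strictly on opposite sides of it.
    by_cases h7 : f.left s < f.right s
    · exact ⟨f, hf, g, hg, hfx, hgx, s, h4, hgs, hR', h7, by grind⟩
    · exact ⟨g, hg, f, hf, hgx, hfx, s, hgs, h4, fun v hv => (hR' v hv).symm, by grind, by grind⟩

end Ramified

end Weaves

namespace Weaves

open SpaceTime CadlagPath

/-! ### Webs of deterministic weaves -/

/-- A compact, pervasive and non-crossing set of half-infinite paths. -/
structure IsWeaveSet (A : Set CadlagPath) : Prop where
  compact : IsCompact A
  half_infinite : A ⊆ halfInfinite
  pervasive : Pervasive A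
  non_crossing : SetNonCrossing A

lemma dense_setOf_nonRamified {C : Set CadlagPath} (hC : C ⊆ halfInfinite)
    (hNC : SetNonCrossing C) : Dense {p : ℝ × ℝ | NonRamified C (ofPlane p)} := by
  obtain ⟨T, hT, h⟩ := hasCountableSlices_ramified hC hNC
  rw [dense_iff_inter_open]
  rintro U hU ⟨⟨x, t⟩, hxt⟩
  obtain ⟨V, W, hV, hW, hxV, htW, hVW⟩ := isOpen_prod_iff.1 hU x t hxt
  obtain ⟨t', ht'W, ht'⟩ := (hT.dense_compl ℝ).inter_open_nonempty W hW ⟨t, htW⟩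
  obtain ⟨x', hx'V, hx'⟩ := (((h t' ht').preimage EReal.coe_injective).dense_compl
    ℝ).inter_open_nonempty V hV ⟨x, hxV⟩
  exact ⟨(x', t'), hVW ⟨hx'V, ht'W⟩, not_not.1 hx'⟩

lemma dense_ofPlane_image {D : Set (ℝ × ℝ)} (hD : Dense D) : Dense (ofPlane '' D) :=
  denseRange_ofPlane.dense_image continuous_ofPlane hD

lemma NonRamified.mono {A B : Set CadlagPath} {z : SpaceTime} (h : NonRamified B z) (hAB : A ⊆ B) :
    NonRamified A z :=
  fun f hf g hg => h f ⟨hAB hf.1, hf.2⟩ g ⟨hAB hg.1, hg.2⟩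

lemma NonRamified.eq_of_mem_restrict {A : Set CadlagPath} {z : SpaceTime} (h : NonRamified A z)
    (hA : A ⊆ halfInfinite) {p q : CadlagPath} (hp : p ∈ restrict A {z})
    (hq : q ∈ restrict A {z}) : p = q := by
  obtain ⟨hp1, z, rfl, f, hf, hfp, hpz⟩ := hp
  obtain ⟨hq1, z, rfl, g, hg, hgq, hqz⟩ := hq
  rcases h f hf g hg with h1 | h1
  · exact eq_of_extends_of_initialPoint_eq hp1 hq1 (hA hg.1) (h1.trans hfp) hgq (hpz.trans hqz.symm)
  · exact eq_of_extends_of_initialPoint_eq hp1 hq1 (hA hf.1) hfp (h1.trans hgq) (hpz.trans hqz.symm)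

lemma restrict_eq_biUnion (A : Set CadlagPath) (D : Set SpaceTime) :
    restrict A D = ⋃ z ∈ D, restrict A {z} := by
  ext g
  simp only [restrict, mem_ofPred_eq, mem_iUnion, mem_singleton_iff]
  constructor
  · rintro ⟨hg, z, hz, h⟩
    exact ⟨z, hz, hg, z, rfl, h⟩
  · rintro ⟨z, hz, hg, _, rfl, h⟩
    exact ⟨hg, _, hz, h⟩

lemma up_subset_halfInfinite (A : Set CadlagPath) : up A ⊆ halfInfinite := fun _ h => h.1

lemma restrict_subset_up (A : Set CadlagPath) (D : Set SpaceTime) : restrict A D ⊆ up A :=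
  fun _ ⟨hg, _, _, f, hf, hfg, _⟩ => ⟨hg, f, hf.1, hfg⟩

lemma up_up_subset (A : Set CadlagPath) : up (up A) ⊆ up A :=
  fun _ ⟨hg, _, ⟨_, f, hf, hfh⟩, hhg⟩ => ⟨hg, f, hf, hfh.trans hhg⟩

lemma up_mono {A B : Set CadlagPath} (h : A ⊆ B) : up A ⊆ up B :=
  fun _ ⟨hg, f, hf, hfg⟩ => ⟨hg, f, h hf, hfg⟩

lemma isCompact_up {A : Set CadlagPath} (hA : IsCompact A) : IsCompact (up A) := by
  rw [isCompact_iff_ultrafilter_le_nhds]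
  intro U hU
  rw [le_principal_iff] at hU
  obtain ⟨f, hf⟩ := (show ∀ᶠ g in (U : Filter CadlagPath), ∃ f, f ∈ A ∧ f.Extends g from
    Filter.mem_of_superset hU fun g hg => hg.2).choice
  obtain ⟨f₀, hf₀, hlim⟩ := hA.ultrafilter_le_nhds (U.map f)
    (le_principal_iff.2 (hf.mono fun _ h => h.1))
  obtain ⟨k, hk, hfk⟩ := exists_tendsto_of_extends (h := id) (U := U) hlim (hf.mono fun _ h => h.2)
  exact ⟨k, ⟨isClosed_halfInfinite.mem_of_tendsto hk
    (Filter.mem_of_superset hU fun g hg => hg.1), f₀, hf₀, hfk⟩, hk⟩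

lemma webOn_subset_up {A : Set CadlagPath} (hA : IsCompact A) (D : Set SpaceTime) :
    webOn D A ⊆ up A :=
  closure_minimal ((up_mono (restrict_subset_up A D)).trans (up_up_subset A))
    (isCompact_up hA).isClosed

lemma isCompact_webOn {A : Set CadlagPath} (hA : IsCompact A) (D : Set SpaceTime) :
    IsCompact (webOn D A) :=
  (isCompact_up hA).of_isClosed_subset isClosed_closure (webOn_subset_up hA D)

lemma restrict_subset_webOn (A : Set CadlagPath) (D : Set SpaceTime) : restrict A D ⊆ webOn D A :=
  fun g hg => subset_closure ⟨hg.1, g, hg, Extends.refl g⟩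

lemma webOn_congr {A B : Set CadlagPath} {D : Set SpaceTime}
    (h : ∀ z ∈ D, restrict A {z} = restrict B {z}) : webOn D A = webOn D B := by
  rw [webOn, webOn, restrict_eq_biUnion A, restrict_eq_biUnion B, iUnion₂_congr h]

namespace IsWeaveSet

variable {A B : Set CadlagPath} {D D' : Set SpaceTime}

lemma exists_mem_restrict (hA : IsWeaveSet A) (z : SpaceTime) : ∃ p, p ∈ restrict A {z} := by
  obtain ⟨f, hf⟩ := hA.pervasive z
  obtain ⟨p, hp, hfp, hpz⟩ := exists_restriction (hA.half_infinite hf.1) hf.2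
  exact ⟨p, hp, z, rfl, f, hf, hfp, hpz⟩

lemma exists_restrict_eq (hA : IsWeaveSet A) {z : SpaceTime} (hz : NonRamified A z) :
    ∃ p, restrict A {z} = {p} := by
  obtain ⟨p, hp⟩ := hA.exists_mem_restrict z
  exact ⟨p, eq_singleton_iff_unique_mem.2
    ⟨hp, fun q hq => hz.eq_of_mem_restrict hA.half_infinite hq hp⟩⟩

/-- Compactness of `A` gives limits of the extending paths, hence of the restrictions, and initial
points are continuous. At a non-ramified `z` the limit is the only path from `z`, so the paths
started at nearby points must converge to it. -/
lemma exists_tendsto_restrict (hA : IsWeaveSet A) {z : SpaceTime} {U : Ultrafilter SpaceTime}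
    (hU : (U : Filter SpaceTime) ≤ 𝓝 z) {p : SpaceTime → CadlagPath}
    (hp : ∀ w, p w ∈ restrict A {w}) : ∃ q ∈ restrict A {z}, Tendsto p U (𝓝 q) := by
  choose hp1 w hw f hf hfp hpw using hp
  obtain ⟨f₀, hf₀, hlim⟩ := hA.compact.ultrafilter_le_nhds (U.map f)
    (le_principal_iff.2 (Filter.univ_mem' (f := (U : Filter SpaceTime)) fun w => (hf w).1))
  obtain ⟨q, hq, hfq⟩ := exists_tendsto_of_extends (U := U) hlim (.of_forall hfp)
  have hqz : q.initialPoint = z := by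
    refine tendsto_nhds_unique ((continuous_initialPoint.tendsto q).comp hq) ?_
    exact Tendsto.congr (fun v => ((hpw v).trans (hw v)).symm) (tendsto_id'.2 hU)
  refine ⟨q, ⟨isClosed_halfInfinite.mem_of_tendsto hq (.of_forall hp1), z, rfl, f₀,
    ⟨hf₀, ?_⟩, hfq, hqz⟩, hq⟩
  exact hqz ▸ hfq.graph_subset q.initialPoint_mem_graph

lemma exists_mem_webOn (hA : IsWeaveSet A) (hD : Dense D) (z : SpaceTime) :
    ∃ h ∈ webOn D A, h.initialPoint = z := by
  obtain ⟨U, hUD, hU⟩ := mem_closure_iff_ultrafilter.1 (hD z)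
  choose p hp using hA.exists_mem_restrict
  obtain ⟨q, ⟨-, _, rfl, -, -, -, hqz⟩, hq⟩ := hA.exists_tendsto_restrict hU hp
  refine ⟨q, isClosed_closure.mem_of_tendsto hq ?_, hqz⟩
  filter_upwards [hUD] with w hw
  refine restrict_subset_webOn A D ?_
  rw [restrict_eq_biUnion]
  exact mem_iUnion₂.2 ⟨w, hw, hp w⟩

/-- A path `p` from a non-ramified `z ∈ D` is a limit of paths `P w` started at points `w ∈ D'`,
whichever these are. A later part `g` of `p` is the limit of the parts of `P w` that start at points
`v w` converging to the initial point of `g`. Applied in both directions, this shows that the web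
does not depend on `D`. -/
lemma webOn_subset (hA : IsWeaveSet A) (hD : ∀ z ∈ D, NonRamified A z) (hD' : Dense D') :
    webOn D A ⊆ webOn D' A := by
  refine closure_minimal ?_ isClosed_closure
  rintro g ⟨hg, p, hp, hpg⟩
  rw [restrict_eq_biUnion] at hp
  obtain ⟨z, hz, hp⟩ := mem_iUnion₂.1 hp
  obtain ⟨U, hUD, hU⟩ := mem_closure_iff_ultrafilter.1 (hD' z)
  choose P hP using hA.exists_mem_restrict
  obtain ⟨q, hq, hlim⟩ := hA.exists_tendsto_restrict hU hP
  obtain rfl := (hD z hz).eq_of_mem_restrict hA.half_infinite hp hq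
  obtain ⟨v, hv, hvlim⟩ := exists_tendsto_graph hlim (hpg.graph_subset g.initialPoint_mem_graph)
  choose k hk hPk hkv using fun w => exists_restriction (hP w).1 (hv w)
  obtain ⟨k₀, hk₀, hpk₀⟩ := exists_tendsto_of_extends hlim (.of_forall hPk)
  have hk₀g : k₀ = g := by
    refine eq_of_extends_of_initialPoint_eq (isClosed_halfInfinite.mem_of_tendsto hk₀
      (.of_forall hk)) hg hp.1 hpk₀ hpg ?_
    exact tendsto_nhds_unique ((continuous_initialPoint.tendsto k₀).comp hk₀)
      (hvlim.congr fun w => (hkv w).symm)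
  rw [← hk₀g]
  refine isClosed_closure.mem_of_tendsto hk₀ ?_
  filter_upwards [hUD] with w hw
  refine subset_closure ⟨hk w, P w, ?_, hPk w⟩
  rw [restrict_eq_biUnion]
  exact mem_iUnion₂.2 ⟨w, hw, hP w⟩

/-- The web does not depend on the choice of the dense set of non-ramified points. -/
lemma webOn_eq (hA : IsWeaveSet A) (hD : ∀ z ∈ D, NonRamified A z) (hDd : Dense D)
    (hD' : ∀ z ∈ D', NonRamified A z) (hDd' : Dense D') : webOn D A = webOn D' A :=
  (hA.webOn_subset hD hDd').antisymm (hA.webOn_subset hD' hDd)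

lemma dense_nonRamified (hA : A ⊆ halfInfinite) (hNC : SetNonCrossing A) :
    Dense {z ∈ range ofPlane | NonRamified A z} := by
  refine (dense_ofPlane_image (dense_setOf_nonRamified hA hNC)).mono ?_
  rintro _ ⟨p, hp, rfl⟩
  exact ⟨mem_range_self p, hp⟩

lemma web_eq_webOn (hA : IsWeaveSet A) (hD : ∀ z ∈ D, NonRamified A z) (hDd : Dense D) :
    web A = webOn D A :=
  hA.webOn_eq (fun _ hz => hz.2) (dense_nonRamified hA.half_infinite hA.non_crossing) hD hDd

lemma isCompact_web (hA : IsWeaveSet A) : IsCompact (web A) := isCompact_webOn hA.compact _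

lemma web_subset_up (hA : IsWeaveSet A) : web A ⊆ up A := webOn_subset_up hA.compact _

lemma exists_mem_web (hA : IsWeaveSet A) (z : SpaceTime) : ∃ h ∈ web A, h.initialPoint = z :=
  hA.exists_mem_webOn (dense_nonRamified hA.half_infinite hA.non_crossing) z

/-- Weaves that do not cross each other have the same web. -/
theorem web_eq_of_nonCrossing (hA : IsWeaveSet A) (hB : IsWeaveSet B)
    (h : SetNonCrossing (A ∪ B)) : web A = web B := by
  have hAB : A ∪ B ⊆ halfInfinite := union_subset hA.half_infinite hB.half_infinite
  -- One dense set serves both webs: the points that are non-ramified in the union, at which the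
  -- paths of `A` and of `B` coincide.
  have hd := dense_nonRamified hAB h
  rw [hA.web_eq_webOn (fun z hz => hz.2.mono subset_union_left) hd,
    hB.web_eq_webOn (fun z hz => hz.2.mono subset_union_right) hd]
  refine webOn_congr fun z hz => ?_
  obtain ⟨p, hp⟩ := hA.exists_restrict_eq (hz.2.mono subset_union_left)
  obtain ⟨q, hq⟩ := hB.exists_restrict_eq (hz.2.mono subset_union_right)
  have hmono : ∀ {S S' : Set CadlagPath}, S ⊆ S' → restrict S {z} ⊆ restrict S' {z} :=
    fun hs _ ⟨h1, w, hw, f, hf, h2⟩ => ⟨h1, w, hw, f, ⟨hs hf.1, hf.2⟩, h2⟩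
  have hpq : p = q := hz.2.eq_of_mem_restrict hAB
    (hmono subset_union_left (hp ▸ mem_singleton p))
    (hmono subset_union_right (hq ▸ mem_singleton q))
  rw [hp, hq, hpq]

/-- The path from a point that is non-ramified in two weaves with the same web. -/
lemma restrict_eq_of_web_eq (hA : IsWeaveSet A) (hB : IsWeaveSet B) (h : web A = web B)
    {z : SpaceTime} (hzA : NonRamified A z) (hzB : NonRamified B z) :
    restrict A {z} = restrict B {z} := by
  obtain ⟨p, hp⟩ := hA.exists_restrict_eq hzA
  obtain ⟨q, hq⟩ := hB.exists_restrict_eq hzB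
  -- A path of the common web from `z` is part of a path of `A` and of a path of `B`, so it is the
  -- path from `z` for both.
  obtain ⟨k, hk, hkz⟩ := hA.exists_mem_web z
  have key : ∀ {S : Set CadlagPath}, k ∈ up S → k ∈ restrict S {z} :=
    fun ⟨h1, f, hf, hfk⟩ => ⟨h1, z, rfl, f,
      ⟨hf, hkz ▸ hfk.graph_subset k.initialPoint_mem_graph⟩, hfk, hkz⟩
  have h1 := key (hA.web_subset_up hk)
  have h2 := key (hB.web_subset_up (h ▸ hk))
  rw [hp, mem_singleton_iff] at h1
  rw [hq, mem_singleton_iff] at h2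
  rw [hp, hq, ← h1, ← h2]

end IsWeaveSet

/-! ### Paths that do not cross a web -/

section Crossing

variable {W : Set CadlagPath} {f g : CadlagPath}

/-- A path of `W` started just after `s` from a point strictly between `g` and `f` has to be right
of `g` and left of `f`, and from then on it separates them. -/
lemma right_le_of_right_lt (hf : f ∈ halfInfinite) (hg : g ∈ halfInfinite)
    (hinit : ∀ z, ∃ h ∈ W, h.initialPoint = z)
    (hfW : ∀ h ∈ W, f.LeftOf h ∨ h.LeftOf f) (hgW : ∀ h ∈ W, g.LeftOf h ∨ h.LeftOf g)
    {s t : ℝ} (hfs : f.σ ≤ s) (hgs : g.σ ≤ s) (hlt : g.right s < f.right s) (hst : s < t) :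
    g.right t ≤ f.right t := by
  obtain ⟨y, hy1, hy2⟩ := exists_between hlt
  have h1 := (((tendsto_left_GT hg hgs).eventually (gt_mem_nhds hy1)).and
    ((tendsto_right_GT hg hgs).eventually (gt_mem_nhds hy1))).and
    (((tendsto_left_GT hf hfs).eventually (lt_mem_nhds hy2)).and
      ((tendsto_right_GT hf hfs).eventually (lt_mem_nhds hy2)))
  obtain ⟨v, ⟨⟨h2, h3⟩, h4, h5⟩, hv⟩ := (h1.and (Ioo_mem_nhdsGT hst)).exists
  obtain ⟨h, hh, hhz⟩ := hinit (pt y v)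
  have hmem : pt y v ∈ h.graph := hhz ▸ h.initialPoint_mem_graph
  have hvE := EReal.coe_lt_coe_iff.2 hv.1
  have hvt := EReal.coe_le_coe_iff.2 hv.2.le
  have hσ : h.σ ≤ t := hmem.1.trans hvt
  have h6 := (hgW h hh).resolve_right (not_leftOf_of_mem (hgs.trans_lt hvE) h2 h3 hmem)
  have h7 := (hfW h hh).resolve_left (not_leftOf_of_mem' (hfs.trans_lt hvE) h4 h5 hmem)
  exact (h6.right_le (hgs.trans (hvE.le.trans hvt)) hσ).trans
    (h7.right_le hσ (hfs.trans (hvE.le.trans hvt)))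

/-- The limit of paths started from `(y, v)`, as `v` increases to `s`. -/
lemma exists_limit_from_left {U : Ultrafilter ℝ} {s : ℝ} (hU : (U : Filter ℝ) ≤ 𝓝[<] s)
    {h : ℝ → CadlagPath} {k : CadlagPath} (hh : ∀ v, h v ∈ halfInfinite)
    (hk : Tendsto h U (𝓝 k)) {y : EReal} (hy : ∀ v, (h v).initialPoint = pt y v) :
    k.σ = s ∧ k.left s = y ∧ ∃ x, Tendsto (fun v => (h v).left s) U (𝓝 x) ∧
      x ∈ uIcc y (k.right s) := by
  have h1 : Tendsto (fun v => pt y v) U (𝓝 (pt y s)) :=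
    tendsto_pt_iff.2 ⟨(continuous_coe_real_ereal.tendsto s).mono_left
      (hU.trans nhdsWithin_le_nhds), tendsto_const_nhds⟩
  have h2 : k.initialPoint = pt y s :=
    tendsto_nhds_unique ((continuous_initialPoint.tendsto k).comp hk) (h1.congr fun v => (hy v).symm)
  have hσ : k.σ = s := by rw [← time_initialPoint, h2, time_pt]
  have hleft : k.left s = y := by
    rw [initialPoint_eq_pt hσ] at h2
    simpa using h2
  obtain ⟨w, hw⟩ := exists_tendsto U fun v => pt ((h v).left s) s
  have h3 := tendsto_nhds_unique ((continuous_time.tendsto w).comp hw) tendsto_const_nhds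
  obtain ⟨x, rfl⟩ : ∃ x, w = pt x s := ⟨_, time_eq_coe_iff.1 h3⟩
  refine ⟨hσ, hleft, x, (tendsto_pt_iff.1 hw).2, ?_⟩
  have h4 : pt x s ∈ k.graph := by
    refine mem_graph_of_tendsto_path hk hw ?_
    filter_upwards [hU self_mem_nhdsWithin] with v hv
    have hv' : (h v).σ = v := by rw [← time_initialPoint, hy, time_pt]
    exact ⟨hv' ▸ EReal.coe_le_coe_iff.2 (le_of_lt hv), (hh v).symm ▸ le_top, left_mem_uIcc⟩
  exact hleft ▸ h4.2.2

/-- The gap at `s-` can be seen only from the left, so paths `h v` of `W` are started at `(y, v)`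
with `g(s-) < y < f(s-)` and `v` increasing to `s`. They cannot separate `g` from `f` up to time
`t`, where the order is reversed; so, along the ultrafilter, they are all left of `g` or all right
of `f`. Against a path that exists before `s` this is absurd, as `(y, v)` lies strictly on its other
side. Against a path that starts at `s`, the limit `k` of `h v` gives the contradiction. -/
lemma false_of_left_lt (hf : f ∈ halfInfinite) (hg : g ∈ halfInfinite)
    (hW : IsCompact W) (hWh : W ⊆ halfInfinite) (hinit : ∀ z, ∃ h ∈ W, h.initialPoint = z)
    (hfW : ∀ h ∈ W, f.LeftOf h ∨ h.LeftOf f) (hgW : ∀ h ∈ W, g.LeftOf h ∨ h.LeftOf g)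
    {s t : ℝ} (hfs : f.σ < s ∨ (f.σ ≤ s ∧ f.right s < f.left s))
    (hgs : g.σ < s ∨ (g.σ ≤ s ∧ g.left s < g.right s)) (hlt : g.left s < f.left s)
    (hst : s ≤ t) (hlt' : f.right t < g.right t) : False := by
  have hfs' : f.σ ≤ s := hfs.elim le_of_lt And.left
  have hgs' : g.σ ≤ s := hgs.elim le_of_lt And.left
  have hstE := EReal.coe_le_coe_iff.2 hst
  obtain ⟨y, hy1, hy2⟩ := exists_between hlt
  choose h hh hhy using fun v : ℝ => hinit (pt y v)
  have hσ : ∀ v, (h v).σ = v := fun v => by rw [← time_initialPoint, hhy, time_pt]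
  have hmem : ∀ v, pt y v ∈ (h v).graph := fun v => hhy v ▸ (h v).initialPoint_mem_graph
  obtain ⟨U, hU⟩ := Ultrafilter.exists_le (𝓝[<] s)
  have hUs : ∀ᶠ v in (U : Filter ℝ), v < s := hU self_mem_nhdsWithin
  obtain ⟨k, hkW, hk⟩ := hW.ultrafilter_le_nhds (U.map h)
    (le_principal_iff.2 (Filter.univ_mem' (f := (U : Filter ℝ)) fun v => hh v))
  obtain ⟨hkσ, hky, x, hx, hxk⟩ := exists_limit_from_left hU (fun v => hWh (hh v)) hk hhy
  rw [mem_uIcc] at hxk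
  have hdich : ∀ᶠ v in (U : Filter ℝ), (h v).LeftOf g ∨ f.LeftOf (h v) := by
    filter_upwards [hUs] with v hv
    by_contra! hcon
    have h1 := (hgW _ (hh v)).resolve_right hcon.1
    have h2 := (hfW _ (hh v)).resolve_left hcon.2
    have h3 : (h v).σ ≤ t := hσ v ▸ (EReal.coe_le_coe_iff.2 hv.le).trans hstE
    exact absurd ((h1.right_le (hgs'.trans hstE) h3).trans (h2.right_le h3 (hfs'.trans hstE)))
      (not_le.2 hlt')
  have hσlt : ∀ {p : CadlagPath}, p.σ < s → ∀ᶠ v : ℝ in (U : Filter ℝ), p.σ < v := by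
    intro p hp
    obtain ⟨c, hc, hcs⟩ := EReal.lt_iff_exists_real_btwn.1 hp
    filter_upwards [hU (Ioo_mem_nhdsLT (EReal.coe_lt_coe_iff.1 hcs))] with v hv
    exact hc.trans (EReal.coe_lt_coe_iff.2 hv.1)
  rw [Ultrafilter.eventually_or] at hdich
  rcases hdich with hd | hd
  · rcases hgs with hgs | ⟨-, hgs⟩
    · obtain ⟨v, h1, h2, h3, h4⟩ := (hd.and ((hσlt hgs).and
        (((tendsto_left_LT hg hgs).mono_left hU).eventually (gt_mem_nhds hy1) |>.and
        (((tendsto_right_LT hg hgs).mono_left hU).eventually (gt_mem_nhds hy1))))).exists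
      exact not_leftOf_of_mem h2 h3 h4 (hmem v) h1
    -- The graph of `k` starts at `(y, s)` and contains `(x, s)` with `x ≤ g(s-) < y`, so `k` jumps
    -- down to at most `g(s-)` while `g` jumps up from `g(s-)`. Then `k` is neither right of `g` (at
    -- `s+`) nor left of it (at `s-`).
    · have h1 : x ≤ g.left s := by
        refine le_of_tendsto hx ?_
        filter_upwards [hd, hUs] with v hv hvs
        exact (hv s).2 (.inl (hσ v ▸ EReal.coe_lt_coe_iff.2 hvs)) (.inr ⟨hgs', hgs⟩)
      have h2 : k.right s < k.left s := by grind
      rcases hgW k hkW with h3 | h3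
      · have h4 := h3.right_le hgs' hkσ.le
        grind
      · have h4 := (h3 s).2 (.inr ⟨hkσ.le, h2⟩) (.inr ⟨hgs', hgs⟩)
        grind
  · rcases hfs with hfs | ⟨-, hfs⟩
    · obtain ⟨v, h1, h2, h3, h4⟩ := (hd.and ((hσlt hfs).and
        (((tendsto_left_LT hf hfs).mono_left hU).eventually (lt_mem_nhds hy2) |>.and
        (((tendsto_right_LT hf hfs).mono_left hU).eventually (lt_mem_nhds hy2))))).exists
      exact not_leftOf_of_mem' h2 h3 h4 (hmem v) h1
    · have h1 : f.left s ≤ x := by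
        refine ge_of_tendsto hx ?_
        filter_upwards [hd, hUs] with v hv hvs
        exact (hv s).2 (.inr ⟨hfs', hfs⟩) (.inl (hσ v ▸ EReal.coe_lt_coe_iff.2 hvs))
      have h2 : k.left s < k.right s := by grind
      rcases hfW k hkW with h3 | h3
      · have h4 := (h3 s).2 (.inr ⟨hfs', hfs⟩) (.inr ⟨hkσ.le, h2⟩)
        grind
      · have h4 := h3.right_le hkσ.le hfs'
        grind

/-- Two paths that do not cross the paths of a compact set with a path from each point do not cross
each other. -/
theorem leftOf_or_leftOf_of_web (hf : f ∈ halfInfinite) (hg : g ∈ halfInfinite)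
    (hW : IsCompact W) (hWh : W ⊆ halfInfinite) (hinit : ∀ z, ∃ h ∈ W, h.initialPoint = z)
    (hfW : ∀ h ∈ W, f.LeftOf h ∨ h.LeftOf f) (hgW : ∀ h ∈ W, g.LeftOf h ∨ h.LeftOf g) :
    f.LeftOf g ∨ g.LeftOf f := by
  by_contra! hcon
  -- A strict inequality at `s+` keeps its direction later, and the opposite one at an earlier time
  -- would have lasted until `s`. So the values at `t+` are ordered one way throughout.
  wlog hR : ∀ t : ℝ, f.σ ≤ t → g.σ ≤ t → f.right t ≤ g.right t generalizing f g
  · refine this hg hf hgW hfW hcon.symm fun t hgt hft => ?_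
    push Not at hR
    obtain ⟨s, hfs, hgs, hlt⟩ := hR
    rcases lt_trichotomy s t with h | rfl | h
    · exact right_le_of_right_lt hf hg hinit hfW hgW hfs hgs hlt h
    · exact hlt.le
    · by_contra! hlt'
      exact absurd (right_le_of_right_lt hg hf hinit hgW hfW hgt hft hlt' h) (not_le.2 hlt)
  -- Given the order at all `t+`, `LeftOf` can fail only at the left end of the later initial time,
  -- because further values at `t-` are limits of values at `v+`.
  have hstep : ∀ {p q : CadlagPath}, p ∈ halfInfinite → q ∈ halfInfinite → ¬ p.LeftOf q →
      (∀ t : ℝ, p.σ ≤ t → q.σ ≤ t → p.right t ≤ q.right t) →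
      ∃ s : ℝ, (p.σ < s ∨ (p.σ ≤ s ∧ p.right s < p.left s)) ∧
        (q.σ < s ∨ (q.σ ≤ s ∧ q.left s < q.right s)) ∧ q.left s < p.left s ∧
        p.σ ⊔ q.σ = s := by
    intro p q hp hq hpq hle
    unfold LeftOf at hpq
    push Not at hpq
    obtain ⟨s, hs⟩ := hpq
    obtain ⟨h1, h2, h3⟩ := hs fun h1 h2 => hle s h1 h2
    refine ⟨s, h1, h2, h3, (sup_le (h1.elim le_of_lt And.left) (h2.elim le_of_lt And.left)).eq_of_not_lt
      fun h4 => ?_⟩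
    rw [sup_lt_iff] at h4
    refine absurd (le_of_tendsto_of_tendsto (tendsto_right_LT hp h4.1) (tendsto_right_LT hq h4.2) ?_)
      (not_le.2 h3)
    obtain ⟨c, hc, hcs⟩ := EReal.lt_iff_exists_real_btwn.1 (sup_lt_iff.2 h4)
    filter_upwards [Ioo_mem_nhdsLT (EReal.coe_lt_coe_iff.1 hcs)] with v hv
    have hcv := hc.le.trans (EReal.coe_le_coe_iff.2 hv.1.le)
    exact hle v (le_sup_left.trans hcv) (le_sup_right.trans hcv)
  obtain ⟨s, h1, h2, h3, hs⟩ := hstep hf hg hcon.1 hR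
  -- If the right values always agree, both failures occur at the same time with opposite strict
  -- inequalities. Otherwise the order at `s-` is reversed at some later `t+`.
  by_cases hR' : ∀ t : ℝ, g.σ ≤ t → f.σ ≤ t → g.right t ≤ f.right t
  · obtain ⟨s', h1', h2', h3', hs'⟩ := hstep hg hf hcon.2 hR'
    obtain rfl : s = s' := EReal.coe_injective (by rw [← hs, ← hs', sup_comm])
    exact lt_asymm h3 h3'
  · push Not at hR'
    obtain ⟨t, hgt, hft, hlt⟩ := hR'
    exact false_of_left_lt hf hg hW hWh hinit hfW hgW h1 h2 h3
      (EReal.coe_le_coe_iff.1 (hs ▸ sup_le hft hgt)) hlt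

end Crossing

/-- Weaves with the same web do not cross each other. -/
theorem IsWeaveSet.nonCrossing_of_web_eq {A B : Set CadlagPath} (hA : IsWeaveSet A)
    (hB : IsWeaveSet B) (h : web A = web B) : SetNonCrossing (A ∪ B) := by
  have key : ∀ {S : Set CadlagPath}, IsWeaveSet S → ∀ f ∈ S, ∀ k ∈ web S,
      f.LeftOf k ∨ k.LeftOf f := by
    intro S hS f hf k hk
    obtain ⟨hk1, k', hk', hkk⟩ := hS.web_subset_up hk
    exact (nonCrossing_iff (hS.half_infinite hf) hk1).1
      ((hS.non_crossing k' hk' f hf).of_extends hkk).symm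
  have hAB : ∀ f ∈ A, ∀ g ∈ B, f.NonCrossing g := by
    intro f hf g hg
    refine (nonCrossing_iff (hA.half_infinite hf) (hB.half_infinite hg)).2 ?_
    exact leftOf_or_leftOf_of_web (hA.half_infinite hf) (hB.half_infinite hg) hA.isCompact_web
      (hA.web_subset_up.trans (up_subset_halfInfinite A)) hA.exists_mem_web (key hA f hf)
      (fun k hk => key hB g hg k (h ▸ hk))
  rintro f (hf | hf) g (hg | hg)
  exacts [hA.non_crossing f hf g hg, hAB f hf g hg, (hAB g hg f hf).symm, hB.non_crossing f hf g hg]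

end Weaves

namespace Weaves

open SpaceTime CadlagPath

/-! ### Measurability -/

/-- A map to the nonempty compact subsets of a metrisable space is measurable if the
events that it hits an open set are measurable. -/
lemma measurable_of_inter_nonempty {Ω X : Type*} [MeasurableSpace Ω] [TopologicalSpace X]
    [MetrizableSpace X] [SecondCountableTopology X] [MeasurableSpace (NonemptyCompacts X)]
    [BorelSpace (NonemptyCompacts X)] {F : Ω → NonemptyCompacts X}
    (h : ∀ U : Set X, IsOpen U → MeasurableSet {ω | ((F ω : Set X) ∩ U).Nonempty}) :
    Measurable F := by
  let _ := metrizableSpaceMetric X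
  have htop : (inferInstance : TopologicalSpace (NonemptyCompacts X)) = .generateFrom
      (preimage (fun K : NonemptyCompacts X => (K : Set X)) '' (powerset '' {U | IsOpen U} ∪
        (fun V => {s | (s ∩ V).Nonempty}) '' {V | IsOpen V})) := by
    rw [← induced_generateFrom_eq]
    let _ : TopologicalSpace (Set X) := .vietoris X
    exact NonemptyCompacts.isEmbedding_coe.eq_induced
  rw [BorelSpace.measurable_eq (α := NonemptyCompacts X), borel_eq_generateFrom_of_subbasis htop]
  refine measurable_generateFrom ?_
  rintro _ ⟨_, ⟨U, hU, rfl⟩ | ⟨U, hU, rfl⟩, rfl⟩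
  -- A compact set lies in `U` exactly if it misses some thickening of `Uᶜ`, so containment events
  -- are countable unions of complements of hitting events.
  · have h1 : F ⁻¹' ((fun K : NonemptyCompacts X => (K : Set X)) ⁻¹' 𝒫 U) =
        ⋃ n : ℕ, {ω | ((F ω : Set X) ∩ Metric.thickening (1 / ((n : ℝ) + 1)) Uᶜ).Nonempty}ᶜ := by
      ext ω
      simp only [mem_preimage, mem_powerset_iff, mem_iUnion, mem_compl_iff, mem_ofPred_eq,
        not_nonempty_iff_eq_empty, ← disjoint_iff_inter_eq_empty]
      constructor
      · intro hω
        obtain ⟨δ, hδ, hd⟩ := (disjoint_compl_right_iff_subset.2 hω).exists_thickenings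
          (F ω).isCompact hU.isClosed_compl
        obtain ⟨n, hn⟩ := exists_nat_one_div_lt hδ
        exact ⟨n, hd.mono (Metric.self_subset_thickening hδ _) (Metric.thickening_mono hn.le _)⟩
      · rintro ⟨n, hn⟩
        exact disjoint_compl_right_iff_subset.1
          (hn.mono_right (Metric.self_subset_thickening (by positivity) _))
    rw [h1]
    exact .iUnion fun n => (h _ Metric.isOpen_thickening).compl
  · exact h U hU

lemma isClosed_setOf_extends_mem {C : Set CadlagPath} (hC : IsClosed C) :
    IsClosed {f : CadlagPath | ∃ g ∈ C, f.Extends g} := by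
  rw [isClosed_iff_ultrafilter]
  intro f U hU hmem
  have h1 : ∀ᶠ f in (U : Filter CadlagPath), ∃ g, g ∈ C ∧ f.Extends g := hmem
  obtain ⟨g, hg⟩ := h1.choice
  obtain ⟨k, hk, hfk⟩ := exists_tendsto_of_extends (f := fun f => f) hU (hg.mono fun _ h => h.2)
  exact ⟨k, hC.mem_of_tendsto hk (hg.mono fun _ h => h.1), hfk⟩

/-- Turns a condition on the restrictions into one that `A` itself hits a set not depending on `A`;
that set is closed if `C` is. -/
lemma restrict_inter_nonempty_iff {A C : Set CadlagPath} {z : SpaceTime} :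
    (restrict A {z} ∩ C).Nonempty ↔
      (A ∩ {f | ∃ g ∈ halfInfinite ∩ initialPoint ⁻¹' {z} ∩ C, f.Extends g}).Nonempty := by
  constructor
  · rintro ⟨g, ⟨hg, _, rfl, f, hf, hfg, hgz⟩, hgC⟩
    exact ⟨f, hf.1, g, ⟨⟨hg, hgz⟩, hgC⟩, hfg⟩
  · rintro ⟨f, hf, g, ⟨⟨hg, rfl⟩, hgC⟩, hfg⟩
    exact ⟨g, ⟨hg, _, rfl, f, ⟨hf, hfg.graph_subset g.initialPoint_mem_graph⟩, hfg, rfl⟩, hgC⟩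

lemma isClosed_restrict_inter_nonempty {C : Set CadlagPath} (hC : IsClosed C) (z : SpaceTime) :
    IsClosed {A : PathSets | (restrict (A : Set CadlagPath) {z} ∩ C).Nonempty} := by
  simp_rw [restrict_inter_nonempty_iff]
  exact NonemptyCompacts.isClosed_inter_nonempty_of_isClosed (isClosed_setOf_extends_mem
    ((isClosed_halfInfinite.inter (isClosed_singleton.preimage continuous_initialPoint)).inter hC))

lemma webOn_inter_nonempty_iff {A U : Set CadlagPath} {D : Set SpaceTime} (hU : IsOpen U) :
    (webOn D A ∩ U).Nonempty ↔
      ∃ z ∈ D, (restrict A {z} ∩ {f | ∃ g ∈ halfInfinite ∩ U, f.Extends g}).Nonempty := by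
  rw [webOn, closure_inter_open_nonempty_iff hU, restrict_eq_biUnion]
  constructor
  · rintro ⟨g, ⟨hg, f, hf, hfg⟩, hgU⟩
    obtain ⟨z, hz, hf⟩ := mem_iUnion₂.1 hf
    exact ⟨z, hz, f, hf, g, ⟨hg, hgU⟩, hfg⟩
  · rintro ⟨z, hz, f, hf, g, ⟨hg, hgU⟩, hfg⟩
    exact ⟨g, ⟨hg, f, mem_iUnion₂.2 ⟨z, hz, hf⟩, hfg⟩, hgU⟩

/-- The closure in `webOn` does not matter for hitting an open set, and `U` is a countable union of
closed sets, each of which gives closed events. -/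
lemma measurableSet_webOn_inter_nonempty {D : Set SpaceTime} (hD : D.Countable)
    {U : Set CadlagPath} (hU : IsOpen U) :
    MeasurableSet {A : PathSets | (webOn D (A : Set CadlagPath) ∩ U).Nonempty} := by
  let _ := upgradeIsCompletelyMetrizable CadlagPath
  obtain ⟨C, hC, -, hCU, -⟩ := hU.exists_iUnion_isClosed
  have h1 : {A : PathSets | (webOn D (A : Set CadlagPath) ∩ U).Nonempty} =
      ⋃ z ∈ D, ⋃ n, {A : PathSets | (restrict (A : Set CadlagPath) {z} ∩
        {f | ∃ g ∈ halfInfinite ∩ C n, f.Extends g}).Nonempty} := by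
    ext A
    rw [mem_ofPred_eq, webOn_inter_nonempty_iff hU]
    simp only [mem_ofPred_eq, mem_iUnion, ← hCU]
    constructor
    · rintro ⟨z, hz, f, hf, g, ⟨hg, hgC⟩, hfg⟩
      obtain ⟨n, hn⟩ := mem_iUnion.1 hgC
      exact ⟨z, hz, n, f, hf, g, ⟨hg, hn⟩, hfg⟩
    · rintro ⟨z, hz, n, f, hf, g, ⟨hg, hn⟩, hfg⟩
      exact ⟨z, hz, f, hf, g, ⟨hg, mem_iUnion.2 ⟨n, hn⟩⟩, hfg⟩
  rw [h1]
  exact .biUnion hD fun z _ => .iUnion fun n => (isClosed_restrict_inter_nonempty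
    (isClosed_setOf_extends_mem (isClosed_halfInfinite.inter (hC n))) z).measurableSet

/-- Joint measurability, needed for Fubini. Incomparability is an open relation, hence a countable
union of closed sets `C n`, and having a pair in `C n` through `z` is a closed condition on `(A, z)`
by compactness of `A`. -/
lemma measurableSet_ramified :
    MeasurableSet {p : PathSets × (ℝ × ℝ) | ¬ NonRamified (p.1 : Set CadlagPath) (ofPlane p.2)} := by
  let _ := upgradeIsCompletelyMetrizable CadlagPath
  have hO : IsOpen {p : CadlagPath × CadlagPath | ¬ (p.2.Extends p.1 ∨ p.1.Extends p.2)} := by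
    rw [← isClosed_compl_iff, isClosed_iff_ultrafilter]
    intro p U hU hmem
    have h1 : ∀ᶠ p in (U : Filter (CadlagPath × CadlagPath)), p.2.Extends p.1 ∨ p.1.Extends p.2 :=
      Filter.mem_of_superset hmem fun p hp => not_not.1 hp
    have hf := (continuous_fst.tendsto p).comp hU
    have hg := (continuous_snd.tendsto p).comp hU
    rw [Ultrafilter.eventually_or] at h1
    exact not_not.2 (h1.imp (extends_of_tendsto hg hf) (extends_of_tendsto hf hg))
  obtain ⟨C, hC, -, hCU, -⟩ := hO.exists_iUnion_isClosed
  have h1 : {p : PathSets × (ℝ × ℝ) | ¬ NonRamified (p.1 : Set CadlagPath) (ofPlane p.2)} =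
      ⋃ n, {p : PathSets × (ℝ × ℝ) | ∃ f ∈ through (p.1 : Set CadlagPath) (ofPlane p.2),
        ∃ g ∈ through (p.1 : Set CadlagPath) (ofPlane p.2), (f, g) ∈ C n} := by
    ext p
    have h2 : ∀ f g : CadlagPath, ¬ (g.Extends f ∨ f.Extends g) ↔ ∃ n, (f, g) ∈ C n := fun f g => by
      rw [← mem_iUnion, hCU]; rfl
    simp only [NonRamified, mem_ofPred_eq, not_forall, h2, mem_iUnion, exists_prop]
    grind
  rw [h1]
  refine .iUnion fun n => IsClosed.measurableSet ?_
  rw [isClosed_iff_ultrafilter]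
  intro p U hU hmem
  have h3 : ∀ᶠ p in (U : Filter (PathSets × (ℝ × ℝ))),
      ∃ f, f ∈ through (p.1 : Set CadlagPath) (ofPlane p.2) ∧
        ∃ g ∈ through (p.1 : Set CadlagPath) (ofPlane p.2), (f, g) ∈ C n := hmem
  obtain ⟨f, hf⟩ := h3.choice
  obtain ⟨g, hg⟩ := (hf.mono fun _ h => h.2).choice
  have hA : Tendsto (fun p : PathSets × (ℝ × ℝ) => p.1) U (𝓝 p.1) := (continuous_fst.tendsto p).comp hU
  have hz : Tendsto (fun p : PathSets × (ℝ × ℝ) => ofPlane p.2) U (𝓝 (ofPlane p.2)) :=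
    ((continuous_ofPlane.comp continuous_snd).tendsto p).comp hU
  obtain ⟨f₀, hf₀, hflim⟩ := exists_tendsto_mem_compacts hA (hf.mono fun _ h => h.1.1)
  obtain ⟨g₀, hg₀, hglim⟩ := exists_tendsto_mem_compacts hA (hg.mono fun _ h => h.1.1)
  exact ⟨f₀, ⟨hf₀, mem_graph_of_tendsto_path hflim hz (hf.mono fun _ h => h.1.2)⟩, g₀,
    ⟨hg₀, mem_graph_of_tendsto_path hglim hz (hg.mono fun _ h => h.1.2)⟩,
    (hC n).mem_of_tendsto (hflim.prodMk_nhds hglim) (hg.mono fun _ h => h.2)⟩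

/-! ### Random weaves -/

namespace IsWeave

variable {μ : Measure PathSets}

lemma isWeaveSet (hμ : IsWeave μ) : ∀ᵐ A : PathSets ∂μ, IsWeaveSet (A : Set CadlagPath) := by
  filter_upwards [hμ.half_infinite, hμ.pervasive, hμ.non_crossing] with A h1 h2 h3
  exact ⟨A.isCompact, h1, h2, h3⟩

/-- Almost all points of the plane are almost surely non-ramified. -/
lemma ae_ae_nonRamified (hμ : IsWeave μ) :
    ∀ᵐ p : ℝ × ℝ, ∀ᵐ A : PathSets ∂μ, NonRamified (A : Set CadlagPath) (ofPlane p) := by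
  have := hμ.prob
  have hm : MeasurableSet {p : PathSets × (ℝ × ℝ) |
      NonRamified (p.1 : Set CadlagPath) (ofPlane p.2)} := by
    simpa only [compl_ofPred, not_not] using measurableSet_ramified.compl
  -- After exchanging the quantifiers the weave is fixed, and a second exchange reduces the claim to
  -- slices at fixed times, which are countable for almost all times.
  refine (Measure.ae_ae_comm (p := fun (A : PathSets) p =>
    NonRamified (A : Set CadlagPath) (ofPlane p)) hm).1 ?_
  filter_upwards [hμ.half_infinite, hμ.non_crossing] with A hA hNC
  have hmA : MeasurableSet {p : ℝ × ℝ | NonRamified (A : Set CadlagPath) (ofPlane p)} :=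
    hm.preimage measurable_prodMk_left
  rw [Measure.volume_eq_prod, Measure.ae_prod_iff_ae_ae hmA, Measure.ae_ae_comm hmA]
  obtain ⟨T, hT, h⟩ := hasCountableSlices_ramified hA hNC
  filter_upwards [hT.ae_notMem volume] with t ht
  filter_upwards [((h t ht).preimage EReal.coe_injective).ae_notMem volume] with x hx
  exact not_not.1 hx

lemma exists_countable_dense_nonRamified {ν : Measure PathSets} (hμ : IsWeave μ)
    (hν : IsWeave ν) : ∃ D : Set (ℝ × ℝ), D.Countable ∧ Dense D ∧
      AENonRamified μ (ofPlane '' D) ∧ AENonRamified ν (ofPlane '' D) := by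
  have hd := Measure.dense_of_ae (hμ.ae_ae_nonRamified.and hν.ae_ae_nonRamified)
  obtain ⟨D, hD, hDc, hDd⟩ := hd.exists_countable_dense_subset
  refine ⟨D, hDc, hDd, ?_, ?_⟩
  · rw [AENonRamified, ae_ball_iff (hDc.image _)]
    rintro _ ⟨p, hp, rfl⟩
    exact (hD hp).1
  · rw [AENonRamified, ae_ball_iff (hDc.image _)]
    rintro _ ⟨p, hp, rfl⟩
    exact (hD hp).2

/-- The set of points in `web` is random and uncountable; it may be replaced by a deterministic
countable dense set that is almost surely non-ramified, for which hitting events are measurable. -/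
lemma exists_measurable_webVersion (hμ : IsWeave μ) :
    ∃ F : PathSets → PathSets, Measurable F ∧ IsWebVersion μ F := by
  classical
  have := hμ.prob
  have : Nonempty PathSets := μ.nonempty_of_neZero
  obtain ⟨D, hDc, hDd, hD, -⟩ := hμ.exists_countable_dense_nonRamified hμ
  let F : PathSets → PathSets := fun A =>
    if h : (webOn (ofPlane '' D) (A : Set CadlagPath)).Nonempty then
      ⟨⟨webOn (ofPlane '' D) A, isCompact_webOn A.isCompact _⟩, h⟩ else Classical.arbitrary _
  refine ⟨F, measurable_of_inter_nonempty fun U hU => ?_, ?_⟩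
  · have h1 : {A | ((F A : Set CadlagPath) ∩ U).Nonempty} =
        {A : PathSets | (webOn (ofPlane '' D) (A : Set CadlagPath) ∩ U).Nonempty} ∪
        ({A : PathSets | (webOn (ofPlane '' D) (A : Set CadlagPath) ∩ univ).Nonempty}ᶜ ∩
          {_A | ((Classical.arbitrary PathSets : Set CadlagPath) ∩ U).Nonempty}) := by
      ext A
      by_cases h : (webOn (ofPlane '' D) (A : Set CadlagPath)).Nonempty
      · have h2 : (F A : Set CadlagPath) = webOn (ofPlane '' D) (A : Set CadlagPath) := by
          simp only [F, dif_pos h]; rfl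
        simp [h, h2]
      · have h2 : F A = Classical.arbitrary PathSets := by simp only [F, dif_neg h]
        simp [h2, not_nonempty_iff_eq_empty.1 h]
    rw [h1]
    exact (measurableSet_webOn_inter_nonempty (hDc.image _) hU).union
      ((measurableSet_webOn_inter_nonempty (hDc.image _) isOpen_univ).compl.inter (.const _))
  · filter_upwards [hμ.isWeaveSet, hD] with A hA hDA
    have hd := dense_ofPlane_image hDd
    obtain ⟨k, hk, -⟩ := hA.exists_mem_webOn hd bot
    have h : (webOn (ofPlane '' D) (A : Set CadlagPath)).Nonempty := ⟨k, hk⟩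
    rw [hA.web_eq_webOn hDA hd]
    simp only [F, dif_pos h]
    rfl

/-- For a singleton, lying in a closed set `C` is the same as hitting `C`, which is a closed event.
-/
lemma exists_measurable_motionVersion {ι : Type*} [Countable ι] (hμ : IsWeave μ)
    {z : ι → SpaceTime} (hz : AENonRamified μ (range z)) :
    ∃ F : PathSets → ι → CadlagPath, Measurable F ∧
      ∀ᵐ A : PathSets ∂μ, ∀ i, restrict (A : Set CadlagPath) {z i} = {F A i} := by
  classical
  have hae : ∀ᵐ A : PathSets ∂μ, ∀ i, ∃ p, restrict (A : Set CadlagPath) {z i} = {p} := by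
    filter_upwards [hμ.isWeaveSet, hz] with A hA hzA i
    exact hA.exists_restrict_eq (hzA _ (mem_range_self i))
  -- A measurable null set off which all restrictions are singletons; on it the version is constant.
  obtain ⟨S, hS, hSm, hSμ⟩ := exists_measurable_superset_of_null (ae_iff.1 hae)
  have hS' : ∀ A ∉ S, ∀ i, ∃ p, restrict (A : Set CadlagPath) {z i} = {p} := fun A hA =>
    not_not.1 fun h => hA (hS h)
  have := hμ.prob
  obtain ⟨A₀⟩ : Nonempty PathSets := μ.nonempty_of_neZero
  obtain ⟨f₀, -⟩ := A₀.nonempty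
  let F : PathSets → ι → CadlagPath := fun A i => if h : A ∉ S then (hS' A h i).choose else f₀
  have hF : ∀ A ∉ S, ∀ i, restrict (A : Set CadlagPath) {z i} = {F A i} := fun A hA i => by
    simp only [F, dif_pos hA]
    exact (hS' A hA i).choose_spec
  refine ⟨F, measurable_pi_iff.2 fun i => measurable_of_isClosed fun C hC => ?_, ?_⟩
  · have h1 : (fun A => F A i) ⁻¹' C =
        (Sᶜ ∩ {A : PathSets | (restrict (A : Set CadlagPath) {z i} ∩ C).Nonempty}) ∪
        (S ∩ {_A | f₀ ∈ C}) := by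
      ext A
      by_cases hA : A ∈ S
      · simp [F, hA]
      · simp [hA, hF A hA i]
    rw [h1]
    exact (hSm.compl.inter (isClosed_restrict_inter_nonempty hC _).measurableSet).union
      (hSm.inter (.const _))
  · filter_upwards [measure_eq_zero_iff_ae_notMem.1 hSμ] with A hA
    exact hF A hA

end IsWeave

end Weaves

/-! ### Couplings -/

section Coupling

variable {X Y W : Type*} [MeasurableSpace X] [MeasurableSpace Y] [MeasurableSpace W]
  {μ : Measure X} {ν : Measure Y} {F : X → W} {G : Y → W}

/-- Random variables with the same law can be coupled so that they are equal. -/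
theorem ProbabilityTheory.IdentDistrib.exists_coupling [StandardBorelSpace X] [StandardBorelSpace Y]
    [MeasurableEq W] [IsProbabilityMeasure μ] [IsProbabilityMeasure ν]
    (h : IdentDistrib F G μ ν) :
    ∃ ρ : Measure (X × Y), ρ.map Prod.fst = μ ∧ ρ.map Prod.snd = ν ∧
      ∀ᵐ p ∂ρ, F p.1 = G p.2 := by
  wlog hFG : Measurable F ∧ Measurable G generalizing F G
  · obtain ⟨hF, hG, hmap⟩ := h
    obtain ⟨ρ, h1, h2, h3⟩ := this (F := hF.mk F) (G := hG.mk G)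
      ⟨hF.measurable_mk.aemeasurable, hG.measurable_mk.aemeasurable, by
        rw [← Measure.map_congr hF.ae_eq_mk, hmap, Measure.map_congr hG.ae_eq_mk]⟩
      ⟨hF.measurable_mk, hG.measurable_mk⟩
    refine ⟨ρ, h1, h2, ?_⟩
    have h4 : ∀ᵐ x ∂ρ.map Prod.fst, F x = hF.mk F x := by rw [h1]; exact hF.ae_eq_mk
    have h5 : ∀ᵐ y ∂ρ.map Prod.snd, G y = hG.mk G y := by rw [h2]; exact hG.ae_eq_mk
    filter_upwards [h3, ae_of_ae_map measurable_fst.aemeasurable h4,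
      ae_of_ae_map measurable_snd.aemeasurable h5] with p h4 h5 h6
    rw [h5, h4, h6]
  obtain ⟨hF, hG⟩ := hFG
  have : Nonempty X := μ.nonempty_of_neZero
  have : Nonempty Y := ν.nonempty_of_neZero
  have : IsProbabilityMeasure (μ.map F) := Measure.isProbabilityMeasure_map hF.aemeasurable
  -- Given the common value `w`, the two variables are drawn independently from their conditional
  -- laws. Each of them, jointly with `w`, then has the law it has jointly with its own image, so
  -- both images are almost surely equal to `w`.
  let κ := condDistrib id F μ
  let η := condDistrib id G ν
  let π : Measure (W × (X × Y)) := μ.map F ⊗ₘ (κ ×ₖ η)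
  have h1 : π.map (Prod.map id Prod.fst) = μ.map fun x => (F x, x) := by
    rw [← Measure.compProd_map measurable_fst, ← Kernel.fst_eq, Kernel.fst_prod,
      compProd_map_condDistrib aemeasurable_id]
    rfl
  have h2 : π.map (Prod.map id Prod.snd) = ν.map fun y => (G y, y) := by
    rw [← Measure.compProd_map measurable_snd, ← Kernel.snd_eq, Kernel.snd_prod, h.map_eq,
      compProd_map_condDistrib aemeasurable_id]
    rfl
  have h3 : ∀ᵐ p ∂π, p.1 = F p.2.1 := by
    refine ae_of_ae_map (f := Prod.map id Prod.fst) (p := fun q : W × X => q.1 = F q.2)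
      (by fun_prop) ?_
    rw [h1, ae_map_iff (by fun_prop) (measurableSet_eq_fun measurable_fst (by fun_prop))]
    exact .of_forall fun _ => rfl
  have h4 : ∀ᵐ p ∂π, p.1 = G p.2.2 := by
    refine ae_of_ae_map (f := Prod.map id Prod.snd) (p := fun q : W × Y => q.1 = G q.2)
      (by fun_prop) ?_
    rw [h2, ae_map_iff (by fun_prop) (measurableSet_eq_fun measurable_fst (by fun_prop))]
    exact .of_forall fun _ => rfl
  refine ⟨π.map Prod.snd, ?_, ?_, ?_⟩
  · have h5 := congrArg (Measure.map Prod.snd) h1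
    rw [Measure.map_map (by fun_prop) (by fun_prop), Measure.map_map (by fun_prop) (by fun_prop)] at h5
    rw [Measure.map_map (by fun_prop) (by fun_prop)]
    exact h5.trans Measure.map_id
  · have h5 := congrArg (Measure.map Prod.snd) h2
    rw [Measure.map_map (by fun_prop) (by fun_prop), Measure.map_map (by fun_prop) (by fun_prop)] at h5
    rw [Measure.map_map (by fun_prop) (by fun_prop)]
    exact h5.trans Measure.map_id
  · rw [ae_map_iff (by fun_prop) (measurableSet_eq_fun (by fun_prop) (by fun_prop))]
    filter_upwards [h3, h4] with p h5 h6
    rw [← h5, h6]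

lemma ProbabilityTheory.identDistrib_of_coupling {ρ : Measure (X × Y)} (h1 : ρ.map Prod.fst = μ)
    (h2 : ρ.map Prod.snd = ν) (hF : Measurable F) (hG : Measurable G)
    (h : ∀ᵐ p ∂ρ, F p.1 = G p.2) : IdentDistrib F G μ ν := by
  refine ⟨hF.aemeasurable, hG.aemeasurable, ?_⟩
  rw [← h1, ← h2, Measure.map_map hF measurable_fst, Measure.map_map hG measurable_snd]
  exact Measure.map_congr h

end Coupling

namespace Weaves

open SpaceTime CadlagPath

/-! ### The equivalences: deterministic results under couplings -/

variable {μ ν : Measure PathSets}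

lemma IsWeave.ae_coupling (hμ : IsWeave μ) (hν : IsWeave ν) {ρ : Measure (PathSets × PathSets)}
    (h1 : ρ.map Prod.fst = μ) (h2 : ρ.map Prod.snd = ν) :
    ∀ᵐ p : PathSets × PathSets ∂ρ, IsWeaveSet (p.1 : Set CadlagPath) ∧
      IsWeaveSet (p.2 : Set CadlagPath) :=
  (ae_of_ae_map measurable_fst.aemeasurable (h1.symm ▸ hμ.isWeaveSet)).and
    (ae_of_ae_map measurable_snd.aemeasurable (h2.symm ▸ hν.isWeaveSet))

lemma WeaveEquiv.nonCrossingCoupling (hμ : IsWeave μ) (hν : IsWeave ν) (h : WeaveEquiv μ ν) :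
    NonCrossingCoupling μ ν := by
  have := hμ.prob
  have := hν.prob
  obtain ⟨F, G, hF, hG, hFG⟩ := h
  obtain ⟨ρ, h1, h2, h3⟩ := hFG.exists_coupling
  refine ⟨ρ, h1, h2, ?_⟩
  filter_upwards [h3, hμ.ae_coupling hν h1 h2, ae_of_ae_map measurable_fst.aemeasurable (h1.symm ▸ hF),
    ae_of_ae_map measurable_snd.aemeasurable (h2.symm ▸ hG)] with p h4 h5 h6 h7
  exact h5.1.nonCrossing_of_web_eq h5.2 (by rw [← h6, ← h7, h4])

lemma NonCrossingCoupling.weaveEquiv (hμ : IsWeave μ) (hν : IsWeave ν)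
    (h : NonCrossingCoupling μ ν) : WeaveEquiv μ ν := by
  obtain ⟨ρ, h1, h2, h3⟩ := h
  obtain ⟨F, hFm, hF⟩ := hμ.exists_measurable_webVersion
  obtain ⟨G, hGm, hG⟩ := hν.exists_measurable_webVersion
  refine ⟨F, G, hF, hG, identDistrib_of_coupling h1 h2 hFm hGm ?_⟩
  filter_upwards [h3, hμ.ae_coupling hν h1 h2, ae_of_ae_map measurable_fst.aemeasurable (h1.symm ▸ hF),
    ae_of_ae_map measurable_snd.aemeasurable (h2.symm ▸ hG)] with p h4 h5 h6 h7
  exact SetLike.coe_injective (by rw [h6, h7, h5.1.web_eq_of_nonCrossing h5.2 h4])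

lemma NonCrossingCoupling.sameMotion (hμ : IsWeave μ) (hν : IsWeave ν)
    (h : NonCrossingCoupling μ ν) {m : ℕ} {z : Fin m → SpaceTime}
    (hzμ : AENonRamified μ (range z)) (hzν : AENonRamified ν (range z)) : SameMotion μ ν z := by
  obtain ⟨ρ, h1, h2, h3⟩ := h
  obtain ⟨F, hFm, hF⟩ := hμ.exists_measurable_motionVersion hzμ
  obtain ⟨G, hGm, hG⟩ := hν.exists_measurable_motionVersion hzν
  refine ⟨F, G, hF, hG, identDistrib_of_coupling h1 h2 hFm hGm ?_⟩
  filter_upwards [h3, hμ.ae_coupling hν h1 h2,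
    ae_of_ae_map measurable_fst.aemeasurable (h1.symm ▸ hF.and hzμ),
    ae_of_ae_map measurable_snd.aemeasurable (h2.symm ▸ hG.and hzν)] with p h4 h5 h6 h7
  funext i
  rw [← singleton_eq_singleton_iff, ← h6.1, ← h7.1]
  exact h5.1.restrict_eq_of_web_eq h5.2 (h5.1.web_eq_of_nonCrossing h5.2 h4)
    (h6.2 _ (mem_range_self i)) (h7.2 _ (mem_range_self i))

/-- Equality in law of all finite particle motions gives equality in law of the particle motion from
countably many points. -/
lemma identDistrib_of_sameMotion [IsProbabilityMeasure μ] [IsProbabilityMeasure ν] {ι : Type*}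
    {z : ι → SpaceTime} {F G : PathSets → ι → CadlagPath} (hFm : Measurable F) (hGm : Measurable G)
    (hF : ∀ᵐ A : PathSets ∂μ, ∀ i, restrict (A : Set CadlagPath) {z i} = {F A i})
    (hG : ∀ᵐ A : PathSets ∂ν, ∀ i, restrict (A : Set CadlagPath) {z i} = {G A i})
    (h : ∀ (m : ℕ) (e : Fin m → ι), SameMotion μ ν (z ∘ e)) : IdentDistrib F G μ ν := by
  refine ⟨hFm.aemeasurable, hGm.aemeasurable, ?_⟩
  have : IsProbabilityMeasure (ν.map G) := Measure.isProbabilityMeasure_map hGm.aemeasurable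
  -- Both laws are projective limits of the finite-dimensional marginals of `G`.
  refine IsProjectiveLimit.unique (P := fun I => (ν.map G).map I.restrict) (fun I => ?_)
    (fun I => rfl)
  let e : Fin I.card ≃ I := I.equivFin.symm
  obtain ⟨F', G', hF', hG', hFG⟩ := h I.card fun i => e i
  have h1 : F' =ᵐ[μ] fun A i => F A (e i) := by
    filter_upwards [hF, hF'] with A h2 h3
    funext i
    rw [← singleton_eq_singleton_iff, ← h2, ← h3]
    rfl
  have h2 : G' =ᵐ[ν] fun A i => G A (e i) := by
    filter_upwards [hG, hG'] with A h2 h3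
    funext i
    rw [← singleton_eq_singleton_iff, ← h2, ← h3]
    rfl
  have h3 : (μ.map fun A i => F A (e i)) = ν.map fun A i => G A (e i) := by
    rw [← Measure.map_congr h1, ← Measure.map_congr h2, hFG.map_eq]
  have h4 := congrArg (Measure.map fun (x : Fin I.card → CadlagPath) (j : I) => x (e.symm j)) h3
  rw [Measure.map_map (by fun_prop) (by fun_prop), Measure.map_map (by fun_prop) (by fun_prop)] at h4
  beta_reduce
  rw [Measure.map_map (by fun_prop) hFm, Measure.map_map (by fun_prop) hGm]
  convert h4 using 2 <;> · funext A j; simp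

/-- The motion from the whole countable set `D` is a random element with the same law for both
weaves; under a coupling that makes the two motions equal, the webs generated from `D` are equal. -/
lemma nonCrossingCoupling_of_sameMotion (hμ : IsWeave μ) (hν : IsWeave ν) {D : Set (ℝ × ℝ)}
    (hDc : D.Countable) (hDd : Dense D) (hDμ : AENonRamified μ (ofPlane '' D))
    (hDν : AENonRamified ν (ofPlane '' D))
    (h : ∀ (m : ℕ) (z : Fin m → ℝ × ℝ), (∀ i, z i ∈ D) → SameMotion μ ν fun i => ofPlane (z i)) :
    NonCrossingCoupling μ ν := by
  have := hμ.prob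
  have := hν.prob
  have := hDc.to_subtype
  have hr : range (fun p : D => ofPlane p) = ofPlane '' D := by
    rw [image_eq_range]
  obtain ⟨F, hFm, hF⟩ := hμ.exists_measurable_motionVersion (hr.symm ▸ hDμ)
  obtain ⟨G, hGm, hG⟩ := hν.exists_measurable_motionVersion (hr.symm ▸ hDν)
  obtain ⟨ρ, h1, h2, h3⟩ := (identDistrib_of_sameMotion hFm hGm hF hG
    fun m e => h m (fun i => e i) fun i => (e i).2).exists_coupling
  refine ⟨ρ, h1, h2, ?_⟩
  filter_upwards [h3, hμ.ae_coupling hν h1 h2,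
    ae_of_ae_map measurable_fst.aemeasurable (h1.symm ▸ hF.and hDμ),
    ae_of_ae_map measurable_snd.aemeasurable (h2.symm ▸ hG.and hDν)] with p h4 h5 h6 h7
  refine h5.1.nonCrossing_of_web_eq h5.2 ?_
  have hd := dense_ofPlane_image hDd
  rw [h5.1.web_eq_webOn h6.2 hd, h5.2.web_eq_webOn h7.2 hd]
  refine webOn_congr ?_
  rintro _ ⟨q, hq, rfl⟩
  rw [h6.1 ⟨q, hq⟩, h7.1 ⟨q, hq⟩, h4]

end Weaves

theorem theorem2p6 (μ ν : Measure Weaves.PathSets)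
    (hμ : Weaves.IsWeave μ) (hν : Weaves.IsWeave ν) :
    (Weaves.WeaveEquiv μ ν → ∀ (m : ℕ) (z : Fin m → Weaves.SpaceTime),
      Weaves.AENonRamified μ (Set.range z) → Weaves.AENonRamified ν (Set.range z) →
        Weaves.SameMotion μ ν z) ∧
    List.TFAE [
      Weaves.WeaveEquiv μ ν,
      Weaves.NonCrossingCoupling μ ν,
      ∃ D : Set (ℝ × ℝ), D.Countable ∧ Dense D ∧
        Weaves.AENonRamified μ (Weaves.ofPlane '' D) ∧
        Weaves.AENonRamified ν (Weaves.ofPlane '' D) ∧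
        ∀ (m : ℕ) (z : Fin m → ℝ × ℝ), (∀ i, z i ∈ D) →
          Weaves.SameMotion μ ν (fun i => Weaves.ofPlane (z i))] := by
  refine ⟨fun h m z hzμ hzν => (h.nonCrossingCoupling hμ hν).sameMotion hμ hν hzμ hzν, ?_⟩
  tfae_have 1 → 2 := fun h => h.nonCrossingCoupling hμ hν
  tfae_have 2 → 1 := fun h => h.weaveEquiv hμ hν
  tfae_have 2 → 3 := by
    intro h
    obtain ⟨D, hDc, hDd, hDμ, hDν⟩ := hμ.exists_countable_dense_nonRamified hν
    refine ⟨D, hDc, hDd, hDμ, hDν, fun m z hz => h.sameMotion hμ hν ?_ ?_⟩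
    · filter_upwards [hDμ] with A hA
      rintro _ ⟨i, rfl⟩
      exact hA _ ⟨_, hz i, rfl⟩
    · filter_upwards [hDν] with A hA
      rintro _ ⟨i, rfl⟩
      exact hA _ ⟨_, hz i, rfl⟩
  tfae_have 3 → 2 := fun ⟨D, hDc, hDd, hDμ, hDν, h⟩ =>
    Weaves.nonCrossingCoupling_of_sameMotion hμ hν hDc hDd hDμ hDν h
  tfae_finish
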